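/- **Setting.** Vertices are named by natural numbers, and $G$ is an arbitrary graph on the set $V$ of vertex names. A fully dynamic stream of vertex updates is a sequence of $M$ updates, each of which inserts a currently inactive vertex or deletes a currently active one; at the start no vertex is active. $G^t$ is the subgraph of $G$ induced by the vertices $V^t$ that are active after the $t$-th update, and $n$ is the maximum over $0\le t\le M$ of the number of active vertices. A random ranking is a map $\pi:V\to[0,1]$ whose values are independent and uniform. For a ranking $\pi$ and a finite graph $H$, $\mathrm{LFMIS}(H,\pi)$ is the set obtained by repeatedly selecting the remaining vertex of smallest rank and removing it together with its remaining neighbours; $\mathrm{LFMIS}_k(H,\pi)$ consists of its $\min\{k,|\mathrm{LFMIS}(H,\pi)|\}$ vertices of smallest rank. A top-$k$ LFMIS with leaders of $H=(V_H,E_H)$ is the set $\mathrm{LFMIS}_k(H,\pi)$ together with a map $\ell:V_H\to V_H\cup\{\bot\}$ such that $\{v,\ell(v)\}\in E_H$ whenever $\ell(v)\ne\bot$, such that $\ell(v)=\bot$ for all $v\in \mathrm{LFMIS}_k(H,\pi)$, and such that, if $\mathrm{LFMIS}_k(H,\pi)=\mathrm{LFMIS}(H,\pi)$, then $\ell(v)\in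 \mathrm{LFMIS}_k(H,\pi)$ for all $v\in V_H\setminus \mathrm{LFMIS}_k(H,\pi)$. The model of computation is a word RAM with unit-cost operations on words of $\Theta(\log(N+k+2))$ bits, where $N$ is the largest vertex name in the stream (a sufficiently large constant factor is allowed, and larger words do no harm). The graph can be accessed only through adjacency queries "is $\{u,v\}$ an edge of $G$?", and the ranks only through comparisons "is $\pi(u)<\pi(v)$?"; each takes one step. The algorithm receives $k$ at the start and then the updates one at a time; the set $\mathrm{LFMIS}_k$ is kept as an array of its elements together with its size, and $\ell$ as an array indexed by the vertices. **Theorem.** There are an algorithm and an absolute constant $C$ such that the following holds for every $k\ge 1$, every graph $G$ and every fully dynamic stream of $M$ vertex insertions and deletions, fixed independently of the ranking. 1. For every ranking $\pi$ without ties (hence almost surely for a random ranking), after each update $t$ the algorithm holds a top-$k$ LFMIS with leaders of $G^t$ under $\pi$. 2. For a random ranking $\pi$, the total running time on the stream is a measurable function of $\pi$ whose expectation is at most $C\,M\,\bigl(k\log(n+1)+\log^2(n+1)\bigr)$; that is, the expected amortized time per update is $O(k\log n+\log^2 n)$ (for $n\ge 2$). The algorithm is one fixed program, which is told neither $n$ nor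 $M$ in advance. -/

import Mathlib

open MeasureTheory
open scoped ENNReal

namespace DynLFMIS

noncomputable section

/-! ### Lexicographically first maximal independent sets -/

section Graph

variable {V : Type*}

/-- The vertex of smallest rank in a nonempty finite vertex set. -/
def minRank (π : V → unitInterval) (A : Finset V) (hA : A.Nonempty) : V :=
  (A.exists_min_image π hA).choose

theorem minRank_mem (π : V → unitInterval) (A : Finset V) (hA : A.Nonempty) :
    minRank π A hA ∈ A :=
  (A.exists_min_image π hA).choose_spec.1

variable [DecidableEq V]

open Classical in
/-- The greedy process on the subgraph of `G` induced by the finite set `A` of alive vertices: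
select the alive vertex of smallest rank, kill it and its alive neighbours, and go on. -/
def lfmis (G : SimpleGraph V) (π : V → unitInterval) (A : Finset V) : Finset V :=
  if hA : A.Nonempty then
    insert (minRank π A hA)
      (lfmis G π (A.filter fun u => u ≠ minRank π A hA ∧ ¬ G.Adj (minRank π A hA) u))
  else ∅
termination_by A.card
decreasing_by
  exact Finset.card_lt_card
    (Finset.filter_ssubset.2 ⟨minRank π A hA, minRank_mem π A hA, fun h => h.1 rfl⟩)

/-- The first `min k |LFMIS|` vertices of the LFMIS in the order of the ranking: the members
that have fewer than `k` members of smaller rank. -/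
def topLFMIS (G : SimpleGraph V) (π : V → unitInterval) (A : Finset V) (k : ℕ) : Finset V :=
  (lfmis G π A).filter fun v => ((lfmis G π A).filter fun u => π u < π v).card < k

/-- `(S, ℓ)` is a top-`k` LFMIS with leaders of the subgraph of `G` induced by `A`
(`none` is the value `⊥` of the leader mapping). -/
structure IsTopLFMISWithLeaders (G : SimpleGraph V) (π : V → unitInterval) (A : Finset V)
    (k : ℕ) (S : Finset V) (ℓ : V → Option V) : Prop where
  set_eq : S = topLFMIS G π A k
  leader_adj : ∀ v ∈ A, ∀ u, ℓ v = some u → u ∈ A ∧ G.Adj v u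
  leader_mem : topLFMIS G π A k = lfmis G π A → ∀ v ∈ A, v ∉ S → ∃ u ∈ S, ℓ v = some u
  leader_bot : ∀ v ∈ S, ℓ v = none

end Graph

/-- The law of a random ranking: independent ranks, each uniform on `[0,1]`. -/
def rankingLaw : Measure (ℕ → unitInterval) :=
  Measure.infinitePi fun _ : ℕ => (volume : Measure unitInterval)

/-! ### Fully dynamic streams of vertex updates -/

/-- Vertices are named by natural numbers. -/
inductive Update where
  | ins (v : ℕ)
  | del (v : ℕ)

def Update.vertex : Update → ℕ
  | .ins v => v
  | .del v => v

def Update.apply (A : Finset ℕ) : Update → Finset ℕ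
  | .ins v => insert v A
  | .del v => A.erase v

/-- The active vertices after a stream of updates. -/
def active (L : List Update) : Finset ℕ := L.foldl Update.apply ∅

/-- From active set `A` on, only inactive vertices are inserted, only active ones deleted. -/
def ValidFrom : Finset ℕ → List Update → Prop
  | _, [] => True
  | A, .ins v :: L => v ∉ A ∧ ValidFrom (insert v A) L
  | A, .del v :: L => v ∈ A ∧ ValidFrom (A.erase v) L

def ValidStream (L : List Update) : Prop := ValidFrom ∅ L

/-- The maximum number of active vertices at any time. -/
def maxActive (L : List Update) : ℕ :=
  (Finset.range (L.length + 1)).sup fun t => (active (L.take t)).card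

/-! ### A word RAM with an adjacency oracle and ranks

A program has finitely many registers and finitely many arrays, all initially zero; arrays are
addressed by words. Words are the numbers below `W`, and a computation that overflows is stuck.
The graph can be accessed only by testing adjacency of two named vertices. Ranks are
real numbers and can only be compared; the rank of a vertex is drawn once, independently of
everything else, so the first access to it is a random draw. Every operation, memory access,
adjacency test and rank comparison costs one step. -/

structure State where
  reg : ℕ → ℕ
  arr : ℕ → ℕ → ℕ

inductive BinOp where
  | add | sub | mul | div

/-- Subtraction is truncated, division rounds down. -/
def BinOp.eval : BinOp → ℕ → ℕ → ℕ
  | .add, a, b => a + b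
  | .sub, a, b => a - b
  | .mul, a, b => a * b
  | .div, a, b => a / b

inductive Expr where
  | lit (n : ℕ)
  | reg (r : ℕ)
  | read (a : ℕ) (i : Expr)
  | bin (o : BinOp) (x y : Expr)

def Expr.eval (s : State) : Expr → ℕ
  | .lit n => n
  | .reg r => s.reg r
  | .read a i => s.arr a (i.eval s)
  | .bin o x y => o.eval (x.eval s) (y.eval s)

/-- No value that occurs in the evaluation overflows. -/
def Expr.Fits (W : ℕ) (s : State) : Expr → Prop
  | .lit n => n < W
  | .reg r => s.reg r < W
  | .read a i => i.Fits W s ∧ s.arr a (i.eval s) < W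
  | .bin o x y => x.Fits W s ∧ y.Fits W s ∧ o.eval (x.eval s) (y.eval s) < W

def Expr.cost : Expr → ℕ
  | .lit _ => 1
  | .reg _ => 1
  | .read _ i => i.cost + 1
  | .bin _ x y => x.cost + y.cost + 1

inductive Test where
  | lt (x y : Expr)
  | eq (x y : Expr)
  | adj (x y : Expr)
  | rankLt (x y : Expr)
  | not (b : Test)
  | and (b c : Test)

def Test.Holds (G : SimpleGraph ℕ) (π : ℕ → unitInterval) (s : State) : Test → Prop
  | .lt x y => x.eval s < y.eval s
  | .eq x y => x.eval s = y.eval s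
  | .adj x y => G.Adj (x.eval s) (y.eval s)
  | .rankLt x y => π (x.eval s) < π (y.eval s)
  | .not b => ¬ b.Holds G π s
  | .and b c => b.Holds G π s ∧ c.Holds G π s

def Test.Fits (W : ℕ) (s : State) : Test → Prop
  | .lt x y => x.Fits W s ∧ y.Fits W s
  | .eq x y => x.Fits W s ∧ y.Fits W s
  | .adj x y => x.Fits W s ∧ y.Fits W s
  | .rankLt x y => x.Fits W s ∧ y.Fits W s
  | .not b => b.Fits W s
  | .and b c => b.Fits W s ∧ c.Fits W s

def Test.cost : Test → ℕ
  | .lt x y => x.cost + y.cost + 1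
  | .eq x y => x.cost + y.cost + 1
  | .adj x y => x.cost + y.cost + 1
  | .rankLt x y => x.cost + y.cost + 1
  | .not b => b.cost + 1
  | .and b c => b.cost + c.cost + 1

inductive Program where
  | skip
  | assign (r : ℕ) (x : Expr)
  | write (a : ℕ) (i x : Expr)
  | seq (p q : Program)
  | ite (b : Test) (p q : Program)
  | while (b : Test) (p : Program)

def State.setReg (s : State) (r x : ℕ) : State :=
  { s with reg := Function.update s.reg r x }

def State.setArr (s : State) (a i x : ℕ) : State :=
  { s with arr := Function.update s.arr a (Function.update (s.arr a) i x) }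

/-- `Exec W G π p s t s₁`: with words below `W`, adjacency oracle `G` and ranks `π`, the program
`p` started in state `s` halts in state `s₁` after exactly `t` steps. -/
inductive Exec (W : ℕ) (G : SimpleGraph ℕ) (π : ℕ → unitInterval) :
    Program → State → ℕ → State → Prop where
  | skip (s : State) : Exec W G π .skip s 1 s
  | assign (s : State) (r : ℕ) (x : Expr) (hx : x.Fits W s) :
      Exec W G π (.assign r x) s (x.cost + 1) (s.setReg r (x.eval s))
  | write (s : State) (a : ℕ) (i x : Expr) (hi : i.Fits W s) (hx : x.Fits W s) :
      Exec W G π (.write a i x) s (i.cost + x.cost + 1) (s.setArr a (i.eval s) (x.eval s))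
  | seq {p q : Program} {s s₁ s₂ : State} {t₁ t₂ : ℕ}
      (hp : Exec W G π p s t₁ s₁) (hq : Exec W G π q s₁ t₂ s₂) :
      Exec W G π (.seq p q) s (t₁ + t₂) s₂
  | ite_true {b : Test} {p q : Program} {s s₁ : State} {t : ℕ}
      (hf : b.Fits W s) (hb : b.Holds G π s) (hp : Exec W G π p s t s₁) :
      Exec W G π (.ite b p q) s (b.cost + t) s₁
  | ite_false {b : Test} {p q : Program} {s s₁ : State} {t : ℕ}
      (hf : b.Fits W s) (hb : ¬ b.Holds G π s) (hq : Exec W G π q s t s₁) :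
      Exec W G π (.ite b p q) s (b.cost + t) s₁
  | while_true {b : Test} {p : Program} {s s₁ s₂ : State} {t₁ t₂ : ℕ}
      (hf : b.Fits W s) (hb : b.Holds G π s) (hp : Exec W G π p s t₁ s₁)
      (hw : Exec W G π (.while b p) s₁ t₂ s₂) :
      Exec W G π (.while b p) s (b.cost + t₁ + t₂) s₂
  | while_false {b : Test} {p : Program} {s : State}
      (hf : b.Fits W s) (hb : ¬ b.Holds G π s) :
      Exec W G π (.while b p) s b.cost s

/-! ### Dynamic algorithms

The parameter `k` is in register 0 at the start. At each update the vertex is put in register 1 and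
the sign (1 for an insertion, 0 for a deletion) in register 2, and the program is run on the
memory that the previous updates have left. -/

def initState (k : ℕ) : State where
  reg := Function.update (fun _ => 0) 0 k
  arr := fun _ _ => 0

def Update.load (s : State) : Update → State
  | .ins v => (s.setReg 1 v).setReg 2 1
  | .del v => (s.setReg 1 v).setReg 2 0

/-- `Run W G π p s L t s₁`: the program `p` processes, one by one, the updates of `L`, from memory
state `s` to memory state `s₁`, in exactly `t` steps in total. -/
inductive Run (W : ℕ) (G : SimpleGraph ℕ) (π : ℕ → unitInterval) (p : Program) :
    State → List Update → ℕ → State → Prop where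
  | nil (s : State) : Run W G π p s [] 0 s
  | cons {s s₁ s₂ : State} {u : Update} {L : List Update} {t₁ t₂ : ℕ}
      (hu : Exec W G π p (u.load s) t₁ s₁) (hL : Run W G π p s₁ L t₂ s₂) :
      Run W G π p s (u :: L) (t₁ + t₂) s₂

/-- The total running time on the stream `L` (infinite if the program does not process the whole
stream). The machine is deterministic once `π` is fixed, so at most one `t` occurs here. -/
def runTime (W : ℕ) (G : SimpleGraph ℕ) (π : ℕ → unitInterval) (p : Program) (k : ℕ)
    (L : List Update) : ℝ≥0∞ :=
  ⨅ (t : ℕ) (_ : ∃ s, Run W G π p (initState k) L t s), (t : ℝ≥0∞)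

/-- The maintained vertex set: array 0 holds its elements in cells `0, 1, …`, and register 3 holds
their number. -/
def State.outSet (s : State) : Finset ℕ := (Finset.range (s.reg 3)).image (s.arr 0)

/-- The maintained leader mapping: cell `v` of array 1 holds `0` for `⊥`, and `u + 1` for `u`. -/
def State.leader (s : State) (v : ℕ) : Option ℕ :=
  match s.arr 1 v with
  | 0 => none
  | u + 1 => some u

/-- The memory holds, listed without repetition, a top-`k` LFMIS of the subgraph induced by `A`,
together with leaders. -/
def Maintains (G : SimpleGraph ℕ) (π : ℕ → unitInterval) (A : Finset ℕ) (k : ℕ)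
    (s : State) : Prop :=
  s.outSet.card = s.reg 3 ∧ IsTopLFMISWithLeaders G π A k s.outSet s.leader

end

end DynLFMIS

/-! The algorithm keeps an independent set `S` of at most `k` active vertices and a queue `Q`
ordered by rank; every other active vertex follows a neighbour of smaller rank in `S ∪ Q`. It treats
the first vertex `q` of the queue again and again. If `q` has an earlier neighbour in `S`, it
releases its own followers to the queue and follows the earliest such neighbour. Otherwise a later
neighbour in `S` is moved to the queue. If `q` has no neighbour in `S` at all, it enters, at the
expense of the last vertex if `S` is full and `q` precedes that vertex; if it does not, the loop
stops.

Correctness is local. Below the ranks of the queue, `S` and the LFMIS obey the same recursion on the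
rank, hence agree (`Inv.mem_iff`); when the loop stops, this identifies `S` with the top-`k` LFMIS
(`Inv.topLFMIS_of_settled`).

For the running time, the state is compared with the true outcome, given by the eliminator of each
vertex: the member of the LFMIS whose selection kills it. Every round of the loop brings the state
closer to the eliminators, and `potential` measures the distance: a round lowers it by at least one,
and every released follower pays one more unit. A unit is worth O(k + log n) steps, for a scan of
`S` and a bounded number of updates of a tournament tree whose leaves are recycled slots. The
delicate move is the replacement, which throws out of `S` a vertex that may well belong to the
LFMIS; the set `O` of queue vertices that came from `S`, a device of the analysis only, shows that
such a vertex does not return by another replacement during the same run of the loop.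

An update raises the potential by a constant plus 6 for each vertex whose eliminator changes
(`potential_elim_insert`). The probabilistic core is that one inserted or deleted vertex changes the
eliminators of at most log n vertices in expectation (`sum_infect_le`, `card_elim_ne_le_infect`).
The vertices are met in random order, and `D` contains those whose state may differ between the two
greedy processes. A vertex met in `D` passes the doubt on to its neighbours; a vertex met among the
common vertices `C` is selected in both processes and removes its neighbours, doubtful or not. With
d = |D| and Y edges between `D` and `C`, the expected spread is at most d log(1 + Y/d), by induction
on the number of remaining vertices. Initially d = 1 and Y < n. Since the stream is fixed before the
ranking, the bounds for the single updates add up. -/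

namespace DynLFMIS

/-! ### The spread of a perturbation along a random order -/

section Infection

variable {V : Type*}

open Classical in
/-- The number of vertices that a difference between two greedy processes spreads to: `C` are the
vertices alive in both processes, `D` those whose state may differ, and the vertices are met in the
order of the list. -/
noncomputable def infect [DecidableEq V] (G : SimpleGraph V) : List V → Finset V → Finset V → ℕ
  | [], _, _ => 0
  | w :: l, C, D =>
    if w ∈ C then
      infect G l (C.filter fun u => u ≠ w ∧ ¬ G.Adj w u) (D.filter fun u => ¬ G.Adj w u)
    -- Pessimistic: all neighbours of `w` in `C` are counted, although `w` may turn out to be dead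
    -- in both processes.
    else if w ∈ D then
      (C.filter fun u => G.Adj w u).card +
        infect G l (C.filter fun u => ¬ G.Adj w u) (D.erase w ∪ C.filter fun u => G.Adj w u)
    else infect G l C D

/-- The enumerations of a finite set. -/
noncomputable def orders [DecidableEq V] (U : Finset V) : Finset (List V) := U.toList.permutations.toFinset

theorem mem_orders [DecidableEq V] {U : Finset V} {l : List V} : l ∈ orders U ↔ l.Nodup ∧ l.toFinset = U := by
  rw [orders, List.mem_toFinset, List.mem_permutations]
  constructor
  · intro h
    refine ⟨h.nodup_iff.2 U.nodup_toList, ?_⟩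
    rw [List.toFinset_eq_of_perm _ _ h, Finset.toList_toFinset]
  · rintro ⟨h, rfl⟩
    exact ((List.toFinset_toList h).symm)

theorem card_orders [DecidableEq V] (U : Finset V) : (orders U).card = U.card.factorial := by
  rw [orders, List.toFinset_card_of_nodup (List.nodup_permutations _ U.nodup_toList),
    List.length_permutations, Finset.length_toList]

/-- An enumeration is a first vertex followed by an enumeration of the rest. Up to the factor |U|!,
this is conditioning on the first vertex, the recursion on which `sum_infect_le` rests. -/
theorem sum_orders [DecidableEq V] {M : Type*} [AddCommMonoid M] {U : Finset V} (hU : U.Nonempty)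
    (f : List V → M) :
    ∑ l ∈ orders U, f l = ∑ w ∈ U, ∑ l ∈ orders (U.erase w), f (w :: l) := by
  have h : orders U = U.biUnion fun w => (orders (U.erase w)).image (List.cons w) := by
    ext l
    simp only [Finset.mem_biUnion, Finset.mem_image, mem_orders]
    constructor
    · rintro ⟨h, rfl⟩
      cases l with
      | nil => simp at hU
      | cons a l =>
        rw [List.nodup_cons] at h
        refine ⟨a, by simp, l, ⟨h.2, ?_⟩, rfl⟩
        rw [List.toFinset_cons, Finset.erase_insert (by simpa using h.1)]
    · rintro ⟨w, hw, l, ⟨h, h'⟩, rfl⟩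
      have : w ∉ l := by
        rw [← List.mem_toFinset, h']; simp
      refine ⟨List.nodup_cons.2 ⟨this, h⟩, ?_⟩
      rw [List.toFinset_cons, h', Finset.insert_erase hw]
  rw [h, Finset.sum_biUnion]
  · refine Finset.sum_congr rfl fun w _ => ?_
    rw [Finset.sum_image]
    intro a _ b _ hab
    exact (List.cons.inj hab).2
  · intro a _ b _ hab
    rw [Function.onFun, Finset.disjoint_left]
    intro l h1 h2
    simp only [Finset.mem_image] at h1 h2
    obtain ⟨l1, -, rfl⟩ := h1
    obtain ⟨l2, -, h2⟩ := h2
    exact hab (List.cons.inj h2).1.symm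

open Classical in
/-- The number of edges between two vertex sets, as a sum of degrees. -/
noncomputable def cross (G : SimpleGraph V) (D C : Finset V) : ℝ :=
  ∑ x ∈ D, ∑ u ∈ C, if G.Adj x u then 1 else 0

theorem cross_nonneg (G : SimpleGraph V) (D C : Finset V) : 0 ≤ cross G D C := by
  unfold cross; positivity

/-- The function (d, Y) ↦ d log(1 + Y/d) is concave and homogeneous, and the right side is its
tangent plane along the ray Y = q d. It makes the induction hypothesis linear in d and Y, so that it
can be summed over all choices of the first vertex. -/
theorem mul_log_le_tangent {q d Y : ℝ} (hq : 0 ≤ q) (hd : 0 ≤ d) (hY : 0 ≤ Y)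
    (h0 : d = 0 → Y = 0) :
    d * Real.log (1 + Y / d) ≤ d * (Real.log (1 + q) - q / (1 + q)) + Y / (1 + q) := by
  rcases hd.eq_or_lt with rfl | hd
  · simp [h0 rfl]
  have h1 : 0 < 1 + q := by linarith
  have h2 : 0 < 1 + Y / d := by positivity
  have h3 := Real.log_le_sub_one_of_pos (div_pos h2 h1)
  rw [Real.log_div h2.ne' h1.ne'] at h3
  have h4 : d * ((1 + Y / d) / (1 + q) - 1) = Y / (1 + q) - d * (q / (1 + q)) := by
    field_simp
    ring
  have h5 := mul_le_mul_of_nonneg_left h3 hd.le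
  rw [h4] at h5
  linarith

open Classical in
/-- The adjacency matrix, with real entries. -/
noncomputable def adjInd (G : SimpleGraph V) (x u : V) : ℝ := if G.Adj x u then 1 else 0

theorem adjInd_comm (G : SimpleGraph V) (x u : V) : adjInd G x u = adjInd G u x := by
  by_cases h : G.Adj x u
  · simp [adjInd, h, h.symm]
  · have h' : ¬ G.Adj u x := fun h' => h h'.symm
    simp [adjInd, h, h']

theorem adjInd_nonneg (G : SimpleGraph V) (x u : V) : 0 ≤ adjInd G x u := by
  unfold adjInd; positivity

theorem adjInd_mul_self (G : SimpleGraph V) (x u : V) :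
    adjInd G x u * adjInd G x u = adjInd G x u := by
  unfold adjInd; split_ifs <;> simp

open Classical in
theorem card_filter_adj (G : SimpleGraph V) (C : Finset V) (w : V) :
    ((C.filter fun u => G.Adj w u).card : ℝ) = ∑ u ∈ C, adjInd G w u := by
  simp [adjInd, Finset.sum_boole]

theorem cross_eq (G : SimpleGraph V) (D C : Finset V) :
    cross G D C = ∑ x ∈ D, ∑ u ∈ C, adjInd G x u := rfl

open Classical in
theorem sum_filter_adj (G : SimpleGraph V) (C : Finset V) (w : V) (f : V → ℝ) :
    ∑ u ∈ C.filter (fun u => G.Adj w u), f u = ∑ u ∈ C, adjInd G w u * f u := by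
  rw [Finset.sum_filter]
  exact Finset.sum_congr rfl fun u _ => by simp [adjInd]

open Classical in
theorem sum_filter_not_adj (G : SimpleGraph V) (C : Finset V) (w : V) (f : V → ℝ) :
    ∑ u ∈ C.filter (fun u => ¬ G.Adj w u), f u = ∑ u ∈ C, (1 - adjInd G w u) * f u := by
  rw [Finset.sum_filter]
  refine Finset.sum_congr rfl fun u _ => ?_
  by_cases h : G.Adj w u <;> simp [adjInd, h]

open Classical in
/-- The effect on the number of edges between `D` and `C` of meeting a vertex of `D`. -/
theorem cross_infected_le [DecidableEq V] (G : SimpleGraph V) {C D : Finset V} (hCD : Disjoint C D) {w : V}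
    (hw : w ∈ D) :
    cross G (D.erase w ∪ C.filter fun u => G.Adj w u) (C.filter fun u => ¬ G.Adj w u) ≤
      cross G D C - ∑ u ∈ C, adjInd G w u +
        ∑ x ∈ C, ∑ u ∈ C, adjInd G w x * ((1 - adjInd G w u) * adjInd G x u) := by
  have hdis : Disjoint (D.erase w) (C.filter fun u => G.Adj w u) :=
    (hCD.symm.mono_left (Finset.erase_subset _ _)).mono_right (Finset.filter_subset _ _)
  rw [cross_eq, Finset.sum_union hdis, sum_filter_adj]
  -- The old edges: those at `w` disappear; the shrinking of `C` can only remove more, whence an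
  -- inequality.
  have h1 : ∑ x ∈ D.erase w, ∑ u ∈ C.filter (fun u => ¬ G.Adj w u), adjInd G x u ≤
      cross G D C - ∑ u ∈ C, adjInd G w u := by
    rw [cross_eq, ← Finset.sum_erase_add D _ hw, add_sub_cancel_right]
    refine Finset.sum_le_sum fun x _ => ?_
    exact Finset.sum_le_sum_of_subset_of_nonneg (Finset.filter_subset _ _)
      fun u _ _ => adjInd_nonneg G x u
  have h2 : ∑ x ∈ C, adjInd G w x * ∑ u ∈ C.filter (fun u => ¬ G.Adj w u), adjInd G x u =
      ∑ x ∈ C, ∑ u ∈ C, adjInd G w x * ((1 - adjInd G w u) * adjInd G x u) := by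
    refine Finset.sum_congr rfl fun x _ => ?_
    rw [sum_filter_not_adj, Finset.mul_sum]
  rw [h2]
  linarith

open Classical in
/-- The effect on the number of edges between `D` and `C` of meeting a vertex of `C`. -/
theorem cross_killed_eq [DecidableEq V] (G : SimpleGraph V) {C D : Finset V} {w : V} (hw : w ∈ C) :
    cross G (D.filter fun u => ¬ G.Adj w u) (C.filter fun u => u ≠ w ∧ ¬ G.Adj w u) =
      cross G D C - ∑ x ∈ D, ∑ u ∈ C, adjInd G x w * adjInd G x u -
        ∑ x ∈ D, ∑ u ∈ C, (1 - adjInd G x w) * (adjInd G x u * adjInd G u w) := by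
  rw [cross_eq, sum_filter_not_adj, cross_eq, ← Finset.sum_sub_distrib, ← Finset.sum_sub_distrib]
  refine Finset.sum_congr rfl fun x _ => ?_
  have h1 : ∑ u ∈ C.filter (fun u => u ≠ w ∧ ¬ G.Adj w u), adjInd G x u =
      ∑ u ∈ C, (1 - adjInd G w u) * adjInd G x u - adjInd G x w := by
    have : C.filter (fun u => u ≠ w ∧ ¬ G.Adj w u) =
        (C.filter fun u => ¬ G.Adj w u).erase w := by
      ext u; simp only [Finset.mem_filter, Finset.mem_erase]; tauto
    rw [this, ← sum_filter_not_adj, ← Finset.sum_erase_add (C.filter fun u => ¬ G.Adj w u) _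
      (show w ∈ _ by simp [hw])]
    ring
  rw [h1, ← Finset.sum_sub_distrib, ← Finset.sum_sub_distrib, mul_sub, Finset.mul_sum]
  -- That `w` itself leaves `C` needs no correction, since the vertices that survive in `D` are not
  -- adjacent to `w`.
  have h2 : (1 - adjInd G w x) * adjInd G x w = 0 := by
    rw [adjInd_comm G w x, sub_mul, adjInd_mul_self]; ring
  rw [h2, sub_zero]
  refine Finset.sum_congr rfl fun u _ => ?_
  rw [adjInd_comm G w x, adjInd_comm G w u]
  ring

/-- Seen from its `D`-end, an edge between `D` and `C` disappears at least as often as one is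
created, with a surplus that is quadratic in the degrees. -/
theorem sum_cross_le (G : SimpleGraph V) {C D : Finset V} (f g : V → ℝ)
    (hf : ∀ w ∈ D, f w ≤ cross G D C - ∑ u ∈ C, adjInd G w u +
        ∑ x ∈ C, ∑ u ∈ C, adjInd G w x * ((1 - adjInd G w u) * adjInd G x u))
    (hg : ∀ w ∈ C, g w = cross G D C - ∑ x ∈ D, ∑ u ∈ C, adjInd G x w * adjInd G x u -
        ∑ x ∈ D, ∑ u ∈ C, (1 - adjInd G x w) * (adjInd G x u * adjInd G u w)) :
    ∑ w ∈ D, f w + ∑ w ∈ C, g w ≤ D.card * cross G D C + C.card * cross G D C - cross G D C -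
      ∑ x ∈ D, (∑ u ∈ C, adjInd G x u) ^ 2 := by
  have h1 := Finset.sum_le_sum hf
  have h2 := Finset.sum_congr (rfl : C = C) hg
  rw [Finset.sum_add_distrib, Finset.sum_sub_distrib, Finset.sum_const, nsmul_eq_mul,
    ← cross_eq] at h1
  rw [Finset.sum_sub_distrib, Finset.sum_sub_distrib, Finset.sum_const, nsmul_eq_mul] at h2
  -- Each of the deg(x) neighbours of `x ∈ D` in `C` kills `x` when met, and all deg(x) edges at `x`
  -- with it.
  have h3 : ∑ w ∈ C, ∑ x ∈ D, ∑ u ∈ C, adjInd G x w * adjInd G x u =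
      ∑ x ∈ D, (∑ u ∈ C, adjInd G x u) ^ 2 := by
    rw [Finset.sum_comm]
    refine Finset.sum_congr rfl fun x _ => ?_
    rw [sq, Finset.sum_mul_sum]
  -- Both sides count the paths D–C–C with nonadjacent ends. Meeting the end in `D` turns the edge
  -- inside `C` into a new crossing edge; meeting the other end destroys the crossing edge of the
  -- path.
  have h4 : ∑ w ∈ C, ∑ x ∈ D, ∑ u ∈ C, (1 - adjInd G x w) * (adjInd G x u * adjInd G u w) =
      ∑ w ∈ D, ∑ x ∈ C, ∑ u ∈ C, adjInd G w x * ((1 - adjInd G w u) * adjInd G x u) := by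
    rw [Finset.sum_comm]
    refine Finset.sum_congr rfl fun x _ => ?_
    rw [Finset.sum_comm]
    refine Finset.sum_congr rfl fun u _ => Finset.sum_congr rfl fun w _ => ?_
    ring
  rw [h3, h4] at h2
  linarith

theorem infect_empty (G : SimpleGraph V) [DecidableEq V] (l : List V) (C : Finset V) :
    infect G l C ∅ = 0 := by
  induction l generalizing C with
  | nil => rfl
  | cons w l ih =>
    unfold infect
    split_ifs with h1 h2
    · rw [Finset.filter_empty]; exact ih _
    · simp at h2
    · exact ih C

/-- Along a uniformly random enumeration, the expected size of the spread is at most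
`d * log (1 + Y / d)`, where `d` is the number of vertices of `D` and `Y` the number of edges
between `D` and `C`. -/
theorem sum_infect_le [DecidableEq V] (G : SimpleGraph V) (U C D : Finset V) (hCD : Disjoint C D)
    (hU : C ∪ D ⊆ U) :
    ∑ l ∈ orders U, (infect G l C D : ℝ) ≤
      U.card.factorial * (D.card * Real.log (1 + cross G D C / D.card)) := by
  classical
  induction hm : U.card generalizing U C D with
  | zero =>
    rw [Finset.card_eq_zero] at hm
    subst hm
    have hC : C = ∅ := by
      rw [← Finset.subset_empty]; exact Finset.subset_union_left.trans hU
    have hD : D = ∅ := by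
      rw [← Finset.subset_empty]; exact Finset.subset_union_right.trans hU
    subst hC hD
    simp [infect_empty]
  | succ m ih =>
    rcases D.eq_empty_or_nonempty with rfl | hD
    · simp [infect_empty]
    have hUne : U.Nonempty := by rw [← Finset.card_pos]; omega
    rw [sum_orders hUne]
    -- All successor states are estimated by one tangent plane, the one at the present density `q`;
    -- `α` is its coefficient of d.
    set q := cross G D C / (D.card : ℝ) with hq
    set d := (D.card : ℝ) with hd
    set Y := cross G D C with hY
    have hd0 : 0 < d := by rw [hd]; exact_mod_cast hD.card_pos
    have hY0 : 0 ≤ Y := cross_nonneg G D C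
    have hq0 : 0 ≤ q := by positivity
    set α := Real.log (1 + q) - q / (1 + q) with hα
    have hα0 : 0 ≤ α := by
      have := Real.one_sub_inv_le_log_of_pos (show 0 < 1 + q by linarith)
      have h2 : 1 - (1 + q)⁻¹ = q / (1 + q) := by field_simp; ring
      rw [hα]; linarith
    have key : ∀ C' D' : Finset V, ∀ w ∈ U, Disjoint C' D' → C' ∪ D' ⊆ U.erase w →
        ∑ l ∈ orders (U.erase w), (infect G l C' D' : ℝ) ≤
          m.factorial * (D'.card * α + cross G D' C' / (1 + q)) := by
      intro C' D' w hw hd' hs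
      refine (ih _ C' D' hd' hs (by rw [Finset.card_erase_of_mem hw, hm]; rfl)).trans ?_
      refine mul_le_mul_of_nonneg_left ?_ (by positivity)
      refine mul_log_le_tangent hq0 (by positivity) (cross_nonneg _ _ _) fun h => ?_
      rw [Nat.cast_eq_zero, Finset.card_eq_zero] at h
      simp [h, cross]
    -- the successor states
    set NA := fun w => C.filter fun u => G.Adj w u with hNA
    set CN := fun w => C.filter fun u => ¬ G.Adj w u with hCN
    set f := fun w => cross G (D.erase w ∪ NA w) (CN w) with hf
    set g := fun w => cross G (D.filter fun u => ¬ G.Adj w u)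
      (C.filter fun u => u ≠ w ∧ ¬ G.Adj w u) with hg
    have hwD : ∀ w ∈ D, ∑ l ∈ orders (U.erase w), (infect G (w :: l) C D : ℝ) ≤
        m.factorial * (∑ u ∈ C, adjInd G w u +
          ((d - 1 + ∑ u ∈ C, adjInd G w u) * α + f w / (1 + q))) := by
      intro w hw
      have hwC : w ∉ C := fun h => Finset.disjoint_left.1 hCD h hw
      have hwU : w ∈ U := hU (Finset.mem_union_right _ hw)
      have h1 : ∀ l, (infect G (w :: l) C D : ℝ) =
          ∑ u ∈ C, adjInd G w u + infect G l (CN w) (D.erase w ∪ NA w) := by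
        intro l
        rw [infect, if_neg hwC, if_pos hw, Nat.cast_add, card_filter_adj]
      have hdis : Disjoint (D.erase w) (NA w) :=
        (hCD.symm.mono_left (Finset.erase_subset _ _)).mono_right (Finset.filter_subset _ _)
      have h2 := key (CN w) (D.erase w ∪ NA w) w hwU (by
        rw [Finset.disjoint_union_right]
        exact ⟨(hCD.mono_left (Finset.filter_subset _ _)).mono_right (Finset.erase_subset _ _),
          (Finset.disjoint_filter_filter_not C C fun u => G.Adj w u).symm⟩) (by
        intro u hu
        simp only [hCN, hNA, Finset.mem_union, Finset.mem_filter, Finset.mem_erase] at hu ⊢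
        have hCU : ∀ u ∈ C, u ≠ w ∧ u ∈ U := fun u hu =>
          ⟨fun h => hwC (h ▸ hu), hU (Finset.mem_union_left _ hu)⟩
        rcases hu with ⟨hu, -⟩ | ⟨hu, hu'⟩ | ⟨hu, -⟩
        · exact hCU u hu
        · exact ⟨hu, hU (Finset.mem_union_right _ hu')⟩
        · exact hCU u hu)
      rw [Finset.sum_congr rfl fun l _ => h1 l, Finset.sum_add_distrib, Finset.sum_const,
        card_orders, Finset.card_erase_of_mem hwU, hm, nsmul_eq_mul, Nat.add_sub_cancel, mul_add]
      refine add_le_add le_rfl (h2.trans_eq ?_)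
      rw [Finset.card_union_of_disjoint hdis, Finset.card_erase_of_mem hw, Nat.cast_add,
        Nat.cast_sub hD.card_pos, card_filter_adj, Nat.cast_one]
    have hwC : ∀ w ∈ C, ∑ l ∈ orders (U.erase w), (infect G (w :: l) C D : ℝ) ≤
        m.factorial * ((d - ∑ u ∈ D, adjInd G w u) * α + g w / (1 + q)) := by
      intro w hw
      have hwD : w ∉ D := fun h => Finset.disjoint_left.1 hCD hw h
      have hwU : w ∈ U := hU (Finset.mem_union_left _ hw)
      have h1 : ∀ l, (infect G (w :: l) C D : ℝ) =
          infect G l (C.filter fun u => u ≠ w ∧ ¬ G.Adj w u) (D.filter fun u => ¬ G.Adj w u) := by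
        intro l
        rw [infect, if_pos hw]
      have h2 := key (C.filter fun u => u ≠ w ∧ ¬ G.Adj w u) (D.filter fun u => ¬ G.Adj w u) w hwU
        ((hCD.mono_left (Finset.filter_subset _ _)).mono_right (Finset.filter_subset _ _)) (by
        intro u hu
        simp only [Finset.mem_union, Finset.mem_filter, Finset.mem_erase] at hu ⊢
        rcases hu with ⟨hu, h, -⟩ | ⟨hu, -⟩
        · exact ⟨h, hU (Finset.mem_union_left _ hu)⟩
        · exact ⟨fun h => hwD (h ▸ hu), hU (Finset.mem_union_right _ hu)⟩)
      rw [Finset.sum_congr rfl fun l _ => h1 l]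
      refine h2.trans_eq ?_
      have h3 := Finset.card_filter_add_card_filter_not (s := D) (fun u => G.Adj w u)
      have h4 : (((D.filter fun u => ¬ G.Adj w u).card : ℕ) : ℝ) =
          d - ∑ u ∈ D, adjInd G w u := by
        rw [← card_filter_adj, hd, ← h3]; push_cast; ring
      rw [h4]
    have hwR : ∀ w ∈ U \ (C ∪ D), ∑ l ∈ orders (U.erase w), (infect G (w :: l) C D : ℝ) ≤
        m.factorial * (d * α + Y / (1 + q)) := by
      intro w hw
      rw [Finset.mem_sdiff, Finset.mem_union, not_or] at hw
      have h1 : ∀ l, infect G (w :: l) C D = infect G l C D := by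
        intro l
        rw [infect, if_neg hw.2.1, if_neg hw.2.2]
      rw [Finset.sum_congr rfl fun l _ => by rw [h1 l]]
      refine key C D w hw.1 hCD fun u hu => ?_
      refine Finset.mem_erase.2 ⟨?_, hU hu⟩
      rintro rfl
      exact absurd (Finset.mem_union.1 hu) (not_or.2 hw.2)
    have hcr := sum_cross_le G f g (fun w hw => cross_infected_le G hCD hw)
      (fun w hw => cross_killed_eq G hw)
    -- Cauchy–Schwarz for the degrees of the vertices of `D`.
    have hcs : Y ^ 2 ≤ d * ∑ x ∈ D, (∑ u ∈ C, adjInd G x u) ^ 2 := by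
      have := sq_sum_le_card_mul_sum_sq (s := D) (f := fun x => ∑ u ∈ C, adjInd G x u)
      rwa [← cross_eq] at this
    have hsplit : U = (U \ (C ∪ D)) ∪ (C ∪ D) := (Finset.sdiff_union_of_subset hU).symm
    have hcard : ((U \ (C ∪ D)).card : ℝ) + C.card + d = m + 1 := by
      have h1 := Finset.card_sdiff_add_card_eq_card hU
      rw [Finset.card_union_of_disjoint hCD, hm] at h1
      rw [hd]; exact_mod_cast (by omega : (U \ (C ∪ D)).card + C.card + D.card = m + 1)
    have hsum : ∑ w ∈ U, ∑ l ∈ orders (U.erase w), (infect G (w :: l) C D : ℝ) ≤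
        m.factorial * ((U \ (C ∪ D)).card * (d * α + Y / (1 + q)) +
          (∑ w ∈ C, ((d - ∑ u ∈ D, adjInd G w u) * α + g w / (1 + q)) +
            ∑ w ∈ D, (∑ u ∈ C, adjInd G w u +
              ((d - 1 + ∑ u ∈ C, adjInd G w u) * α + f w / (1 + q))))) := by
      have e1 := Finset.sum_le_sum hwR
      have e2 := Finset.sum_le_sum hwC
      have e3 := Finset.sum_le_sum hwD
      rw [Finset.sum_const, nsmul_eq_mul] at e1
      rw [← Finset.mul_sum] at e2 e3
      calc ∑ w ∈ U, ∑ l ∈ orders (U.erase w), (infect G (w :: l) C D : ℝ)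
          = ∑ w ∈ (U \ (C ∪ D)) ∪ (C ∪ D),
              ∑ l ∈ orders (U.erase w), (infect G (w :: l) C D : ℝ) := by rw [← hsplit]
        _ ≤ _ := by
          rw [Finset.sum_union Finset.sdiff_disjoint, Finset.sum_union hCD]
          rw [mul_add, mul_add _ (∑ w ∈ C, _)]
          exact add_le_add (e1.trans_eq (by ring)) (add_le_add e2 e3)
    refine hsum.trans ?_
    have hYC : ∑ w ∈ C, ∑ u ∈ D, adjInd G w u = Y := by
      rw [Finset.sum_comm, hY, cross_eq]
      exact Finset.sum_congr rfl fun x _ => Finset.sum_congr rfl fun u _ => adjInd_comm _ _ _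
    have hYD : ∑ w ∈ D, ∑ u ∈ C, adjInd G w u = Y := rfl
    have hS1 : ∑ w ∈ C, ((d - ∑ u ∈ D, adjInd G w u) * α + g w / (1 + q)) =
        (C.card * d - Y) * α + (∑ w ∈ C, g w) / (1 + q) := by
      rw [Finset.sum_add_distrib, ← Finset.sum_mul, Finset.sum_sub_distrib, hYC,
        Finset.sum_const, nsmul_eq_mul, Finset.sum_div]
    have hS2 : ∑ w ∈ D, (∑ u ∈ C, adjInd G w u +
          ((d - 1 + ∑ u ∈ C, adjInd G w u) * α + f w / (1 + q))) =
        Y + ((d * (d - 1) + Y) * α + (∑ w ∈ D, f w) / (1 + q)) := by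
      rw [Finset.sum_add_distrib, hYD, Finset.sum_add_distrib, ← Finset.sum_mul,
        Finset.sum_add_distrib, hYD, Finset.sum_const, nsmul_eq_mul, Finset.sum_div]
    rw [hS1, hS2, Nat.factorial_succ]
    push_cast
    rw [mul_comm ((m : ℝ) + 1), mul_assoc]
    refine mul_le_mul_of_nonneg_left ?_ (by positivity)
    have hYq : Y = d * q := by rw [hq]; field_simp
    have hQ : d * q ^ 2 ≤ ∑ x ∈ D, (∑ u ∈ C, adjInd G x u) ^ 2 := by
      rw [hYq] at hcs
      refine le_of_mul_le_mul_left ?_ hd0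
      linarith
    -- Summed over the first vertex, Y loses at least Y + d q² = Y (1 + q). Divided by 1 + q this is
    -- Y, exactly the number of newly infected vertices, summed over the first vertices in `D`.
    have hfg : (∑ w ∈ C, g w) / (1 + q) + (∑ w ∈ D, f w) / (1 + q) ≤
        (d + C.card) * (Y / (1 + q)) - Y := by
      have : (∑ w ∈ C, g w) + (∑ w ∈ D, f w) ≤ (d + C.card) * Y - Y * (1 + q) := by
        have e : Y * (1 + q) = Y + d * q ^ 2 := by rw [hYq]; ring
        linarith
      rw [← add_div]
      calc _ ≤ ((d + C.card) * Y - Y * (1 + q)) / (1 + q) :=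
            div_le_div_of_nonneg_right this (by linarith)
        _ = _ := by field_simp
    have hlog : d * Real.log (1 + q) = d * α + Y / (1 + q) := by
      rw [hα, hYq]; field_simp; ring
    rw [hlog]
    have hU' : ((U \ (C ∪ D)).card : ℝ) = m + 1 - C.card - d := by linarith
    rw [hU']
    -- The changes of d sum to -d, since the gains and losses of Y cancel; what remains is the term
    -- -dα, which may be dropped.
    have : 0 ≤ d * α := mul_nonneg hd0.le hα0
    nlinarith

/-- The expected spread from one vertex is at most logarithmic. -/
theorem sum_infect_singleton_le [DecidableEq V] (G : SimpleGraph V) (U : Finset V) (v : V)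
    (hv : v ∈ U) :
    ∑ l ∈ orders U, (infect G l (U.erase v) {v} : ℝ) ≤
      (orders U).card * Real.log U.card := by
  refine (sum_infect_le G U _ _ (Finset.disjoint_singleton_right.2 (Finset.notMem_erase v U)) ?_).trans ?_
  · intro u hu
    rcases Finset.mem_union.1 hu with h | h
    · exact Finset.mem_of_mem_erase h
    · rw [Finset.mem_singleton.1 h]; exact hv
  rw [card_orders]
  refine mul_le_mul_of_nonneg_left ?_ (by positivity)
  rw [Finset.card_singleton, Nat.cast_one, one_mul, div_one]
  have h0 := cross_nonneg G {v} (U.erase v)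
  refine Real.log_le_log (by linarith) ?_
  have h1 : cross G {v} (U.erase v) ≤ ((U.erase v).card : ℝ) := by
    rw [cross_eq, Finset.sum_singleton, ← nsmul_one]
    refine Finset.sum_le_card_nsmul _ _ _ fun u _ => ?_
    unfold adjInd
    split_ifs
    · exact le_rfl
    · exact zero_le_one
  rw [Finset.card_erase_of_mem hv, Nat.cast_sub (Finset.card_pos.2 ⟨v, hv⟩)] at h1
  push_cast at h1
  linarith

end Infection
end DynLFMIS

namespace DynLFMIS

/-! ### Random rankings: no ties, equally likely orders, measurability -/

section RandomRanking

/-- The list is in the order of increasing rank. -/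
def Ranked {V : Type*} (π : V → unitInterval) (l : List V) : Prop :=
  l.Pairwise fun u v => π u < π v

theorem exists_ranked {V : Type*} [DecidableEq V] {π : V → unitInterval}
    (hπ : Function.Injective π) (U : Finset V) : ∃ l ∈ orders U, Ranked π l := by
  classical
  have htot : Std.Total fun u v : V => π u ≤ π v := ⟨fun a b => le_total (π a) (π b)⟩
  have htr : IsTrans V fun u v : V => π u ≤ π v := ⟨fun a b c => le_trans⟩
  have hp := List.perm_insertionSort (fun u v => π u ≤ π v) U.toList
  have hs := List.pairwise_insertionSort (fun u v => π u ≤ π v) U.toList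
  have hn : (U.toList.insertionSort fun u v => π u ≤ π v).Nodup := hp.nodup_iff.2 U.nodup_toList
  refine ⟨_, mem_orders.2 ⟨hn, ?_⟩, ?_⟩
  · rw [List.toFinset_eq_of_perm _ _ hp, Finset.toList_toFinset]
  · exact List.Pairwise.imp₂ (fun a b hab hne => lt_of_le_of_ne hab fun h => hne (hπ h)) hs hn

theorem Ranked.eq_of_mem_orders {V : Type*} [DecidableEq V] {π : V → unitInterval}
    {U : Finset V} {l l' : List V} (h : Ranked π l) (h' : Ranked π l') (hl : l ∈ orders U)
    (hl' : l' ∈ orders U) : l = l' := by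
  rw [mem_orders] at hl hl'
  have hp : l.Perm l' := by
    rw [List.perm_ext_iff_of_nodup hl.1 hl'.1]
    intro a
    rw [← List.mem_toFinset, hl.2, ← hl'.2, List.mem_toFinset]
  exact hp.eq_of_pairwise (fun a b _ _ hab hba => absurd hab hba.not_gt) h h'

/-- A rearrangement of a list without repetition is a renaming of its entries, so the invariance of
the ranking law under renaming applies to it. That `σ` fixes everything off the list is what lets
the induction pass a common head. -/
theorem exists_perm_map_eq {V : Type*} [DecidableEq V] {l l' : List V} (h : l.Perm l')
    (hn : l.Nodup) : ∃ σ : Equiv.Perm V, (∀ x, x ∉ l → σ x = x) ∧ l' = l.map σ := by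
  induction h with
  | nil => exact ⟨1, by simp, by simp⟩
  | @cons a l₁ l₂ h ih =>
    rw [List.nodup_cons] at hn
    obtain ⟨σ, h1, h2⟩ := ih hn.2
    refine ⟨σ, fun x hx => h1 x fun h => hx (List.mem_cons_of_mem _ h), ?_⟩
    rw [List.map_cons, h1 a hn.1, h2]
  | swap x y l =>
    simp only [List.nodup_cons, List.mem_cons, not_or] at hn
    refine ⟨Equiv.swap x y, fun z hz => ?_, ?_⟩
    · simp only [List.mem_cons, not_or] at hz
      exact Equiv.swap_apply_of_ne_of_ne hz.2.1 hz.1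
    · rw [List.map_cons, List.map_cons, Equiv.swap_apply_left, Equiv.swap_apply_right]
      congr 2
      conv_lhs => rw [← List.map_id l]
      refine List.map_congr_left fun z hz => (Equiv.swap_apply_of_ne_of_ne ?_ ?_).symm
      · rintro rfl; exact hn.2.1 hz
      · rintro rfl; exact hn.1.2 hz
  | trans h₁ _ ih₁ ih₂ =>
    obtain ⟨σ, h1, h2⟩ := ih₁ hn
    obtain ⟨τ, h3, h4⟩ := ih₂ (h₁.nodup_iff.1 hn)
    refine ⟨τ * σ, fun x hx => ?_, ?_⟩
    · rw [Equiv.Perm.mul_apply, h1 x hx, h3 x fun h => hx (h₁.mem_iff.2 h)]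
    · rw [h4, h2, List.map_map]; rfl

instance : IsProbabilityMeasure rankingLaw :=
  inferInstanceAs (IsProbabilityMeasure (Measure.infinitePi _))

/-- Two ranks have a product law without atoms, for which the diagonal is null; there are countably
many pairs of vertices. -/
theorem ae_injective_rankingLaw : ∀ᵐ π ∂rankingLaw, Function.Injective π := by
  have h : ∀ i j : ℕ, i ≠ j → ∀ᵐ π ∂rankingLaw, π i ≠ π j := by
    intro i j hij
    have h1 := Measure.infinitePi_map_eval_prod (P := fun _ : ℕ => (volume : Measure unitInterval))
      hij
    have h2 : ∀ᵐ p ∂((volume : Measure unitInterval).prod volume), p.1 ≠ p.2 := by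
      rw [Measure.ae_prod_iff_ae_ae]
      · refine Filter.Eventually.of_forall fun x => ?_
        have := measure_singleton (μ := (volume : Measure unitInterval)) x
        rw [ae_iff]
        simp only [ne_eq, not_not]
        convert this using 2
        ext y
        simp [eq_comm]
      · exact (measurableSet_eq_fun measurable_fst measurable_snd).compl
    rw [← h1] at h2
    exact ae_of_ae_map (f := fun ω : ℕ → unitInterval => (ω i, ω j)) (by fun_prop) h2
  have h' : ∀ᵐ π ∂rankingLaw, ∀ i j : ℕ, i ≠ j → π i ≠ π j := by
    rw [ae_all_iff]; intro i
    rw [ae_all_iff]; intro j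
    by_cases hij : i = j
    · exact Filter.Eventually.of_forall fun π hne => absurd hij hne
    · filter_upwards [h i j hij] with π hπ _ using hπ
  filter_upwards [h'] with π hπ i j hij
  by_contra hne
  exact hπ i j hne hij

/-- A function of the ranking that only depends on finitely many comparisons is measurable. -/
theorem measurable_of_comparisons {X : Type*} [MeasurableSpace X] (W : ℕ)
    (f : (ℕ → unitInterval) → X)
    (hf : ∀ π π' : ℕ → unitInterval, (∀ a < W, ∀ b < W, π a < π b ↔ π' a < π' b) → f π = f π') :
    Measurable f := by
  classical
  -- The function factors through the table of comparisons below `W`, which has finitely many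
  -- values.
  let pat : (ℕ → unitInterval) → (Fin W × Fin W → Bool) := fun π p => decide (π p.1 < π p.2)
  have hpat : Measurable pat := by
    refine measurable_pi_lambda _ fun p => ?_
    refine measurable_to_bool ?_
    have : (fun π : ℕ → unitInterval => pat π p) ⁻¹' {true} = {π | π p.1 < π p.2} := by
      ext π; simp [pat]
    rw [this]
    exact measurableSet_lt (measurable_pi_apply _) (measurable_pi_apply _)
  let g : (Fin W × Fin W → Bool) → X := fun q =>
    -- The value at a table that no ranking realises is arbitrary.
    if h : ∃ π, pat π = q then f h.choose else f fun _ => 0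
  have hg : f = g ∘ pat := by
    funext π
    have h : ∃ π', pat π' = pat π := ⟨π, rfl⟩
    have h2 : g (pat π) = f h.choose := dif_pos h
    rw [Function.comp_apply, h2]
    refine hf _ _ fun a ha b hb => ?_
    exact (decide_eq_decide.1 (congrFun h.choose_spec (⟨a, ha⟩, ⟨b, hb⟩))).symm
  rw [hg]
  exact (measurable_of_finite g).comp hpat

theorem measurableSet_ranked (l : List ℕ) : MeasurableSet {π : ℕ → unitInterval | Ranked π l} := by
  induction l with
  | nil => simp [Ranked]
  | cons a l ih =>
    have : {π : ℕ → unitInterval | Ranked π (a :: l)} =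
        (⋂ b ∈ l, {π : ℕ → unitInterval | π a < π b}) ∩ {π | Ranked π l} := by
      ext π; simp [Ranked]
    rw [this]
    refine MeasurableSet.inter ?_ ih
    exact Set.Finite.measurableSet_biInter (List.finite_toSet l) fun b _ =>
      measurableSet_lt (measurable_pi_apply _) (measurable_pi_apply _)

/-- All enumerations of a finite set are equally likely. -/
theorem rankingLaw_ranked_eq {l l' : List ℕ} (h : l.Perm l') (hn : l.Nodup) :
    rankingLaw {π | Ranked π l} = rankingLaw {π | Ranked π l'} := by
  obtain ⟨σ, -, rfl⟩ := exists_perm_map_eq h hn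
  -- Renaming the coordinates preserves a power of a single measure.
  have h1 := Measure.map_infinitePi_infinitePi_of_inj
    (P := fun _ : ℕ => (volume : Measure unitInterval)) (f := σ) σ.injective
  have h2 : rankingLaw = rankingLaw.map fun π i => π (σ i) := h1.symm
  conv_lhs => rw [h2]
  rw [Measure.map_apply (by fun_prop) (measurableSet_ranked l)]
  congr 1
  ext π
  simp [Ranked, List.pairwise_map]

/-- The events for the various enumerations of `U` are disjoint and equally likely. An upper bound
is all that is needed, so ties do not have to be excluded. -/
theorem rankingLaw_ranked_le {U : Finset ℕ} {l : List ℕ} (hl : l ∈ orders U) :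
    ((orders U).card : ℝ≥0∞) * rankingLaw {π | Ranked π l} ≤ 1 := by
  have h1 : ∀ l' ∈ orders U, rankingLaw {π | Ranked π l'} = rankingLaw {π | Ranked π l} := by
    intro l' hl'
    rw [mem_orders] at hl hl'
    refine rankingLaw_ranked_eq ?_ hl'.1
    rw [List.perm_ext_iff_of_nodup hl'.1 hl.1]
    intro a
    rw [← List.mem_toFinset, hl'.2, ← hl.2, List.mem_toFinset]
  rw [← nsmul_eq_mul, ← Finset.sum_const, ← Finset.sum_congr rfl h1,
    ← measure_biUnion_finset _ fun l' _ => measurableSet_ranked l']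
  · exact prob_le_one
  · intro l₁ h₁ l₂ h₂ hne
    rw [Function.onFun, Set.disjoint_left]
    intro π hp hp'
    exact hne (Ranked.eq_of_mem_orders hp hp' h₁ h₂)

open Classical in
/-- The value of `F` at the enumeration of `U` in the order of the ranking. -/
noncomputable def atRanking (π : ℕ → unitInterval) (U : Finset ℕ) (F : List ℕ → ℕ) : ℕ :=
  -- As a finite sum of indicators this is measurable; if the ranking has a tie inside `U`, its
  -- value is 0.
  ∑ l ∈ orders U, if Ranked π l then F l else 0

theorem atRanking_eq {π : ℕ → unitInterval} {U : Finset ℕ} (F : List ℕ → ℕ) {l : List ℕ}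
    (hl : l ∈ orders U) (h : Ranked π l) : atRanking π U F = F l := by
  classical
  rw [atRanking, Finset.sum_eq_single_of_mem l hl, if_pos h]
  intro l' hl' hne
  rw [if_neg fun h' => hne (h'.eq_of_mem_orders h hl' hl)]

theorem measurable_atRanking (U : Finset ℕ) (F : List ℕ → ℕ) :
    Measurable fun π => (atRanking π U F : ℝ≥0∞) := by
  classical
  simp only [atRanking, Nat.cast_sum, Nat.cast_ite]
  refine Finset.measurable_sum _ fun l _ => ?_
  exact Measurable.ite (measurableSet_ranked l) measurable_const measurable_const

/-- No enumeration has probability above 1/|U|!, so an average over the enumerations bounds the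
expectation. -/
theorem lintegral_atRanking_le (U : Finset ℕ) (F : List ℕ → ℕ) {X : ℝ}
    (hF : ∑ l ∈ orders U, (F l : ℝ) ≤ (orders U).card * X) :
    ∫⁻ π, (atRanking π U F : ℝ≥0∞) ∂rankingLaw ≤ ENNReal.ofReal X := by
  classical
  simp only [atRanking, Nat.cast_sum, Nat.cast_ite]
  rw [lintegral_finsetSum _ fun l _ =>
    Measurable.ite (measurableSet_ranked l) measurable_const measurable_const]
  have h1 : ∀ l ∈ orders U, ∫⁻ π, (if Ranked π l then (F l : ℝ≥0∞) else ((0 : ℕ) : ℝ≥0∞))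
      ∂rankingLaw ≤ F l * ((orders U).card : ℝ≥0∞)⁻¹ := by
    intro l hl
    have : ∀ π, (if Ranked π l then (F l : ℝ≥0∞) else ((0 : ℕ) : ℝ≥0∞)) =
        Set.indicator {π | Ranked π l} (fun _ => (F l : ℝ≥0∞)) π := by
      intro π; simp [Set.indicator]
    simp_rw [this]
    rw [lintegral_indicator_const (measurableSet_ranked l)]
    gcongr
    rw [ENNReal.le_inv_iff_mul_le, mul_comm]
    exact rankingLaw_ranked_le hl
  have hc : 0 < (orders U).card := by rw [card_orders]; exact Nat.factorial_pos _
  refine (Finset.sum_le_sum h1).trans ?_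
  rw [← Finset.sum_mul, ← div_eq_mul_inv]
  refine ENNReal.div_le_of_le_mul ?_
  rw [mul_comm, ← ENNReal.ofReal_natCast, ← ENNReal.ofReal_mul (by positivity), ← Nat.cast_sum,
    ← ENNReal.ofReal_natCast]
  refine ENNReal.ofReal_le_ofReal ?_
  rw [Nat.cast_sum]; exact hF

end RandomRanking
end DynLFMIS

namespace DynLFMIS

/-! ### The greedy process and the eliminators of vertices -/

section Greedy

theorem minRank_le {V : Type*} (π : V → unitInterval) (A : Finset V) (hA : A.Nonempty) {u : V}
    (hu : u ∈ A) : π (minRank π A hA) ≤ π u :=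
  (A.exists_min_image π hA).choose_spec.2 u hu

theorem minRank_eq {V : Type*} {π : V → unitInterval} (hπ : Function.Injective π) {A : Finset V}
    (hA : A.Nonempty) {w : V} (hw : w ∈ A) (hmin : ∀ u ∈ A, π w ≤ π u) : minRank π A hA = w :=
  hπ (le_antisymm (minRank_le π A hA hw) (hmin _ (minRank_mem π A hA)))

variable {V : Type*} [DecidableEq V]

open Classical in
/-- The vertices that stay alive when `w` is selected. -/
noncomputable def survivors (G : SimpleGraph V) (A : Finset V) (w : V) : Finset V :=
  A.filter fun u => u ≠ w ∧ ¬ G.Adj w u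

theorem mem_survivors {G : SimpleGraph V} {A : Finset V} {w u : V} :
    u ∈ survivors G A w ↔ u ∈ A ∧ u ≠ w ∧ ¬ G.Adj w u := by
  classical
  rw [survivors, Finset.mem_filter]

theorem lfmis_of_nonempty (G : SimpleGraph V) (π : V → unitInterval) {A : Finset V}
    (hA : A.Nonempty) :
    lfmis G π A = insert (minRank π A hA) (lfmis G π (survivors G A (minRank π A hA))) := by
  rw [lfmis, dif_pos hA, survivors]

theorem lfmis_empty (G : SimpleGraph V) (π : V → unitInterval) : lfmis G π ∅ = ∅ := by
  rw [lfmis, dif_neg (by simp)]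

theorem survivors_ssubset (G : SimpleGraph V) {A : Finset V} {w : V} (hw : w ∈ A) :
    survivors G A w ⊂ A := by
  refine Finset.ssubset_iff_subset_ne.2 ⟨fun u hu => (mem_survivors.1 hu).1, fun h => ?_⟩
  rw [← h, mem_survivors] at hw
  exact hw.2.1 rfl

theorem lfmis_subset (G : SimpleGraph V) (π : V → unitInterval) (A : Finset V) :
    lfmis G π A ⊆ A := by
  induction A using Finset.strongInduction with
  | H A ih =>
    rcases A.eq_empty_or_nonempty with rfl | hA
    · rw [lfmis_empty]
    rw [lfmis_of_nonempty G π hA, Finset.insert_subset_iff]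
    have hm := minRank_mem π A hA
    exact ⟨hm, (ih _ (survivors_ssubset G hm)).trans (survivors_ssubset G hm).subset⟩

theorem not_adj_of_mem_lfmis {G : SimpleGraph V} {π : V → unitInterval} {A : Finset V} {u w : V}
    (hu : u ∈ lfmis G π A) (hw : w ∈ lfmis G π A) : ¬ G.Adj u w := by
  induction A using Finset.strongInduction with
  | H A ih =>
    rcases A.eq_empty_or_nonempty with rfl | hA
    · rw [lfmis_empty] at hu; simp at hu
    rw [lfmis_of_nonempty G π hA, Finset.mem_insert] at hu hw
    have hm := minRank_mem π A hA
    have hs : ∀ x ∈ lfmis G π (survivors G A (minRank π A hA)), ¬ G.Adj (minRank π A hA) x :=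
      fun x hx => (mem_survivors.1 (lfmis_subset _ _ _ hx)).2.2
    rcases hu with rfl | hu <;> rcases hw with rfl | hw
    · exact G.loopless.irrefl _
    · exact hs _ hw
    · exact fun h => hs _ hu h.symm
    · exact ih _ (survivors_ssubset G hm) hu hw

/-- The witness is the vertex selected in the round in which `u` is killed. -/
theorem exists_adj_of_notMem_lfmis {G : SimpleGraph V} {π : V → unitInterval}
    (hπ : Function.Injective π) {A : Finset V} {u : V}
    (hu : u ∈ A) (hu' : u ∉ lfmis G π A) : ∃ w ∈ lfmis G π A, G.Adj w u ∧ π w < π u := by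
  induction A using Finset.strongInduction with
  | H A ih =>
    have hA : A.Nonempty := ⟨u, hu⟩
    have hm := minRank_mem π A hA
    rw [lfmis_of_nonempty G π hA] at hu' ⊢
    rw [Finset.mem_insert, not_or] at hu'
    by_cases had : G.Adj (minRank π A hA) u
    · exact ⟨_, Finset.mem_insert_self _ _, had, lt_of_le_of_ne (minRank_le π A hA hu)
        fun h => hu'.1 (hπ h).symm⟩
    · obtain ⟨w, hw, h⟩ := ih _ (survivors_ssubset G hm) (mem_survivors.2 ⟨hu, hu'.1, had⟩) hu'.2
      exact ⟨w, Finset.mem_insert_of_mem hw, h⟩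

open Classical in
/-- The members of the LFMIS that are equal or adjacent to `u`. -/
noncomputable def dominators (G : SimpleGraph V) (π : V → unitInterval) (A : Finset V) (u : V) :
    Finset V :=
  (lfmis G π A).filter fun w => w = u ∨ G.Adj w u

theorem mem_dominators {G : SimpleGraph V} {π : V → unitInterval} {A : Finset V} {u w : V} :
    w ∈ dominators G π A u ↔ w ∈ lfmis G π A ∧ (w = u ∨ G.Adj w u) := by
  classical
  rw [dominators, Finset.mem_filter]

open Classical in
/-- The vertex whose selection kills `u` in the greedy process. -/
noncomputable def elim (G : SimpleGraph V) (π : V → unitInterval) (A : Finset V) (u : V) : V :=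
  -- The default does not occur for active vertices; eliminators are also evaluated at a vertex that
  -- is about to enter or has just left.
  if h : (dominators G π A u).Nonempty then minRank π _ h else u

theorem elim_eq {G : SimpleGraph V} {π : V → unitInterval} (hπ : Function.Injective π)
    {A : Finset V} {u w : V} (hw : w ∈ lfmis G π A) (h : w = u ∨ G.Adj w u)
    (hmin : ∀ x ∈ lfmis G π A, x = u ∨ G.Adj x u → π w ≤ π x) : elim G π A u = w := by
  have hmem : w ∈ dominators G π A u := mem_dominators.2 ⟨hw, h⟩
  rw [elim, dif_pos ⟨w, hmem⟩]
  refine minRank_eq hπ _ hmem fun x hx => ?_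
  rw [mem_dominators] at hx
  exact hmin x hx.1 hx.2

theorem elim_self {G : SimpleGraph V} {π : V → unitInterval} (hπ : Function.Injective π)
    {A : Finset V} {u : V} (hu : u ∈ lfmis G π A) : elim G π A u = u := by
  refine elim_eq hπ hu (Or.inl rfl) fun x hx h => ?_
  rcases h with rfl | h
  · exact le_rfl
  · exact absurd h (not_adj_of_mem_lfmis hx hu)

theorem elim_mem {G : SimpleGraph V} {π : V → unitInterval} (hπ : Function.Injective π)
    {A : Finset V} {u : V} (hu : u ∈ A) : elim G π A u ∈ lfmis G π A := by
  have hne : (dominators G π A u).Nonempty := by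
    by_cases h : u ∈ lfmis G π A
    · exact ⟨u, mem_dominators.2 ⟨h, Or.inl rfl⟩⟩
    · obtain ⟨w, hw, h, -⟩ := exists_adj_of_notMem_lfmis hπ hu h
      exact ⟨w, mem_dominators.2 ⟨hw, Or.inr h⟩⟩
  rw [elim, dif_pos hne]
  exact (mem_dominators.1 (minRank_mem π _ hne)).1

theorem elim_congr {G : SimpleGraph V} {π : V → unitInterval} {A B : Finset V} {u : V}
    (h : dominators G π A u = dominators G π B u) : elim G π A u = elim G π B u := by
  unfold elim
  simp only [h]

/-- The first selected vertex is no dominator of `u`, and the other members of the LFMIS form the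
LFMIS of the survivors, so the dominators of `u` are the same. -/
theorem elim_survivors {G : SimpleGraph V} {π : V → unitInterval} (hπ : Function.Injective π)
    {A : Finset V} {w u : V} (hw : w ∈ A) (hmin : ∀ x ∈ A, π w ≤ π x) (hu : u ≠ w)
    (had : ¬ G.Adj w u) : elim G π A u = elim G π (survivors G A w) u := by
  refine elim_congr ?_
  ext x
  rw [mem_dominators, mem_dominators, lfmis_of_nonempty G π (show A.Nonempty from ⟨w, hw⟩), minRank_eq hπ _ hw hmin,
    Finset.mem_insert]
  constructor
  · rintro ⟨rfl | hx, h⟩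
    · rcases h with rfl | h
      · exact absurd rfl hu
      · exact absurd h had
    · exact ⟨hx, h⟩
  · exact fun h => ⟨Or.inr h.1, h.2⟩

theorem elim_eq_first {G : SimpleGraph V} {π : V → unitInterval} (hπ : Function.Injective π)
    {A : Finset V} {w u : V} (hw : w ∈ A) (hmin : ∀ x ∈ A, π w ≤ π x)
    (h : w = u ∨ G.Adj w u) : elim G π A u = w := by
  refine elim_eq hπ ?_ h fun x hx _ => hmin x (lfmis_subset _ _ _ hx)
  rw [lfmis_of_nonempty G π (show A.Nonempty from ⟨w, hw⟩), minRank_eq hπ _ hw hmin]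
  exact Finset.mem_insert_self _ _

open Classical in
/-- The alive set after the vertex `w` has been met. -/
noncomputable def meet (G : SimpleGraph V) (A : Finset V) (w : V) : Finset V :=
  if w ∈ A then survivors G A w else A

theorem mem_of_mem_meet {G : SimpleGraph V} {A : Finset V} {w u : V} (h : u ∈ meet G A w) :
    u ∈ A ∧ u ≠ w := by
  unfold meet at h
  split_ifs at h with hw
  · exact ⟨(mem_survivors.1 h).1, (mem_survivors.1 h).2.1⟩
  · exact ⟨h, fun e => hw (e ▸ h)⟩

theorem mem_meet {G : SimpleGraph V} {A : Finset V} {w u : V} (hu : u ∈ A) (hne : u ≠ w)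
    (had : ¬ G.Adj w u) : u ∈ meet G A w := by
  unfold meet
  split_ifs with hw
  · exact mem_survivors.2 ⟨hu, hne, had⟩
  · exact hu

theorem elim_meet {G : SimpleGraph V} {π : V → unitInterval} (hπ : Function.Injective π)
    {A : Finset V} {w u : V} (hmin : ∀ x ∈ A, π w ≤ π x) (hu : u ≠ w) (had : ¬ G.Adj w u) :
    elim G π A u = elim G π (meet G A w) u := by
  unfold meet
  split_ifs with hw
  · exact elim_survivors hπ hw hmin hu had
  · rfl

open Classical in
/-- Two greedy processes that differ only inside `D` have different outcomes only at vertices to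
which the difference spreads. -/
theorem card_elim_ne_le_infect {G : SimpleGraph V} {π : V → unitInterval}
    (hπ : Function.Injective π) {l : List V} (hl : Ranked π l) {B₁ B₂ C D : Finset V}
    (h₁ : ∀ u ∈ B₁, u ∈ l) (h₂ : ∀ u ∈ B₂, u ∈ l) (hC₁ : C ⊆ B₁) (hC₂ : C ⊆ B₂)
    (hCD : Disjoint C D) (hB₁ : B₁ ⊆ C ∪ D) (hB₂ : B₂ ⊆ C ∪ D) :
    (C.filter fun u => elim G π B₁ u ≠ elim G π B₂ u).card ≤ infect G l C D := by
  induction l generalizing B₁ B₂ C D with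
  | nil =>
    have : C = ∅ := Finset.eq_empty_of_forall_notMem fun u hu => by simpa using h₁ u (hC₁ hu)
    simp [this]
  | cons w l ih =>
    have hmin : ∀ B : Finset V, (∀ u ∈ B, u ∈ w :: l) → ∀ x ∈ B, π w ≤ π x := by
      intro B hB x hx
      rcases List.mem_cons.1 (hB x hx) with rfl | h
      · exact le_rfl
      · exact ((List.pairwise_cons.1 hl).1 x h).le
    have hl' : Ranked π l := (List.pairwise_cons.1 hl).2
    have hmem : ∀ B : Finset V, (∀ u ∈ B, u ∈ w :: l) → ∀ x ∈ meet G B w, x ∈ l := by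
      intro B hB x hx
      obtain ⟨h, hne⟩ := mem_of_mem_meet hx
      exact (List.mem_cons.1 (hB x h)).resolve_left hne
    have hdis : ∀ u ∈ C, u ∉ D := fun u h => Finset.disjoint_left.1 hCD h
    rw [infect]
    split_ifs with hwC hwD
    -- `w` is alive in both processes and comes first, so both select it: its neighbours get the
    -- same eliminator, and the induction goes on with the survivors.
    · refine le_trans (Finset.card_le_card ?_) (ih hl' (hmem B₁ h₁) (hmem B₂ h₂)
        ?_ ?_ (Finset.disjoint_filter_filter hCD) ?_ ?_)
      · intro u hu
        simp only [Finset.mem_filter] at hu ⊢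
        by_cases h : w = u ∨ G.Adj w u
        · exact absurd ((elim_eq_first hπ (hC₁ hwC) (hmin _ h₁) h).trans
            (elim_eq_first hπ (hC₂ hwC) (hmin _ h₂) h).symm) hu.2
        · rw [not_or] at h
          refine ⟨⟨hu.1, Ne.symm h.1, h.2⟩, ?_⟩
          rw [← elim_meet hπ (hmin _ h₁) (Ne.symm h.1) h.2,
            ← elim_meet hπ (hmin _ h₂) (Ne.symm h.1) h.2]
          exact hu.2
      · intro u hu
        rw [Finset.mem_filter] at hu
        exact mem_meet (hC₁ hu.1) hu.2.1 hu.2.2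
      · intro u hu
        rw [Finset.mem_filter] at hu
        exact mem_meet (hC₂ hu.1) hu.2.1 hu.2.2
      · intro u hu
        rw [meet, if_pos (hC₁ hwC), mem_survivors] at hu
        simp only [Finset.mem_union, Finset.mem_filter]
        exact (Finset.mem_union.1 (hB₁ hu.1)).imp (fun h => ⟨h, hu.2⟩) fun h => ⟨h, hu.2.2⟩
      · intro u hu
        rw [meet, if_pos (hC₂ hwC), mem_survivors] at hu
        simp only [Finset.mem_union, Finset.mem_filter]
        exact (Finset.mem_union.1 (hB₂ hu.1)).imp (fun h => ⟨h, hu.2⟩) fun h => ⟨h, hu.2.2⟩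
    -- The processes may disagree about `w`. Its neighbours in `C` are given up as different and
    -- join `D`; for the other vertices of `C`, `w` is irrelevant.
    · have hsub : ∀ B : Finset V, B ⊆ C ∪ D → meet G B w ⊆ (C.filter fun u => ¬ G.Adj w u) ∪
          (D.erase w ∪ C.filter fun u => G.Adj w u) := by
        intro B hB u hu
        obtain ⟨h, hne⟩ := mem_of_mem_meet hu
        have := Finset.mem_union.1 (hB h)
        simp only [Finset.mem_union, Finset.mem_filter, Finset.mem_erase]
        tauto
      have hge : ∀ B : Finset V, C ⊆ B → (C.filter fun u => ¬ G.Adj w u) ⊆ meet G B w := by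
        intro B hB u hu
        rw [Finset.mem_filter] at hu
        exact mem_meet (hB hu.1) (fun e => hwC (e ▸ hu.1)) hu.2
      refine le_trans ((Finset.card_le_card ?_).trans (Finset.card_union_le _ _))
        (Nat.add_le_add_left (ih hl' (hmem B₁ h₁) (hmem B₂ h₂) (hge _ hC₁) (hge _ hC₂) ?_
          (hsub _ hB₁) (hsub _ hB₂)) _)
      · intro u hu
        simp only [Finset.mem_filter, Finset.mem_union] at hu ⊢
        by_cases h : G.Adj w u
        · exact Or.inl ⟨hu.1, h⟩
        · have hne : u ≠ w := fun e => hwC (e ▸ hu.1)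
          refine Or.inr ⟨⟨hu.1, h⟩, ?_⟩
          rw [← elim_meet hπ (hmin _ h₁) hne h, ← elim_meet hπ (hmin _ h₂) hne h]
          exact hu.2
      · rw [Finset.disjoint_left]
        intro u hu hu'
        simp only [Finset.mem_union, Finset.mem_filter, Finset.mem_erase] at hu hu'
        have := hdis u hu.1
        tauto
    -- `w` is alive in neither process, and meeting it has no effect.
    · have hnot : ∀ B : Finset V, (∀ u ∈ B, u ∈ w :: l) → B ⊆ C ∪ D → ∀ u ∈ B, u ∈ l := by
        intro B hB hs u hu
        refine (List.mem_cons.1 (hB u hu)).resolve_left fun e => ?_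
        rcases Finset.mem_union.1 (hs hu) with h | h
        · exact hwC (e ▸ h)
        · exact hwD (e ▸ h)
      exact ih hl' (hnot _ h₁ hB₁) (hnot _ h₂ hB₂) hC₁ hC₂ hCD hB₁ hB₂

/-- The number of vertices whose eliminator changes when `v` is inserted in `A` or deleted from
`insert v A`. -/
noncomputable def changes (π : ℕ → unitInterval) (G : SimpleGraph ℕ) (A : Finset ℕ) (v : ℕ) : ℕ :=
  atRanking π (insert v A) fun l => infect G l (A.erase v) {v}

-- The processes on `A` and on `insert v A` start with `C = A` and `D = {v}`.
open Classical in
theorem card_elim_ne_le_changes {G : SimpleGraph ℕ} {π : ℕ → unitInterval}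
    (hπ : Function.Injective π) {A : Finset ℕ} {v : ℕ} (hv : v ∉ A) :
    (A.filter fun u => elim G π A u ≠ elim G π (insert v A) u).card ≤ changes π G A v := by
  obtain ⟨l, hl, hr⟩ := exists_ranked hπ (insert v A)
  rw [changes, atRanking_eq _ hl hr, Finset.erase_eq_of_notMem hv]
  have hmem : ∀ u ∈ insert v A, u ∈ l := fun u hu => by
    rw [← List.mem_toFinset, (mem_orders.1 hl).2]; exact hu
  refine card_elim_ne_le_infect hπ hr (fun u hu => hmem u (Finset.mem_insert_of_mem hu)) hmem
    subset_rfl (Finset.subset_insert _ _) (Finset.disjoint_singleton_right.2 hv)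
    Finset.subset_union_left ?_
  rw [Finset.union_comm]; exact subset_rfl

theorem measurable_changes (G : SimpleGraph ℕ) (A : Finset ℕ) (v : ℕ) :
    Measurable fun π => (changes π G A v : ℝ≥0∞) :=
  measurable_atRanking _ _

theorem lintegral_changes_le (G : SimpleGraph ℕ) (A : Finset ℕ) (v : ℕ) :
    ∫⁻ π, (changes π G A v : ℝ≥0∞) ∂rankingLaw ≤ ENNReal.ofReal (Real.log (insert v A).card) := by
  refine lintegral_atRanking_le _ _ ?_
  have := sum_infect_singleton_le G (insert v A) v (Finset.mem_insert_self _ _)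
  rwa [Finset.erase_insert_eq_erase] at this

end Greedy
end DynLFMIS

namespace DynLFMIS

/-! ### A program logic with time budgets for the word RAM -/

section Logic

variable {W : ℕ} {G : SimpleGraph ℕ} {π : ℕ → unitInterval}

/-- The program halts after at most `T` steps in a state that satisfies `Q`. -/
def Halts (W : ℕ) (G : SimpleGraph ℕ) (π : ℕ → unitInterval) (p : Program) (s : State) (T : ℕ)
    (Q : State → Prop) : Prop :=
  ∃ t s', Exec W G π p s t s' ∧ t ≤ T ∧ Q s'

/-- The sequential composition of a list of programs. -/
def block : List Program → Program
  | [] => .skip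
  | [p] => p
  | p :: q :: l => .seq p (block (q :: l))

theorem Halts.mono {p : Program} {s : State} {T T' : ℕ} {Q Q' : State → Prop}
    (h : Halts W G π p s T Q) (hT : T ≤ T') (hQ : ∀ s', Q s' → Q' s') : Halts W G π p s T' Q' := by
  obtain ⟨t, s', h1, h2, h3⟩ := h
  exact ⟨t, s', h1, h2.trans hT, hQ s' h3⟩

theorem halts_skip {s : State} {T : ℕ} {Q : State → Prop} (hc : 1 ≤ T) (h : Q s) :
    Halts W G π .skip s T Q :=
  ⟨1, s, .skip s, hc, h⟩

theorem halts_assign {s : State} {r : ℕ} {x : Expr} {T : ℕ} {Q : State → Prop}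
    (hx : x.Fits W s) (hc : x.cost + 1 ≤ T) (h : Q (s.setReg r (x.eval s))) :
    Halts W G π (.assign r x) s T Q :=
  ⟨_, _, .assign s r x hx, hc, h⟩

theorem halts_write {s : State} {a : ℕ} {i x : Expr} {T : ℕ} {Q : State → Prop}
    (hi : i.Fits W s) (hx : x.Fits W s) (hc : i.cost + x.cost + 1 ≤ T)
    (h : Q (s.setArr a (i.eval s) (x.eval s))) :
    Halts W G π (.write a i x) s T Q :=
  ⟨_, _, .write s a i x hi hx, hc, h⟩

theorem halts_cons {p q : Program} {l : List Program} {s : State} (T₁ T₂ : ℕ) {T : ℕ}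
    {Q : State → Prop}
    (h : Halts W G π p s T₁ fun s' => Halts W G π (block (q :: l)) s' T₂ Q) (hc : T₁ + T₂ ≤ T) :
    Halts W G π (block (p :: q :: l)) s T Q := by
  obtain ⟨t₁, s₁, h1, h2, t₂, s₂, h3, h4, h5⟩ := h
  exact ⟨_, _, .seq h1 h3, by omega, h5⟩

theorem halts_assign_cons {q : Program} {l : List Program} {s : State} {T : ℕ}
    {Q : State → Prop} {r : ℕ} {x : Expr} (hx : x.Fits W s) (hc : x.cost + 1 ≤ T)
    (h : Halts W G π (block (q :: l)) (s.setReg r (x.eval s)) (T - (x.cost + 1)) Q) :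
    Halts W G π (block (.assign r x :: q :: l)) s T Q :=
  halts_cons (x.cost + 1) (T - (x.cost + 1)) (halts_assign hx le_rfl h) (by omega)

theorem halts_write_cons {q : Program} {l : List Program} {s : State} {T : ℕ}
    {Q : State → Prop} {a : ℕ} {i x : Expr} (hi : i.Fits W s) (hx : x.Fits W s)
    (hc : i.cost + x.cost + 1 ≤ T)
    (h : Halts W G π (block (q :: l)) (s.setArr a (i.eval s) (x.eval s))
      (T - (i.cost + x.cost + 1)) Q) :
    Halts W G π (block (.write a i x :: q :: l)) s T Q :=
  halts_cons (i.cost + x.cost + 1) (T - (i.cost + x.cost + 1)) (halts_write hi hx le_rfl h)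
    (by omega)

theorem halts_ite {b : Test} {p q : Program} {s : State} {T : ℕ} {Q : State → Prop}
    (hf : b.Fits W s) (hc : b.cost ≤ T)
    (hp : b.Holds G π s → Halts W G π p s (T - b.cost) Q)
    (hq : ¬ b.Holds G π s → Halts W G π q s (T - b.cost) Q) :
    Halts W G π (.ite b p q) s T Q := by
  by_cases hb : b.Holds G π s
  · obtain ⟨t, s', h1, h2, h3⟩ := hp hb
    exact ⟨_, _, .ite_true hf hb h1, by omega, h3⟩
  · obtain ⟨t, s', h1, h2, h3⟩ := hq hb
    exact ⟨_, _, .ite_false hf hb h1, by omega, h3⟩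

theorem Test.cost_pos (b : Test) : 1 ≤ b.cost := by
  cases b <;> simp [Test.cost]

/-- The rule for loops: `I c s` says that in the state `s` the loop is good for `c` more steps. -/
theorem halts_while {b : Test} {p : Program} {Q : State → Prop} (I : ℕ → State → Prop)
    (hf : ∀ c s, I c s → b.Fits W s)
    (hp : ∀ c s, I c s → b.Holds G π s → ∃ c₁ c₂, b.cost + c₁ + c₂ ≤ c ∧
      Halts W G π p s c₁ (I c₂))
    (hq : ∀ c s, I c s → ¬ b.Holds G π s → b.cost ≤ c ∧ Q s) {c : ℕ} {s : State} (h : I c s) :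
    Halts W G π (.while b p) s c Q := by
  induction c using Nat.strong_induction_on generalizing s with
  | _ c ih =>
    by_cases hb : b.Holds G π s
    · obtain ⟨c₁, c₂, hc, t, s', h1, h2, h3⟩ := hp c s h hb
      -- A test costs at least one step, so the budget decreases strictly in each round and serves
      -- as the termination measure.
      have hpos := b.cost_pos
      obtain ⟨t', s'', h4, h5, h6⟩ := ih c₂ (by omega) h3
      exact ⟨_, _, .while_true (hf c s h) hb h1 h4, by omega, h6⟩
    · obtain ⟨h1, h2⟩ := hq c s h hb
      exact ⟨_, _, .while_false (hf c s h) hb, h1, h2⟩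

@[simp] theorem setReg_reg (s : State) (r x r' : ℕ) :
    (s.setReg r x).reg r' = if r' = r then x else s.reg r' := by
  simp [State.setReg, Function.update_apply]

@[simp] theorem setReg_arr (s : State) (r x : ℕ) : (s.setReg r x).arr = s.arr := rfl

@[simp] theorem setArr_reg (s : State) (a i x : ℕ) : (s.setArr a i x).reg = s.reg := rfl

theorem setArr_arr (s : State) (a i x a' : ℕ) :
    (s.setArr a i x).arr a' = if a' = a then Function.update (s.arr a) i x else s.arr a' := by
  by_cases h : a' = a
  · subst h; simp [State.setArr]
  · simp [State.setArr, h]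

@[simp] theorem setArr_arr_same (s : State) (a i x : ℕ) :
    (s.setArr a i x).arr a = Function.update (s.arr a) i x := by
  simp [State.setArr]

theorem setArr_arr_ne (s : State) {a a' : ℕ} (i x : ℕ) (h : a' ≠ a) :
    (s.setArr a i x).arr a' = s.arr a' := by
  rw [setArr_arr, if_neg h]

theorem setArr_arr_le {s : State} {B : ℕ} (h : ∀ a i, s.arr a i ≤ B) {a i x : ℕ} (hx : x ≤ B)
    (a' i' : ℕ) : (s.setArr a i x).arr a' i' ≤ B := by
  rw [setArr_arr]
  split_ifs
  · rw [Function.update_apply]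
    split_ifs
    · exact hx
    · exact h _ _
  · exact h _ _

/-- An injective coding of pairs. -/
def pair (a b : ℕ) : ℕ := (a + b) * (a + b) + a

/-- The code lies between (a + b)² and (a + b + 1)², excluding the latter, so it determines a + b
and then a. -/
theorem pair_inj {a b a' b' : ℕ} : pair a b = pair a' b' ↔ a = a' ∧ b = b' := by
  constructor
  · intro h
    unfold pair at h
    have h1 : a + b = a' + b' := by
      rcases lt_trichotomy (a + b) (a' + b') with hlt | heq | hlt
      · nlinarith
      · exact heq
      · nlinarith
    rw [h1] at h
    omega
  · rintro ⟨rfl, rfl⟩; rfl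

def pairExpr (x y : Expr) : Expr :=
  .bin .add (.bin .mul (.bin .add x y) (.bin .add x y)) x

@[simp] theorem pairExpr_eval (x y : Expr) (s : State) :
    (pairExpr x y).eval s = pair (x.eval s) (y.eval s) := rfl

/-- The arguments are slots, tree positions, vertex names and list positions, all at most 2B + 1;
the code is then below (4B + 2)² + 2B + 2, which is where the factor 100 leaves ample room. -/
theorem pairExpr_fits {x y : Expr} {s : State} {B : ℕ} (hB : 1 ≤ B) (hW : 100 * (B * B) ≤ W)
    (hx : x.Fits W s) (hy : y.Fits W s) (hx' : x.eval s ≤ 2 * B + 1)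
    (hy' : y.eval s ≤ 2 * B + 1) : (pairExpr x y).Fits W s := by
  set a := x.eval s with ha
  set b := y.eval s with hb
  have h1 : a + b ≤ 4 * B + 2 := by omega
  have h2 : (a + b) * (a + b) ≤ (4 * B + 2) * (4 * B + 2) := Nat.mul_le_mul h1 h1
  have h3 : (4 * B + 2) * (4 * B + 2) + (2 * B + 1) < 100 * (B * B) := by nlinarith
  have h4 : a + b < W := by nlinarith
  have h5 : (a + b) * (a + b) < W := by omega
  have h6 : (a + b) * (a + b) + a < W := by omega
  exact ⟨⟨⟨hx, hy, h4⟩, ⟨hx, hy, h4⟩, h5⟩, hx, h6⟩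

end Logic

/-! ### The tournament tree that implements the queue -/

section Tree

/-- The node of the tournament tree that covers the slots `i * 2 ^ j, …, (i + 1) * 2 ^ j - 1`
contains the successor of the vertex of smallest rank of the queue `Q` whose slot is covered,
or `0`. -/
def NodeOK (π : ℕ → unitInterval) (T slot : ℕ → ℕ) (Q : Finset ℕ) (j i : ℕ) : Prop :=
  (T (pair j i) = 0 ∧ ∀ q ∈ Q, slot q / 2 ^ j ≠ i) ∨
    ∃ v ∈ Q, T (pair j i) = v + 1 ∧ slot v / 2 ^ j = i ∧ ∀ q ∈ Q, slot q / 2 ^ j = i → π v ≤ π q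

/-- The correctness of a node depends only on its own cell and on the queue vertices below it, so
changes elsewhere leave it intact. -/
theorem NodeOK.congr {π : ℕ → unitInterval} {T T' slot slot' : ℕ → ℕ} {Q Q' : Finset ℕ} {j i : ℕ}
    (h : NodeOK π T slot Q j i) (hT : T' (pair j i) = T (pair j i))
    (hQ : ∀ q, (q ∈ Q ∧ slot q / 2 ^ j = i) ↔ (q ∈ Q' ∧ slot' q / 2 ^ j = i)) :
    NodeOK π T' slot' Q' j i := by
  rcases h with ⟨h1, h2⟩ | ⟨v, hv, h1, h2, h3⟩
  · exact Or.inl ⟨hT.trans h1, fun q hq e => h2 q ((hQ q).2 ⟨hq, e⟩).1 ((hQ q).2 ⟨hq, e⟩).2⟩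
  · obtain ⟨h4, h5⟩ := (hQ v).1 ⟨hv, h2⟩
    exact Or.inr ⟨v, h4, hT.trans h1, h5, fun q hq e =>
      h3 q ((hQ q).2 ⟨hq, e⟩).1 ((hQ q).2 ⟨hq, e⟩).2⟩

theorem div_pow_succ (x j : ℕ) : x / 2 ^ (j + 1) = x / 2 ^ j / 2 := by
  rw [pow_succ, Nat.div_div_eq_div_mul]

/-- A node is computed from its two children. -/
theorem NodeOK.parent {π : ℕ → unitInterval} {T T' slot : ℕ → ℕ} {Q : Finset ℕ} {j i : ℕ}
    (hl : NodeOK π T slot Q j (i + i)) (hr : NodeOK π T slot Q j (i + i + 1))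
    (h0 : T (pair j (i + i)) = 0 → T' (pair (j + 1) i) = T (pair j (i + i + 1)))
    (h1 : T (pair j (i + i + 1)) = 0 → T' (pair (j + 1) i) = T (pair j (i + i)))
    (h2 : T (pair j (i + i)) ≠ 0 → T (pair j (i + i + 1)) ≠ 0 →
      π (T (pair j (i + i + 1)) - 1) < π (T (pair j (i + i)) - 1) →
      T' (pair (j + 1) i) = T (pair j (i + i + 1)))
    (h3 : T (pair j (i + i)) ≠ 0 → T (pair j (i + i + 1)) ≠ 0 →
      ¬ π (T (pair j (i + i + 1)) - 1) < π (T (pair j (i + i)) - 1) →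
      T' (pair (j + 1) i) = T (pair j (i + i))) :
    NodeOK π T' slot Q (j + 1) i := by
  have key : ∀ q, slot q / 2 ^ (j + 1) = i ↔ slot q / 2 ^ j = i + i ∨ slot q / 2 ^ j = i + i + 1 :=
    fun q => by rw [div_pow_succ]; omega
  rcases hl with ⟨hl1, hl2⟩ | ⟨v, hv, hl1, hl2, hl3⟩
  · rcases hr with ⟨hr1, hr2⟩ | ⟨u, hu, hr1, hr2, hr3⟩
    · refine Or.inl ⟨(h0 hl1).trans hr1, fun q hq e => ?_⟩
      rcases (key q).1 e with e | e
      · exact hl2 q hq e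
      · exact hr2 q hq e
    · refine Or.inr ⟨u, hu, (h0 hl1).trans hr1, (key u).2 (Or.inr hr2), fun q hq e => ?_⟩
      rcases (key q).1 e with e | e
      · exact absurd e (hl2 q hq)
      · exact hr3 q hq e
  · rcases hr with ⟨hr1, hr2⟩ | ⟨u, hu, hr1, hr2, hr3⟩
    · refine Or.inr ⟨v, hv, (h1 hr1).trans hl1, (key v).2 (Or.inl hl2), fun q hq e => ?_⟩
      rcases (key q).1 e with e | e
      · exact hl3 q hq e
      · exact absurd e (hr2 q hq)
    · have hl0 : T (pair j (i + i)) ≠ 0 := by omega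
      have hr0 : T (pair j (i + i + 1)) ≠ 0 := by omega
      have ev : T (pair j (i + i)) - 1 = v := by omega
      have eu : T (pair j (i + i + 1)) - 1 = u := by omega
      rw [ev, eu] at h2 h3
      by_cases hlt : π u < π v
      · refine Or.inr ⟨u, hu, (h2 hl0 hr0 hlt).trans hr1, (key u).2 (Or.inr hr2),
          fun q hq e => ?_⟩
        rcases (key q).1 e with e | e
        · exact hlt.le.trans (hl3 q hq e)
        · exact hr3 q hq e
      · refine Or.inr ⟨v, hv, (h3 hl0 hr0 hlt).trans hl1, (key v).2 (Or.inl hl2),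
          fun q hq e => ?_⟩
        rcases (key q).1 e with e | e
        · exact hl3 q hq e
        · exact (not_lt.1 hlt).trans (hr3 q hq e)

/-- Move register 10 to its parent, on the level above register 12, and recompute that node. -/
def treeStep : Program := block [
  .assign 10 (.bin .div (.reg 10) (.lit 2)),
  .assign 13 (.read 2 (pairExpr (.reg 12) (.bin .add (.reg 10) (.reg 10)))),
  .assign 14 (.read 2 (pairExpr (.reg 12) (.bin .add (.bin .add (.reg 10) (.reg 10)) (.lit 1)))),
  .assign 12 (.bin .add (.reg 12) (.lit 1)),
  .ite (.eq (.reg 13) (.lit 0))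
    (.write 2 (pairExpr (.reg 12) (.reg 10)) (.reg 14))
    (.ite (.eq (.reg 14) (.lit 0))
      (.write 2 (pairExpr (.reg 12) (.reg 10)) (.reg 13))
      (.ite (.rankLt (.bin .sub (.reg 14) (.lit 1)) (.bin .sub (.reg 13) (.lit 1)))
        (.write 2 (pairExpr (.reg 12) (.reg 10)) (.reg 14))
        (.write 2 (pairExpr (.reg 12) (.reg 10)) (.reg 13))))]

/-- Write register 11 into the leaf given by register 10 and update its ancestors. -/
def treeUpdate : Program := block [
  .write 2 (pairExpr (.lit 0) (.reg 10)) (.reg 11),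
  .assign 12 (.lit 0),
  .while (.lt (.reg 12) (.reg 4)) treeStep]

theorem treeStep_halts {W : ℕ} {G : SimpleGraph ℕ} {π : ℕ → unitInterval} {B i j p : ℕ}
    {s : State} (hB : 1 ≤ B) (hW : 100 * (B * B) ≤ W)
    (harr : ∀ a x, s.arr a x ≤ B) (hi : s.reg 10 = i) (hiB : i ≤ B) (hp : p = i / 2)
    (hj : s.reg 12 = j) (hjB : j < 2 * B) :
    Halts W G π treeStep s 80 fun s' =>
      (∀ r, r < 10 ∨ 14 < r → s'.reg r = s.reg r) ∧ s'.reg 10 = p ∧ s'.reg 12 = j + 1 ∧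
      (∀ a, a ≠ 2 → s'.arr a = s.arr a) ∧
      (∀ a x, s'.arr a x ≤ B) ∧
      (∀ y, y ≠ pair (j + 1) p → s'.arr 2 y = s.arr 2 y) ∧
      ∀ Q, NodeOK π (s.arr 2) (s.arr 3) Q j (p + p) → NodeOK π (s.arr 2) (s.arr 3) Q j (p + p + 1) →
        NodeOK π (s'.arr 2) (s.arr 3) Q (j + 1) p := by
  have hBW : 2 * B + 2 < W := by nlinarith
  have hA : ∀ a x, s.arr a x < W := fun a x => by have := harr a x; omega
  have hpB : p ≤ B := by omega
  subst hi hj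
  refine halts_assign_cons ?_ ?_ ?_
  · simp [Expr.Fits, Expr.eval, BinOp.eval]; omega
  · simp [Expr.cost]
  refine halts_assign_cons ?_ ?_ ?_
  · refine ⟨pairExpr_fits hB hW ?_ ?_ ?_ ?_, ?_⟩ <;>
      simp [Expr.Fits, Expr.eval, BinOp.eval, hA, ← hp] <;> omega
  · simp [Expr.cost, pairExpr]
  refine halts_assign_cons ?_ ?_ ?_
  · refine ⟨pairExpr_fits hB hW ?_ ?_ ?_ ?_, ?_⟩ <;>
      simp [Expr.Fits, Expr.eval, BinOp.eval, hA, ← hp] <;> omega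
  · simp [Expr.cost, pairExpr]
  refine halts_assign_cons ?_ ?_ ?_
  · simp [Expr.Fits, Expr.eval, BinOp.eval, ← hp]; omega
  · simp [Expr.cost, pairExpr]
  simp only [Expr.eval, BinOp.eval, pairExpr_eval, setReg_reg, setReg_arr, ← hp]
  simp only [Nat.reduceEqDiff, if_true, if_false]
  generalize hl : s.arr 2 (pair (s.reg 12) (p + p)) = l
  generalize hr : s.arr 2 (pair (s.reg 12) (p + p + 1)) = r
  have hlB : l ≤ B := by rw [← hl]; exact harr _ _
  have hrB : r ≤ B := by rw [← hr]; exact harr _ _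
  set s₂ := (((s.setReg 10 p).setReg 13 l).setReg 14 r).setReg 12 (s.reg 12 + 1) with hs₂
  have h10 : s₂.reg 10 = p := by simp [hs₂]
  have h12 : s₂.reg 12 = s.reg 12 + 1 := by simp [hs₂]
  have h13 : s₂.reg 13 = l := by simp [hs₂]
  have h14 : s₂.reg 14 = r := by simp [hs₂]
  have harr₂ : s₂.arr = s.arr := rfl
  have hreg : ∀ r, r < 10 ∨ 14 < r → s₂.reg r = s.reg r := by
    intro r hr
    have h1 : r ≠ 10 := by omega
    have h2 : r ≠ 12 := by omega
    have h3 : r ≠ 13 := by omega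
    have h4 : r ≠ 14 := by omega
    simp [hs₂, h1, h2, h3, h4]
  have hfit : (pairExpr (.reg 12) (.reg 10)).Fits W s₂ := by
    refine pairExpr_fits hB hW ?_ ?_ ?_ ?_ <;> simp [Expr.Fits, Expr.eval, h12, h10] <;> omega
  -- The four branches write to the same cell and differ only in the child `x` whose entry they
  -- copy, so the verification is shared.
  have fin : ∀ x T (e : Expr), e.Fits W s₂ → e.eval s₂ = x → x ≤ B → e.cost = 1 → 20 ≤ T →
      (l = 0 → x = r) → (r = 0 → x = l) →
      (l ≠ 0 → r ≠ 0 → π (r - 1) < π (l - 1) → x = r) →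
      (l ≠ 0 → r ≠ 0 → ¬ π (r - 1) < π (l - 1) → x = l) →
      Halts W G π (.write 2 (pairExpr (.reg 12) (.reg 10)) e) s₂ T fun s' =>
      (∀ r, r < 10 ∨ 14 < r → s'.reg r = s.reg r) ∧ s'.reg 10 = p ∧ s'.reg 12 = s.reg 12 + 1 ∧
      (∀ a, a ≠ 2 → s'.arr a = s.arr a) ∧
      (∀ a x, s'.arr a x ≤ B) ∧
      (∀ y, y ≠ pair (s.reg 12 + 1) p → s'.arr 2 y = s.arr 2 y) ∧
      ∀ Q, NodeOK π (s.arr 2) (s.arr 3) Q (s.reg 12) (p + p) →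
        NodeOK π (s.arr 2) (s.arr 3) Q (s.reg 12) (p + p + 1) →
        NodeOK π (s'.arr 2) (s.arr 3) Q (s.reg 12 + 1) p := by
    intro x T e he hx hxB hc hT e0 e1 e2 e3
    refine halts_write hfit he (by simp [Expr.cost, pairExpr]; omega) ?_
    rw [hx]
    simp only [pairExpr_eval, Expr.eval, h12, h10]
    refine ⟨hreg, h10, h12, fun a ha => ?_, setArr_arr_le (by rw [harr₂]; exact harr) hxB,
      fun y hy => ?_, fun Q hQl hQr => ?_⟩
    · rw [setArr_arr_ne _ _ _ ha, harr₂]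
    · rw [setArr_arr_same, Function.update_of_ne hy, harr₂]
    · refine NodeOK.parent hQl hQr ?_ ?_ ?_ ?_ <;>
        rw [setArr_arr_same, Function.update_self, hl, hr] <;> assumption
  refine halts_ite ?_ ?_ (fun hb => ?_) (fun hb => ?_)
  · simp [Test.Fits, Expr.Fits, h13]; omega
  · simp [Test.cost, Expr.cost, pairExpr]
  · simp only [Test.Holds, Expr.eval, h13] at hb
    refine fin r _ (.reg 14) ?_ h14 hrB rfl ?_ ?_ ?_ ?_ ?_
    · simp [Expr.Fits, h14]; omega
    · simp [Test.cost, Expr.cost, pairExpr]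
    all_goals (intros; first | rfl | omega)
  simp only [Test.Holds, Expr.eval, h13] at hb
  refine halts_ite ?_ ?_ (fun hb' => ?_) (fun hb' => ?_)
  · simp [Test.Fits, Expr.Fits, h14]; omega
  · simp [Test.cost, Expr.cost, pairExpr]
  · simp only [Test.Holds, Expr.eval, h14] at hb'
    refine fin l _ (.reg 13) ?_ h13 hlB rfl ?_ ?_ ?_ ?_ ?_
    · simp [Expr.Fits, h13]; omega
    · simp [Test.cost, Expr.cost, pairExpr]
    all_goals (intros; first | rfl | omega)
  simp only [Test.Holds, Expr.eval, h14] at hb'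
  refine halts_ite ?_ ?_ (fun hb'' => ?_) (fun hb'' => ?_)
  · simp [Test.Fits, Expr.Fits, Expr.eval, BinOp.eval, h13, h14]; omega
  · simp [Test.cost, Expr.cost, pairExpr]
  · simp only [Test.Holds, Expr.eval, BinOp.eval, h13, h14] at hb''
    refine fin r _ (.reg 14) ?_ h14 hrB rfl ?_ ?_ ?_ ?_ ?_
    · simp [Expr.Fits, h14]; omega
    · simp [Test.cost, Expr.cost, pairExpr]
    all_goals (intros; first | rfl | omega | contradiction)
  · simp only [Test.Holds, Expr.eval, BinOp.eval, h13, h14] at hb''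
    refine fin l _ (.reg 13) ?_ h13 hlB rfl ?_ ?_ ?_ ?_ ?_
    · simp [Expr.Fits, h13]; omega
    · simp [Test.cost, Expr.cost, pairExpr]
    all_goals (intros; first | rfl | omega | contradiction)

/-- The invariant of the tree: all its nodes are correct, and the cells above it are empty. -/
structure TreeOK (π : ℕ → unitInterval) (T slot : ℕ → ℕ) (h : ℕ) (Q : Finset ℕ) : Prop where
  node : ∀ j ≤ h, ∀ i, NodeOK π T slot Q j i
  above : ∀ j, h < j → ∀ i, T (pair j i) = 0

/-- A change at slot `i` can only spoil the nodes above it, at position i / 2^j on level j. If all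
other nodes are already right for the new queue, recomputing this path from the leaf to the root
repairs the tree. -/
theorem treeUpdate_halts {W : ℕ} {G : SimpleGraph ℕ} {π : ℕ → unitInterval} {B i v h : ℕ}
    {Q : Finset ℕ} {s : State} (hB : 1 ≤ B) (hW : 100 * (B * B) ≤ W)
    (harr : ∀ a x, s.arr a x ≤ B) (hi : s.reg 10 = i) (hiB : i ≤ B)
    (hv : s.reg 11 = v) (hvB : v ≤ B) (hh : s.reg 4 = h) (hhB : h ≤ 2 * B)
    (hleaf : (v = 0 ∧ ∀ q ∈ Q, s.arr 3 q ≠ i) ∨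
      ∃ u ∈ Q, v = u + 1 ∧ s.arr 3 u = i ∧ ∀ q ∈ Q, s.arr 3 q = i → π u ≤ π q)
    (hother : ∀ j ≤ h, ∀ x, x ≠ i / 2 ^ j → NodeOK π (s.arr 2) (s.arr 3) Q j x)
    (habove : ∀ j, h < j → ∀ x, s.arr 2 (pair j x) = 0) :
    Halts W G π treeUpdate s (100 * (h + 1)) fun s' =>
      (∀ r, r < 10 ∨ 14 < r → s'.reg r = s.reg r) ∧ (∀ a, a ≠ 2 → s'.arr a = s.arr a) ∧
        (∀ a x, s'.arr a x ≤ B) ∧ TreeOK π (s'.arr 2) (s.arr 3) h Q := by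
  have hBW : 2 * B + 2 < W := by nlinarith
  refine halts_write_cons ?_ ?_ ?_ ?_
  · refine pairExpr_fits hB hW ?_ ?_ ?_ ?_ <;> simp [Expr.Fits, Expr.eval] <;> omega
  · simp [Expr.Fits]; omega
  · simp [Expr.cost, pairExpr]; omega
  refine halts_assign_cons ?_ ?_ ?_
  · simp [Expr.Fits]; omega
  · simp [Expr.cost, pairExpr]; omega
  refine Halts.mono (T := 90 * h + 50) ?_ ?_ (fun _ => id)
  -- The climb has reached level `j`: a node is right if its level is at most `j` or if it lies off
  -- the path.
  · refine halts_while (c := 90 * h + 50) (fun c s₁ => ∃ j ≤ h, c = 90 * (h - j) + 50 ∧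
      s₁.reg 12 = j ∧ s₁.reg 10 = i / 2 ^ j ∧ (∀ r, r < 10 ∨ 14 < r → s₁.reg r = s.reg r) ∧
      (∀ a, a ≠ 2 → s₁.arr a = s.arr a) ∧ (∀ a x, s₁.arr a x ≤ B) ∧
      (∀ j' ≤ h, ∀ x, (j' ≤ j ∨ x ≠ i / 2 ^ j') → NodeOK π (s₁.arr 2) (s.arr 3) Q j' x) ∧
      ∀ j', h < j' → ∀ x, s₁.arr 2 (pair j' x) = 0) ?_ ?_ ?_ ?_
    · rintro c s₁ ⟨j, hj, -, h1, -, h2, -⟩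
      simp only [Test.Fits, Expr.Fits, h1, h2 4 (by omega), hh]
      omega
    · rintro c s₁ ⟨j, hj, rfl, h1, h2, h3, h4, h5, h6, h7⟩ hb
      simp only [Test.Holds, Expr.eval, h1, h3 4 (by omega), hh] at hb
      refine ⟨80, 90 * (h - (j + 1)) + 50, by simp [Test.cost, Expr.cost]; omega, ?_⟩
      refine (treeStep_halts hB hW h5 h2 ((Nat.div_le_self _ _).trans hiB) rfl h1
        (by omega)).mono le_rfl ?_
      rintro s₂ ⟨e1, e2, e3, e4, e5, e6, e7⟩
      refine ⟨j + 1, hb, rfl, e3, by rw [e2, div_pow_succ], fun r hr => (e1 r hr).trans (h3 r hr),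
        fun a ha => (e4 a ha).trans (h4 a ha), e5, ?_, ?_⟩
      · intro j' hj' x hx
        rw [h4 3 (by omega)] at e7
        by_cases hx' : j' = j + 1 ∧ x = i / 2 ^ j / 2
        · obtain ⟨rfl, rfl⟩ := hx'
          exact e7 Q (h6 j hj _ (Or.inl le_rfl)) (h6 j hj _ (Or.inl le_rfl))
        · refine (h6 j' hj' x ?_).congr (e6 _ ?_) fun q => Iff.rfl
          · by_cases hj'' : j' = j + 1
            · right
              rw [hj'', div_pow_succ]
              exact fun e => hx' ⟨hj'', e⟩
            · exact hx.imp (fun h => by omega) id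
          · rw [ne_eq, pair_inj]
            exact hx'
      · intro j' hj' x
        rw [e6 _ ?_]
        · exact h7 j' hj' x
        · rw [ne_eq, pair_inj]; omega
    · rintro c s₁ ⟨j, hj, rfl, h1, h2, h3, h4, h5, h6, h7⟩ hb
      simp only [Test.Holds, Expr.eval, h1, h3 4 (by omega), hh] at hb
      refine ⟨by simp [Test.cost, Expr.cost], h3, h4, h5, fun j' hj' x => ?_, h7⟩
      exact h6 j' hj' x (Or.inl (by omega))
    · simp only [pairExpr_eval, Expr.eval, setReg_reg, setReg_arr, hi, hv, setArr_reg]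
      refine ⟨0, Nat.zero_le _, rfl, by simp, by simp, ?_, ?_, ?_, ?_, ?_⟩
      · intro r hr
        rw [if_neg (by omega)]
      · intro a ha
        exact setArr_arr_ne _ _ _ ha
      · exact setArr_arr_le harr hvB
      · intro j' hj' x hx
        rw [setArr_arr_same]
        by_cases hx' : j' = 0 ∧ x = i
        · obtain ⟨rfl, rfl⟩ := hx'
          rcases hleaf with ⟨h1, h2⟩ | ⟨u, h1, h2, h3, h4⟩
          · exact Or.inl ⟨by rw [Function.update_self, h1], by simpa using h2⟩
          · exact Or.inr ⟨u, h1, by rw [Function.update_self, h2], by simpa using h3,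
              by simpa using h4⟩
        · refine (hother j' hj' x ?_).congr ?_ fun q => Iff.rfl
          · rcases hx with h | h
            · obtain rfl : j' = 0 := by omega
              simpa using hx'
            · exact h
          · rw [Function.update_of_ne]
            rw [ne_eq, pair_inj]; exact hx'
      · intro j' hj' x
        rw [setArr_arr_same, Function.update_of_ne]
        · exact habove j' hj' x
        · rw [ne_eq, pair_inj]; omega
  · simp [Expr.cost, pairExpr]; omega

end Tree
end DynLFMIS

namespace DynLFMIS

/-! ### Configurations of the algorithm and the potential -/

section Configurations

/-- The invariant of the algorithm: the active vertices `A` are partitioned into the current set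
`S`, the queue `Q` and the followers, which have a leader of smaller rank in `S` or `Q`; `O`
consists of the vertices of the queue that came there from `S`. -/
structure Inv (G : SimpleGraph ℕ) (π : ℕ → unitInterval) (k : ℕ) (A S Q O : Finset ℕ)
    (ld : ℕ → ℕ) : Prop where
  S_sub : S ⊆ A
  Q_sub : Q ⊆ A
  O_sub : O ⊆ Q
  disj : ∀ u ∈ S, u ∉ Q
  ld_S : ∀ u ∈ S, ld u = 0
  ld_Q : ∀ u ∈ Q, ld u = 0
  ld_F : ∀ u ∈ A, u ∉ S → u ∉ Q → ∃ w, ld u = w + 1 ∧ (w ∈ S ∨ w ∈ Q) ∧ G.Adj w u ∧ π w < π u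
  indep : ∀ u ∈ S, ∀ w ∈ S, ¬ G.Adj u w
  card_le : S.card ≤ k

/-- Old vertices of the queue that are their own eliminators come after `S`. -/
def OldLast (π : ℕ → unitInterval) (e : ℕ → ℕ) (S O : Finset ℕ) : Prop :=
  ∀ u ∈ O, e u = u → ∀ w ∈ S, π w < π u

/-- The contribution of a vertex to the potential, in terms of its eliminator `e u`. -/
def weight (e : ℕ → ℕ) (S Q O : Finset ℕ) (ld : ℕ → ℕ) (u : ℕ) : ℕ :=
  -- The weights make every move pay. A wrongly led follower goes to the queue: 5 → 4. A wrong
  -- member of `S` is thrown out: 7 → 6. A queue vertex attaches to its eliminator: 4 or 6 → 1. A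
  -- vertex that is its own eliminator enters `S`: 2 → 1 if it is old, 4 → 1 if not. The only loss
  -- is 1 → 2, when a right member of `S` is replaced, and the newcomer gains 3 at the same time.
  if u ∈ S then (if e u = u then 1 else 7)
  else if u ∈ O then (if e u = u then 2 else 6)
  else if u ∈ Q then 4
  else if ld u = e u + 1 then 1 else 5

def potential (e : ℕ → ℕ) (A S Q O : Finset ℕ) (ld : ℕ → ℕ) : ℕ :=
  ∑ u ∈ A, weight e S Q O ld u

theorem weight_le (e : ℕ → ℕ) (S Q O : Finset ℕ) (ld : ℕ → ℕ) (u : ℕ) :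
    weight e S Q O ld u ≤ 7 := by
  unfold weight; split_ifs <;> omega

theorem weight_pos (e : ℕ → ℕ) (S Q O : Finset ℕ) (ld : ℕ → ℕ) (u : ℕ) :
    1 ≤ weight e S Q O ld u := by
  unfold weight; split_ifs <;> omega

theorem weight_congr {e : ℕ → ℕ} {S S' Q Q' O O' : Finset ℕ} {ld ld' : ℕ → ℕ} {u : ℕ}
    (hS : u ∈ S' ↔ u ∈ S) (hQ : u ∈ Q' ↔ u ∈ Q) (hO : u ∈ O' ↔ u ∈ O) (hl : ld' u = ld u) :
    weight e S' Q' O' ld' u = weight e S Q O ld u := by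
  simp only [weight, hS, hQ, hO, hl]

theorem potential_change {e : ℕ → ℕ} {A S S' Q Q' O O' : Finset ℕ} {ld ld' : ℕ → ℕ} {u a b : ℕ}
    (hu : u ∈ A)
    (h : ∀ x ∈ A, x ≠ u → (x ∈ S' ↔ x ∈ S) ∧ (x ∈ Q' ↔ x ∈ Q) ∧ (x ∈ O' ↔ x ∈ O) ∧ ld' x = ld x)
    (hw : weight e S' Q' O' ld' u + a ≤ weight e S Q O ld u + b) :
    potential e A S' Q' O' ld' + a ≤ potential e A S Q O ld + b := by
  unfold potential
  rw [← Finset.sum_erase_add A _ hu, ← Finset.sum_erase_add A _ hu]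
  have : ∑ x ∈ A.erase u, weight e S' Q' O' ld' x = ∑ x ∈ A.erase u, weight e S Q O ld x := by
    refine Finset.sum_congr rfl fun x hx => ?_
    obtain ⟨h1, h2⟩ := Finset.mem_erase.1 hx
    obtain ⟨h3, h4, h5, h6⟩ := h x h2 h1
    exact weight_congr h3 h4 h5 h6
  omega

open Classical in
/-- A change of eliminators. -/
theorem potential_le_of_elim {e e' : ℕ → ℕ} {A S Q O : Finset ℕ} {ld : ℕ → ℕ} :
    potential e' A S Q O ld ≤
      potential e A S Q O ld + 6 * (A.filter fun u => e u ≠ e' u).card := by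
  unfold potential
  rw [Finset.card_filter, Finset.mul_sum, ← Finset.sum_add_distrib]
  refine Finset.sum_le_sum fun u _ => ?_
  by_cases h : e u = e' u
  · simp [weight, h]
  -- All weights lie between 1 and 7.
  · have h1 := weight_le e' S Q O ld u
    have h2 := weight_pos e S Q O ld u
    rw [if_pos h]
    omega

variable {G : SimpleGraph ℕ} {π : ℕ → unitInterval} {k : ℕ} {A S Q O : Finset ℕ} {ld : ℕ → ℕ}
  {e : ℕ → ℕ}

/-- A follower is released to the queue. -/
theorem Inv.release (h : Inv G π k A S Q O ld) {u w : ℕ} (hu : u ∈ A)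
    (hld : ld u = w + 1) : Inv G π k A S (insert u Q) O (Function.update ld u 0) where
  S_sub := h.S_sub
  Q_sub := Finset.insert_subset hu h.Q_sub
  O_sub := h.O_sub.trans (Finset.subset_insert _ _)
  disj x hx hx' := by
    rcases Finset.mem_insert.1 hx' with rfl | hx'
    · have := h.ld_S _ hx; omega
    · exact h.disj x hx hx'
  ld_S x hx := by
    rw [Function.update_apply]; split_ifs
    · rfl
    · exact h.ld_S x hx
  ld_Q x hx := by
    rw [Function.update_apply]; split_ifs with h1
    · rfl
    · exact h.ld_Q x ((Finset.mem_insert.1 hx).resolve_left h1)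
  ld_F x hx h1 h2 := by
    rw [Finset.mem_insert, not_or] at h2
    obtain ⟨y, h3, h4, h5⟩ := h.ld_F x hx h1 h2.2
    exact ⟨y, by rw [Function.update_of_ne h2.1, h3], h4.imp_right (Finset.mem_insert_of_mem), h5⟩
  indep := h.indep
  card_le := h.card_le

theorem Inv.potential_release (h : Inv G π k A S Q O ld) {u w : ℕ} (hu : u ∈ A)
    (hld : ld u = w + 1) (he : e u ≠ w) :
    potential e A S (insert u Q) O (Function.update ld u 0) + 1 ≤ potential e A S Q O ld := by
  refine potential_change (b := 0) hu (fun x _ hx => ?_) ?_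
  · simp [hx]
  · have h1 : u ∉ S := fun h' => by have := h.ld_S u h'; omega
    have h2 : u ∉ Q := fun h' => by have := h.ld_Q u h'; omega
    have h3 : u ∉ O := fun h' => h2 (h.O_sub h')
    have h4 : ld u ≠ e u + 1 := by omega
    simp [weight, h1, h2, h3, h4]

/-- A vertex of the queue without followers becomes a follower. -/
theorem Inv.attach (h : Inv G π k A S Q O ld) {q w : ℕ} (hq : q ∈ Q) (hw : w ∈ S)
    (hF : ∀ u ∈ A, ld u ≠ q + 1) (had : G.Adj w q) (hlt : π w < π q) :
    Inv G π k A S (Q.erase q) (O.erase q) (Function.update ld q (w + 1)) where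
  S_sub := h.S_sub
  Q_sub := (Finset.erase_subset _ _).trans h.Q_sub
  O_sub := Finset.erase_subset_erase _ h.O_sub
  disj x hx hx' := h.disj x hx (Finset.mem_of_mem_erase hx')
  ld_S x hx := by
    have : x ≠ q := fun e => h.disj x hx (e ▸ hq)
    rw [Function.update_of_ne this, h.ld_S x hx]
  ld_Q x hx := by
    rw [Finset.mem_erase] at hx
    rw [Function.update_of_ne hx.1, h.ld_Q x hx.2]
  ld_F x hx h1 h2 := by
    by_cases hxq : x = q
    · subst hxq
      exact ⟨w, by rw [Function.update_self], Or.inl hw, had, hlt⟩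
    · have h3 : x ∉ Q := fun h' => h2 (Finset.mem_erase.2 ⟨hxq, h'⟩)
      obtain ⟨y, h4, h5, h6⟩ := h.ld_F x hx h1 h3
      refine ⟨y, by rw [Function.update_of_ne hxq, h4], h5.imp_right fun h' => ?_, h6⟩
      refine Finset.mem_erase.2 ⟨?_, h'⟩
      rintro rfl
      exact hF x hx h4
  indep := h.indep
  card_le := h.card_le

theorem Inv.potential_attach (h : Inv G π k A S Q O ld) {q w : ℕ} (hq : q ∈ Q) (hw : w ∈ S)
    (he : e q = w) :
    potential e A S (Q.erase q) (O.erase q) (Function.update ld q (w + 1)) + 3 ≤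
      potential e A S Q O ld := by
  refine potential_change (b := 0) (h.Q_sub hq) (fun x _ hx => ?_) ?_
  · simp [hx]
  · have h1 : q ∉ S := fun h' => h.disj q h' hq
    have h2 : e q ≠ q := by rw [he]; rintro rfl; exact h1 hw
    by_cases h3 : q ∈ O <;> simp [weight, h1, h3, hq, he]
    have : w ≠ q := by rintro rfl; exact h1 hw
    simp [this]

/-- A vertex moves from the current set to the queue. -/
theorem Inv.drop (h : Inv G π k A S Q O ld) {x : ℕ} (hx : x ∈ S) :
    Inv G π k A (S.erase x) (insert x Q) (insert x O) ld where
  S_sub := (Finset.erase_subset _ _).trans h.S_sub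
  Q_sub := Finset.insert_subset (h.S_sub hx) h.Q_sub
  O_sub := Finset.insert_subset_insert _ h.O_sub
  disj u hu hu' := by
    rw [Finset.mem_erase] at hu
    exact h.disj u hu.2 ((Finset.mem_insert.1 hu').resolve_left hu.1)
  ld_S u hu := h.ld_S u (Finset.mem_of_mem_erase hu)
  ld_Q u hu := by
    rcases Finset.mem_insert.1 hu with rfl | hu
    · exact h.ld_S _ hx
    · exact h.ld_Q u hu
  ld_F u hu h1 h2 := by
    rw [Finset.mem_insert, not_or] at h2
    have h3 : u ∉ S := fun h' => h1 (Finset.mem_erase.2 ⟨h2.1, h'⟩)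
    obtain ⟨w, h4, h5, h6⟩ := h.ld_F u hu h3 h2.2
    refine ⟨w, h4, ?_, h6⟩
    rw [Finset.mem_erase, Finset.mem_insert]
    by_cases hwx : w = x
    · exact Or.inr (Or.inl hwx)
    · exact h5.imp (fun h' => ⟨hwx, h'⟩) Or.inr
  indep u hu w hw := h.indep u (Finset.mem_of_mem_erase hu) w (Finset.mem_of_mem_erase hw)
  card_le := (Finset.card_le_card (Finset.erase_subset _ _)).trans h.card_le

theorem Inv.potential_eliminate (h : Inv G π k A S Q O ld) {x : ℕ} (hx : x ∈ S) (he : e x ≠ x) :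
    potential e A (S.erase x) (insert x Q) (insert x O) ld + 1 ≤ potential e A S Q O ld := by
  refine potential_change (b := 0) (h.S_sub hx) (fun u _ hu => ?_) ?_
  · simp [hu]
  · simp [weight, hx, he]

/-- For use in a replacement, where it is not known whether `x` is its own eliminator. The loss of
at most 1 is outweighed by `Inv.potential_enter_new`. -/
theorem Inv.potential_drop (h : Inv G π k A S Q O ld) {x : ℕ} (hx : x ∈ S) :
    potential e A (S.erase x) (insert x Q) (insert x O) ld ≤ potential e A S Q O ld + 1 := by
  refine potential_change (a := 0) (h.S_sub hx) (fun u _ hu => ?_) ?_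
  · simp [hu]
  · by_cases he : e x = x <;> simp [weight, hx, he]

/-- The dropped vertex becomes old, so it has to be harmless: either it is not its own eliminator,
as in an elimination, or it was the last of `S`, as in a replacement. -/
theorem OldLast.drop (h : OldLast π e S O) {x : ℕ}
    (hx : e x = x → ∀ w ∈ S, w ≠ x → π w < π x) : OldLast π e (S.erase x) (insert x O) := by
  intro u hu he w hw
  rw [Finset.mem_erase] at hw
  rcases Finset.mem_insert.1 hu with rfl | hu
  · exact hx he w hw.2 hw.1
  · exact h u hu he w hw.2

theorem OldLast.erase (h : OldLast π e S O) (q : ℕ) : OldLast π e S (O.erase q) :=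
  fun u hu => h u (Finset.mem_of_mem_erase hu)

/-- A vertex of the queue enters the current set. -/
theorem Inv.enter (h : Inv G π k A S Q O ld) {q : ℕ} (hq : q ∈ Q) (had : ∀ w ∈ S, ¬ G.Adj w q)
    (hk : S.card < k) : Inv G π k A (insert q S) (Q.erase q) (O.erase q) ld where
  S_sub := Finset.insert_subset (h.Q_sub hq) h.S_sub
  Q_sub := (Finset.erase_subset _ _).trans h.Q_sub
  O_sub := Finset.erase_subset_erase _ h.O_sub
  disj u hu hu' := by
    rw [Finset.mem_erase] at hu'
    exact h.disj u ((Finset.mem_insert.1 hu).resolve_left hu'.1) hu'.2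
  ld_S u hu := by
    rcases Finset.mem_insert.1 hu with rfl | hu
    · exact h.ld_Q _ hq
    · exact h.ld_S u hu
  ld_Q u hu := h.ld_Q u (Finset.mem_of_mem_erase hu)
  ld_F u hu h1 h2 := by
    rw [Finset.mem_insert, not_or] at h1
    have h3 : u ∉ Q := fun h' => h2 (Finset.mem_erase.2 ⟨h1.1, h'⟩)
    obtain ⟨w, h4, h5, h6⟩ := h.ld_F u hu h1.2 h3
    refine ⟨w, h4, ?_, h6⟩
    rw [Finset.mem_erase, Finset.mem_insert]
    by_cases hwx : w = q
    · exact Or.inl (Or.inl hwx)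
    · exact h5.imp Or.inr fun h' => ⟨hwx, h'⟩
  indep u hu w hw := by
    rcases Finset.mem_insert.1 hu with rfl | hu' <;> rcases Finset.mem_insert.1 hw with rfl | hw'
    · exact G.loopless.irrefl _
    · exact fun h' => had _ hw' h'.symm
    · exact had _ hu'
    · exact h.indep u hu' w hw'
  card_le := (Finset.card_insert_le _ _).trans hk

theorem Inv.potential_enter (h : Inv G π k A S Q O ld) {q : ℕ} (hq : q ∈ Q) (he : e q = q) :
    potential e A (insert q S) (Q.erase q) (O.erase q) ld + 1 ≤ potential e A S Q O ld := by
  refine potential_change (b := 0) (h.Q_sub hq) (fun x _ hx => ?_) ?_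
  · simp [hx]
  · have h1 : q ∉ S := fun h' => h.disj q h' hq
    by_cases h3 : q ∈ O <;> simp [weight, h1, h3, hq, he]

theorem Inv.potential_enter_new (h : Inv G π k A S Q O ld) {q : ℕ} (hq : q ∈ Q) (hO : q ∉ O)
    (he : e q = q) :
    potential e A (insert q S) (Q.erase q) (O.erase q) ld + 3 ≤ potential e A S Q O ld := by
  refine potential_change (b := 0) (h.Q_sub hq) (fun x _ hx => ?_) ?_
  · simp [hx]
  · have h1 : q ∉ S := fun h' => h.disj q h' hq
    simp [weight, h1, hO, hq, he]

/-- The treated vertex is the first of the queue, so it precedes all other old vertices. -/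
theorem OldLast.enter (h : OldLast π e S O) {q : ℕ} (hq : ∀ u ∈ O, u ≠ q → π q < π u) :
    OldLast π e (insert q S) (O.erase q) := by
  intro u hu he w hw
  rw [Finset.mem_erase] at hu
  rcases Finset.mem_insert.1 hw with rfl | hw
  · exact hq u hu.2 hu.1
  · exact h u hu.2 he w hw

/-- A vertex without followers is deleted. -/
theorem Inv.delete (h : Inv G π k A S Q O ld) {v : ℕ} (hF : ∀ u ∈ A, ld u ≠ v + 1) :
    Inv G π k (A.erase v) (S.erase v) (Q.erase v) (O.erase v) ld where
  S_sub := Finset.erase_subset_erase _ h.S_sub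
  Q_sub := Finset.erase_subset_erase _ h.Q_sub
  O_sub := Finset.erase_subset_erase _ h.O_sub
  disj u hu hu' := h.disj u (Finset.mem_of_mem_erase hu) (Finset.mem_of_mem_erase hu')
  ld_S u hu := h.ld_S u (Finset.mem_of_mem_erase hu)
  ld_Q u hu := h.ld_Q u (Finset.mem_of_mem_erase hu)
  ld_F u hu h1 h2 := by
    rw [Finset.mem_erase] at hu h1 h2
    obtain ⟨w, h3, h4, h5⟩ := h.ld_F u hu.2 (fun h' => h1 ⟨hu.1, h'⟩) (fun h' => h2 ⟨hu.1, h'⟩)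
    have hw : w ≠ v := by rintro rfl; exact hF u hu.2 h3
    exact ⟨w, h3, h4.imp (fun h' => Finset.mem_erase.2 ⟨hw, h'⟩)
      fun h' => Finset.mem_erase.2 ⟨hw, h'⟩, h5⟩
  indep u hu w hw := h.indep u (Finset.mem_of_mem_erase hu) w (Finset.mem_of_mem_erase hw)
  card_le := (Finset.card_le_card (Finset.erase_subset _ _)).trans h.card_le

theorem potential_delete (v : ℕ) :
    potential e (A.erase v) (S.erase v) (Q.erase v) (O.erase v) ld ≤ potential e A S Q O ld := by
  unfold potential
  refine (Finset.sum_congr rfl fun x hx => ?_).trans_le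
    (Finset.sum_le_sum_of_subset (Finset.erase_subset v A))
  have hx' := (Finset.mem_erase.1 hx).1
  refine weight_congr ?_ ?_ ?_ rfl <;> simp [hx']

/-- A vertex is inserted. -/
theorem Inv.insert (h : Inv G π k A S Q O ld) {v : ℕ} (hv : v ∉ A) :
    Inv G π k (insert v A) S (insert v Q) O (Function.update ld v 0) where
  S_sub := h.S_sub.trans (Finset.subset_insert _ _)
  Q_sub := Finset.insert_subset_insert _ h.Q_sub
  O_sub := h.O_sub.trans (Finset.subset_insert _ _)
  disj x hx hx' := by
    rcases Finset.mem_insert.1 hx' with rfl | hx'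
    · exact hv (h.S_sub hx)
    · exact h.disj x hx hx'
  ld_S x hx := by
    rw [Function.update_apply]; split_ifs
    · rfl
    · exact h.ld_S x hx
  ld_Q x hx := by
    rw [Function.update_apply]; split_ifs with h1
    · rfl
    · exact h.ld_Q x ((Finset.mem_insert.1 hx).resolve_left h1)
  ld_F x hx h1 h2 := by
    rw [Finset.mem_insert, not_or] at h2
    obtain ⟨y, h3, h4, h5⟩ := h.ld_F x ((Finset.mem_insert.1 hx).resolve_left h2.1) h1 h2.2
    exact ⟨y, by rw [Function.update_of_ne h2.1, h3], h4.imp_right (Finset.mem_insert_of_mem), h5⟩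
  indep := h.indep
  card_le := h.card_le

theorem Inv.potential_insert (h : Inv G π k A S Q O ld) {v : ℕ} (hv : v ∉ A) :
    potential e (Insert.insert v A) S (Insert.insert v Q) O (Function.update ld v 0) ≤
      potential e A S Q O ld + 4 := by
  unfold potential
  rw [Finset.sum_insert hv, add_comm]
  refine add_le_add (Finset.sum_le_sum fun x hx => (weight_congr Iff.rfl ?_ Iff.rfl ?_).le) ?_
  · have : x ≠ v := fun e => hv (e ▸ hx)
    simp [this]
  · rw [Function.update_of_ne]
    exact fun e => hv (e ▸ hx)
  · have h1 : v ∉ S := fun h' => hv (h.S_sub h')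
    have h2 : v ∉ O := fun h' => hv (h.Q_sub (h.O_sub h'))
    simp [weight, h1, h2]

/-! ### Correctness: comparing the current set with the LFMIS -/

/-- Below the ranks of the queue, the current set is the LFMIS. -/
theorem Inv.mem_iff (h : Inv G π k A S Q O ld) (hπ : Function.Injective π) {u : ℕ} (hu : u ∈ A)
    (hq : ∀ q ∈ Q, π u < π q) : u ∈ S ↔ u ∈ lfmis G π A := by
  -- Induction on the rank. Both sets are independent, and a vertex below the queue that is missing
  -- from either of them has an earlier neighbour in it.
  have hwf : WellFounded fun a b : {x // x ∈ A} => π a < π b :=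
    Finite.wellFounded_of_trans_of_irrefl _
  have key : ∀ a : {x // x ∈ A}, (∀ q ∈ Q, π a < π q) → (a.1 ∈ S ↔ a.1 ∈ lfmis G π A) := by
    intro a
    induction a using hwf.induction with
    | _ a ih =>
      intro ha
      constructor
      · intro haS
        by_contra hne
        obtain ⟨w, hw, had, hlt⟩ := exists_adj_of_notMem_lfmis hπ a.2 hne
        have := (ih ⟨w, lfmis_subset _ _ _ hw⟩ hlt fun q hq => hlt.trans (ha q hq)).2 hw
        exact h.indep _ this _ haS had
      · intro haI
        by_contra hne
        have haQ : a.1 ∉ Q := fun h' => lt_irrefl _ (ha _ h')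
        obtain ⟨w, -, hw, had, hlt⟩ := h.ld_F a a.2 hne haQ
        -- A leader has smaller rank than its follower; if it were in the queue, the follower would
        -- not lie below the queue.
        have hwS : w ∈ S := hw.resolve_right fun h' => lt_asymm hlt (ha _ h')
        have := (ih ⟨w, h.S_sub hwS⟩ hlt fun q hq => hlt.trans (ha q hq)).1 hwS
        exact not_adj_of_mem_lfmis this haI had
  exact key ⟨u, hu⟩ hq

/-- The first vertex of the queue is in the LFMIS unless the current set dominates it. -/
theorem Inv.mem_lfmis_of_min (h : Inv G π k A S Q O ld) (hπ : Function.Injective π) {q : ℕ}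
    (hq : q ∈ Q) (hmin : ∀ x ∈ Q, π q ≤ π x) (hS : ∀ w ∈ S, π w < π q → ¬ G.Adj w q) :
    q ∈ lfmis G π A := by
  by_contra hne
  obtain ⟨w, hw, had, hlt⟩ := exists_adj_of_notMem_lfmis hπ (h.Q_sub hq) hne
  exact hS w ((h.mem_iff hπ (lfmis_subset _ _ _ hw) fun x hx => hlt.trans_le (hmin x hx)).2 hw)
    hlt had

/-- The eliminator of the first vertex of the queue is its first dominator in the current set. -/
theorem Inv.elim_of_min (h : Inv G π k A S Q O ld) (hπ : Function.Injective π) {q w : ℕ}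
    (hmin : ∀ x ∈ Q, π q ≤ π x) (hw : w ∈ S) (had : G.Adj w q)
    (hlt : π w < π q) (hfirst : ∀ x ∈ S, π x < π q → G.Adj x q → π w ≤ π x) :
    elim G π A q = w := by
  have hwI := (h.mem_iff hπ (h.S_sub hw) fun x hx => hlt.trans_le (hmin x hx)).1 hw
  refine elim_eq hπ hwI (Or.inr had) fun x hx hxq => ?_
  rcases hxq with rfl | hxq
  · exact hlt.le
  · by_contra hlt'
    rw [not_le] at hlt'
    exact not_le.2 hlt' (hfirst x ((h.mem_iff hπ (lfmis_subset _ _ _ hx) fun y hy =>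
      (hlt'.trans hlt).trans_le (hmin y hy)).2 hx) (hlt'.trans hlt) hxq)

/-- The configurations in which the algorithm waits for the next update. -/
def Settled (G : SimpleGraph ℕ) (π : ℕ → unitInterval) (k : ℕ) (S Q : Finset ℕ) : Prop :=
  Q = ∅ ∨ S.card = k ∧ ∃ q ∈ Q, (∀ x ∈ Q, π q ≤ π x) ∧ (∀ w ∈ S, π w < π q ∧ ¬ G.Adj w q)

/-- Between updates the whole queue comes after `S`, so the condition holds for every choice of
eliminators. It can thus be restarted after each update, when the eliminators have changed. -/
theorem Settled.oldLast (h : Settled G π k S Q) (hO : O ⊆ Q) (e : ℕ → ℕ) : OldLast π e S O := by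
  intro u hu _ w hw
  rcases h with rfl | ⟨-, q, -, h1, h2⟩
  · simpa using hO hu
  · exact (h2 w hw).1.trans_le (h1 u (hO hu))

/-- If the queue is empty, `Inv.mem_iff` applies to all vertices. Otherwise its first vertex `q`
lies in the LFMIS, since no vertex of `S` is adjacent to it; the members before `q` are exactly the
`k` vertices of `S`, and `q` shows that the LFMIS is larger. -/
theorem Inv.topLFMIS_of_settled (h : Inv G π k A S Q O ld) (hπ : Function.Injective π)
    (hs : Settled G π k S Q) :
    S = topLFMIS G π A k ∧ (Q.Nonempty → topLFMIS G π A k ≠ lfmis G π A) := by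
  rcases hs with rfl | ⟨hk, q, hq, hmin, hS⟩
  · have hSI : S = lfmis G π A := by
      ext u
      constructor
      · exact fun hu => (h.mem_iff hπ (h.S_sub hu) (by simp)).1 hu
      · exact fun hu => (h.mem_iff hπ (lfmis_subset _ _ _ hu) (by simp)).2 hu
    refine ⟨?_, fun h => absurd h (by simp)⟩
    rw [topLFMIS, ← hSI, eq_comm, Finset.filter_eq_self]
    intro v hv
    refine lt_of_lt_of_le (Finset.card_lt_card (Finset.filter_ssubset.2 ⟨v, hv, ?_⟩)) h.card_le
    exact lt_irrefl _
  · have hqI : q ∈ lfmis G π A := h.mem_lfmis_of_min hπ hq hmin fun w hw _ => (hS w hw).2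
    have hSI : ∀ u ∈ S, u ∈ lfmis G π A := fun u hu =>
      (h.mem_iff hπ (h.S_sub hu) fun x hx => (hS u hu).1.trans_le (hmin x hx)).1 hu
    have hIS : ∀ u ∈ lfmis G π A, π u < π q → u ∈ S := fun u hu hlt =>
      (h.mem_iff hπ (lfmis_subset _ _ _ hu) fun x hx => hlt.trans_le (hmin x hx)).2 hu
    have hST : S = topLFMIS G π A k := by
      ext u
      rw [topLFMIS, Finset.mem_filter]
      constructor
      · intro hu
        refine ⟨hSI u hu, hk ▸ Finset.card_lt_card ?_⟩
        refine Finset.ssubset_iff_subset_ne.2 ⟨fun x hx => ?_, fun heq => ?_⟩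
        · rw [Finset.mem_filter] at hx
          exact hIS x hx.1 (hx.2.trans (hS u hu).1)
        · rw [← heq, Finset.mem_filter] at hu
          exact lt_irrefl _ hu.2
      · rintro ⟨hu, hlt⟩
        by_contra hne
        have hge : π q ≤ π u := not_lt.1 fun h' => hne (hIS u hu h')
        refine absurd hlt (not_lt.2 (hk ▸ Finset.card_le_card fun x hx => ?_))
        exact Finset.mem_filter.2 ⟨hSI x hx, (hS x hx).1.trans_le hge⟩
    refine ⟨hST, fun _ heq => ?_⟩
    rw [← hST] at heq
    exact lt_irrefl _ (hS q (heq ▸ hqI)).1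

/-- The strong condition on leaders is demanded only when `S` is the whole LFMIS. Then the queue is
empty and every leader lies in `S`. -/
theorem Inv.isTop_of_settled (h : Inv G π k A S Q O ld) (hπ : Function.Injective π)
    (hs : Settled G π k S Q) {ℓ : ℕ → Option ℕ} (h0 : ∀ u, ld u = 0 → ℓ u = none)
    (h1 : ∀ u w, ld u = w + 1 → ℓ u = some w) : IsTopLFMISWithLeaders G π A k S ℓ := by
  obtain ⟨hT, hQ⟩ := h.topLFMIS_of_settled hπ hs
  refine ⟨hT, fun v hv u hu => ?_, fun heq v hv hvS => ?_, fun v hv => h0 v (h.ld_S v hv)⟩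
  · by_cases hvS : v ∈ S
    · simp [h0 v (h.ld_S v hvS)] at hu
    by_cases hvQ : v ∈ Q
    · simp [h0 v (h.ld_Q v hvQ)] at hu
    obtain ⟨w, h2, h3, h4, -⟩ := h.ld_F v hv hvS hvQ
    obtain rfl : w = u := by simpa [h1 v w h2] using hu
    exact ⟨h3.elim (fun h5 => h.S_sub h5) (fun h5 => h.Q_sub h5), h4.symm⟩
  · have hQ0 : Q = ∅ := by
      by_contra hne
      exact hQ (Finset.nonempty_iff_ne_empty.2 hne) heq
    subst hQ0
    obtain ⟨w, h2, h3, h4, -⟩ := h.ld_F v hv hvS (by simp)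
    exact ⟨w, h3.resolve_right (by simp), h1 v w h2⟩

end Configurations
end DynLFMIS

namespace DynLFMIS

/-! ### Finite sets in arrays: lists, slots, lists of followers -/

section Arrays

/-- The first `n` cells of the array list the finite set `S` without repetition. -/
def Lists (f : ℕ → ℕ) (n : ℕ) (S : Finset ℕ) : Prop :=
  S.card = n ∧ (Finset.range n).image f = S

theorem Lists.injOn {f : ℕ → ℕ} {n : ℕ} {S : Finset ℕ} (h : Lists f n S) {i j : ℕ} (hi : i < n)
    (hj : j < n) (hij : f i = f j) : i = j := by
  have h1 : Set.InjOn f (Finset.range n) := by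
    rw [← Finset.card_image_iff, h.2, h.1, Finset.card_range]
  exact h1 (by simpa using hi) (by simpa using hj) hij

theorem Lists.mem {f : ℕ → ℕ} {n : ℕ} {S : Finset ℕ} (h : Lists f n S) {i : ℕ} (hi : i < n) :
    f i ∈ S := by
  rw [← h.2]; exact Finset.mem_image_of_mem f (Finset.mem_range.2 hi)

theorem Lists.exists_index {f : ℕ → ℕ} {n : ℕ} {S : Finset ℕ} (h : Lists f n S) {x : ℕ}
    (hx : x ∈ S) : ∃ i < n, f i = x := by
  rw [← h.2, Finset.mem_image] at hx
  simpa using hx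

theorem lists_of {f : ℕ → ℕ} {n : ℕ} {S : Finset ℕ}
    (hinj : ∀ i < n, ∀ j < n, f i = f j → i = j) (hS : ∀ x, x ∈ S ↔ ∃ i < n, f i = x) :
    Lists f n S := by
  have h2 : (Finset.range n).image f = S := by
    ext x; rw [hS]; simp
  refine ⟨?_, h2⟩
  rw [← h2, Finset.card_image_of_injOn, Finset.card_range]
  intro i hi j hj hij
  exact hinj i (by simpa using hi) j (by simpa using hj) hij

theorem Lists.swapLast {f : ℕ → ℕ} {n m : ℕ} {S : Finset ℕ} (h : Lists f n S) (hm : m < n) :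
    Lists (Function.update f m (f (n - 1))) (n - 1) (S.erase (f m)) := by
  -- The new array is the old one after a reindexing that is injective on the first n - 1 indices,
  -- also when m = n - 1.
  have hf : ∀ i, Function.update f m (f (n - 1)) i = f (if i = m then n - 1 else i) := by
    intro i
    rw [Function.update_apply]; split_ifs <;> rfl
  refine lists_of (fun i hi j hj hij => ?_) fun x => ?_
  · rw [hf, hf] at hij
    have := h.injOn (by split_ifs <;> omega) (by split_ifs <;> omega) hij
    split_ifs at this <;> omega
  · rw [Finset.mem_erase]
    constructor
    · rintro ⟨h1, h2⟩
      obtain ⟨i, hi, rfl⟩ := h.exists_index h2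
      have him : i ≠ m := fun e => h1 (by rw [e])
      by_cases hin : i = n - 1
      · exact ⟨m, by omega, by rw [Function.update_self, hin]⟩
      · exact ⟨i, by omega, by rw [Function.update_of_ne him]⟩
    · rintro ⟨i, hi, rfl⟩
      rw [hf]
      refine ⟨fun e => ?_, h.mem (by split_ifs <;> omega)⟩
      have := h.injOn (by split_ifs <;> omega) hm e
      split_ifs at this <;> omega

theorem Lists.push {f : ℕ → ℕ} {n x : ℕ} {S : Finset ℕ} (h : Lists f n S) (hx : x ∉ S) :
    Lists (Function.update f n x) (n + 1) (insert x S) := by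
  refine ⟨by rw [Finset.card_insert_of_notMem hx, h.1], ?_⟩
  rw [Finset.range_add_one, Finset.image_insert, Function.update_self, ← h.2]
  congr 1
  refine Finset.image_congr fun i hi => ?_
  rw [Function.update_of_ne]
  simp at hi; omega

theorem Lists.replace {f : ℕ → ℕ} {n m x : ℕ} {S : Finset ℕ} (h : Lists f n S) (hm : m < n)
    (hx : x ∉ S) : Lists (Function.update f m x) n (insert x (S.erase (f m))) := by
  have hne : ∀ i < n, f i ≠ x := fun i hi e => hx (e ▸ h.mem hi)
  refine lists_of (fun i hi j hj hij => ?_) fun y => ?_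
  · rw [Function.update_apply, Function.update_apply] at hij
    split_ifs at hij with h1 h2 h2
    · omega
    · exact absurd hij.symm (hne j hj)
    · exact absurd hij (hne i hi)
    · exact h.injOn hi hj hij
  · rw [Finset.mem_insert, Finset.mem_erase]
    constructor
    · rintro (rfl | ⟨h1, h2⟩)
      · exact ⟨m, hm, by rw [Function.update_self]⟩
      · obtain ⟨i, hi, rfl⟩ := h.exists_index h2
        exact ⟨i, hi, by rw [Function.update_of_ne]; exact fun e => h1 (by rw [e])⟩
    · rintro ⟨i, hi, rfl⟩
      rw [Function.update_apply]
      split_ifs with h1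
      · exact Or.inl rfl
      · exact Or.inr ⟨fun e => h1 (h.injOn hi hm e), h.mem hi⟩

/-- The slots of the active vertices, and the stack of free slots. -/
structure SlotOK (A : Finset ℕ) (slot free : ℕ → ℕ) (fc nn : ℕ) : Prop where
  inj : ∀ u ∈ A, ∀ v ∈ A, slot u = slot v → u = v
  lt : ∀ u ∈ A, slot u < nn
  free_lt : ∀ i < fc, free i < nn
  free_ne : ∀ i < fc, ∀ u ∈ A, slot u ≠ free i
  free_inj : ∀ i < fc, ∀ j < fc, free i = free j → i = j
  card : nn = A.card + fc

/-- The lists of followers. -/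
structure FolOK (A : Finset ℕ) (ld F cnt pos : ℕ → ℕ) : Prop where
  list : ∀ w ∈ A, ∀ i < cnt w, F (pair w i) ∈ A ∧ ld (F (pair w i)) = w + 1 ∧
    pos (F (pair w i)) = i
  pos : ∀ u ∈ A, ∀ w, ld u = w + 1 → pos u < cnt w ∧ F (pair w (pos u)) = u

/-- The stored positions invert the list, so its entries are distinct active vertices. This keeps
the counters within the word size. -/
theorem FolOK.cnt_le {A : Finset ℕ} {ld F cnt pos : ℕ → ℕ} (h : FolOK A ld F cnt pos) {w : ℕ}
    (hw : w ∈ A) : cnt w ≤ A.card := by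
  rw [← Finset.card_range (cnt w)]
  refine Finset.card_le_card_of_injOn (fun i => F (pair w i)) (fun i hi => ?_) fun i hi j hj e => ?_
  · exact (h.list w hw i (by simpa using hi)).1
  · rw [← (h.list w hw i (by simpa using hi)).2.2, ← (h.list w hw j (by simpa using hj)).2.2]
    exact congrArg pos e

/-- The last follower of `w` is released. -/
theorem FolOK.pop {A : Finset ℕ} {ld F cnt pos : ℕ → ℕ} (h : FolOK A ld F cnt pos) {w c : ℕ}
    (hw : w ∈ A) (hc : cnt w = c + 1) :
    FolOK A (Function.update ld (F (pair w c)) 0) F (Function.update cnt w c) pos := by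
  obtain ⟨h1, h2, h3⟩ := h.list w hw c (by omega)
  constructor
  · intro x hx i hi
    have hi' : i < cnt x := by
      rw [Function.update_apply] at hi
      split_ifs at hi with e
      · rw [e]; omega
      · exact hi
    obtain ⟨h4, h5, h6⟩ := h.list x hx i hi'
    refine ⟨h4, ?_, h6⟩
    rw [Function.update_of_ne, h5]
    intro e
    rw [e, h3] at h6
    rw [e, h2] at h5
    obtain rfl : w = x := by omega
    rw [Function.update_self] at hi
    omega
  · intro u hu x hx
    rw [Function.update_apply] at hx
    split_ifs at hx with e
    obtain ⟨h4, h5⟩ := h.pos u hu x hx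
    refine ⟨?_, h5⟩
    rw [Function.update_apply]
    split_ifs with e'
    · subst e'
      have : pos u ≠ c := fun e'' => e (by rw [← h5, e''])
      omega
    · exact h4

/-- A vertex that has no leader becomes the last follower of `w`. -/
theorem FolOK.push {A : Finset ℕ} {ld F cnt pos : ℕ → ℕ} (h : FolOK A ld F cnt pos) {w q : ℕ}
    (hw : w ∈ A) (hq : q ∈ A) (hq0 : ld q = 0) :
    FolOK A (Function.update ld q (w + 1)) (Function.update F (pair w (cnt w)) q)
      (Function.update cnt w (cnt w + 1)) (Function.update pos q (cnt w)) := by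
  constructor
  · intro x hx i hi
    by_cases hxi : x = w ∧ i = cnt w
    · obtain ⟨rfl, rfl⟩ := hxi
      simp [hq]
    · have hi' : i < cnt x := by
        rw [Function.update_apply] at hi
        split_ifs at hi with e
        · subst e; have := fun e => hxi ⟨rfl, e⟩; omega
        · exact hi
      have hne : pair x i ≠ pair w (cnt w) := by rw [ne_eq, pair_inj]; exact hxi
      obtain ⟨h4, h5, h6⟩ := h.list x hx i hi'
      have hne' : F (pair x i) ≠ q := by rintro rfl; omega
      rw [Function.update_of_ne hne, Function.update_of_ne hne', Function.update_of_ne hne']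
      exact ⟨h4, h5, h6⟩
  · intro u hu x hx
    by_cases huq : u = q
    · subst huq
      rw [Function.update_self] at hx
      obtain rfl : w = x := by omega
      simp
    · rw [Function.update_of_ne huq] at hx
      obtain ⟨h4, h5⟩ := h.pos u hu x hx
      have hne : pair x (pos u) ≠ pair w (cnt w) := by
        rw [ne_eq, pair_inj]; rintro ⟨rfl, e⟩; omega
      rw [Function.update_of_ne huq, Function.update_of_ne hne]
      refine ⟨?_, h5⟩
      rw [Function.update_apply]; split_ifs with e
      · subst e; omega
      · exact h4

/-- A follower of `w` is removed from its list; the last follower takes its place. -/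
theorem FolOK.remove {A : Finset ℕ} {ld F cnt pos : ℕ → ℕ} (h : FolOK A ld F cnt pos) {w v c : ℕ}
    (hw : w ∈ A) (hv : v ∈ A) (hld : ld v = w + 1) (hc : cnt w = c + 1) :
    FolOK A (Function.update ld v 0)
      (Function.update F (pair w (pos v)) (F (pair w c)))
      (Function.update cnt w c)
      (Function.update pos (F (pair w c)) (pos v)) := by
  obtain ⟨h1, h2, h3⟩ := h.list w hw c (by omega)
  obtain ⟨h4, h5⟩ := h.pos v hv w hld
  have hposinj : ∀ u ∈ A, ld u = w + 1 → pos u = pos v → u = v := by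
    intro u hu hlu e
    rw [← (h.pos u hu w hlu).2, e, h5]
  have hposinj' : ∀ u ∈ A, ld u = w + 1 → pos u = c → u = F (pair w c) := by
    intro u hu hlu e
    rw [← (h.pos u hu w hlu).2, e]
  constructor
  · intro x hx i hi
    by_cases hxw : x = w
    · subst hxw
      rw [Function.update_self] at hi
      by_cases hip : i = pos v
      · subst hip
        -- In this case `pos v < c`, so `v` is not itself the last follower.
        have hne : F (pair x c) ≠ v := by
          intro e
          rw [e] at h3
          omega
        simp [h1, h2, hne]
      · have hne : pair x i ≠ pair x (pos v) := by rw [ne_eq, pair_inj]; simp [hip]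
        obtain ⟨h6, h7, h8⟩ := h.list x hx i (by omega)
        have hne1 : F (pair x i) ≠ v := by rintro e; rw [e] at h8; omega
        have hne2 : F (pair x i) ≠ F (pair x c) := by
          intro e; rw [e] at h8; omega
        rw [Function.update_of_ne hne, Function.update_of_ne hne1, Function.update_of_ne hne2]
        exact ⟨h6, h7, h8⟩
    · rw [Function.update_of_ne hxw] at hi
      have hne : pair x i ≠ pair w (pos v) := by rw [ne_eq, pair_inj]; simp [hxw]
      obtain ⟨h6, h7, h8⟩ := h.list x hx i hi
      have hne1 : F (pair x i) ≠ v := by rintro e; rw [e] at h7; omega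
      have hne2 : F (pair x i) ≠ F (pair w c) := by
        intro e; rw [e] at h7; omega
      rw [Function.update_of_ne hne, Function.update_of_ne hne1, Function.update_of_ne hne2]
      exact ⟨h6, h7, h8⟩
  · intro u hu x hx
    by_cases huv : u = v
    · subst huv
      rw [Function.update_self] at hx; omega
    rw [Function.update_of_ne huv] at hx
    obtain ⟨h6, h7⟩ := h.pos u hu x hx
    by_cases hxw : x = w
    · subst hxw
      by_cases hul : u = F (pair x c)
      · subst hul
        rw [Function.update_self, Function.update_self, Function.update_self]
        refine ⟨?_, rfl⟩
        have : pos v ≠ c := by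
          intro e
          exact huv (by rw [← e, h5])
        omega
      · have hpc : pos u ≠ c := fun e => hul (hposinj' u hu hx e)
        have hpv : pos u ≠ pos v := fun e => huv (hposinj u hu hx e)
        have hne : pair x (pos u) ≠ pair x (pos v) := by rw [ne_eq, pair_inj]; simp [hpv]
        rw [Function.update_of_ne hul, Function.update_self, Function.update_of_ne hne]
        exact ⟨by omega, h7⟩
    · have hul : u ≠ F (pair w c) := by rintro e; rw [e] at hx; omega
      have hne : pair x (pos u) ≠ pair w (pos v) := by rw [ne_eq, pair_inj]; simp [hxw]
      rw [Function.update_of_ne hul, Function.update_of_ne hxw, Function.update_of_ne hne]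
      exact ⟨h6, h7⟩

/-- A vertex without leader and followers is deleted. -/
theorem FolOK.erase {A : Finset ℕ} {ld F cnt pos : ℕ → ℕ} (h : FolOK A ld F cnt pos) {v : ℕ}
    (hv : ld v = 0) : FolOK (A.erase v) ld F cnt pos := by
  constructor
  · intro w hw i hi
    obtain ⟨h1, h2⟩ := h.list w (Finset.mem_of_mem_erase hw) i hi
    refine ⟨Finset.mem_erase.2 ⟨fun e => ?_, h1⟩, h2⟩
    rw [e] at h2; omega
  · exact fun u hu => h.pos u (Finset.mem_of_mem_erase hu)

theorem FolOK.insert {A : Finset ℕ} {ld F cnt pos : ℕ → ℕ} (h : FolOK A ld F cnt pos) {v : ℕ}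
    (hv : v ∉ A) (hF : ∀ u ∈ A, ld u ≠ v + 1) :
    FolOK (insert v A) (Function.update ld v 0) F (Function.update cnt v 0) pos := by
  have hne : ∀ u ∈ A, u ≠ v := fun u hu e => hv (e ▸ hu)
  constructor
  · intro w hw i hi
    rcases Finset.mem_insert.1 hw with rfl | hw
    · simp at hi
    rw [Function.update_of_ne (hne w hw)] at hi
    obtain ⟨h1, h2⟩ := h.list w hw i hi
    refine ⟨Finset.mem_insert_of_mem h1, ?_⟩
    rw [Function.update_of_ne (hne _ h1)]
    exact h2
  · intro u hu w hw
    rcases Finset.mem_insert.1 hu with rfl | hu'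
    · simp at hw
    rw [Function.update_of_ne (hne u hu')] at hw
    obtain ⟨h1, h2⟩ := h.pos u hu' w hw
    refine ⟨?_, h2⟩
    rw [Function.update_of_ne]
    · exact h1
    · rintro rfl
      exact hF u hu' hw

/-- The last free slot is given to a new vertex. -/
theorem SlotOK.pop {A : Finset ℕ} {slot free : ℕ → ℕ} {fc nn v : ℕ}
    (h : SlotOK A slot free (fc + 1) nn) (hv : v ∉ A) :
    SlotOK (insert v A) (Function.update slot v (free fc)) free fc nn := by
  have hne : ∀ u ∈ A, u ≠ v := fun u hu e => hv (e ▸ hu)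
  refine ⟨?_, ?_, fun i hi => h.free_lt i (by omega), ?_,
    fun i hi j hj => h.free_inj i (by omega) j (by omega), ?_⟩
  · intro x hx y hy hxy
    rcases Finset.mem_insert.1 hx with rfl | hx' <;> rcases Finset.mem_insert.1 hy with rfl | hy'
    · rfl
    · rw [Function.update_self, Function.update_of_ne (hne y hy')] at hxy
      exact absurd hxy.symm (h.free_ne fc (by omega) y hy')
    · rw [Function.update_self, Function.update_of_ne (hne x hx')] at hxy
      exact absurd hxy (h.free_ne fc (by omega) x hx')
    · rw [Function.update_of_ne (hne x hx'), Function.update_of_ne (hne y hy')] at hxy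
      exact h.inj x hx' y hy' hxy
  · intro x hx
    rcases Finset.mem_insert.1 hx with rfl | hx
    · rw [Function.update_self]; exact h.free_lt fc (by omega)
    · rw [Function.update_of_ne (hne x hx)]; exact h.lt x hx
  · intro i hi x hx
    rcases Finset.mem_insert.1 hx with rfl | hx
    · rw [Function.update_self]
      intro e
      have := h.free_inj fc (by omega) i (by omega) e
      omega
    · rw [Function.update_of_ne (hne x hx)]; exact h.free_ne i (by omega) x hx
  · rw [Finset.card_insert_of_notMem hv, h.card]; omega

/-- A new slot is given to a new vertex. -/
theorem SlotOK.extend {A : Finset ℕ} {slot free : ℕ → ℕ} {nn v : ℕ}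
    (h : SlotOK A slot free 0 nn) (hv : v ∉ A) :
    SlotOK (insert v A) (Function.update slot v nn) free 0 (nn + 1) := by
  have hne : ∀ u ∈ A, u ≠ v := fun u hu e => hv (e ▸ hu)
  refine ⟨?_, ?_, by simp, by simp, by simp, ?_⟩
  · intro x hx y hy hxy
    rcases Finset.mem_insert.1 hx with rfl | hx' <;> rcases Finset.mem_insert.1 hy with rfl | hy'
    · rfl
    · rw [Function.update_self, Function.update_of_ne (hne y hy')] at hxy
      have := h.lt y hy'; omega
    · rw [Function.update_self, Function.update_of_ne (hne x hx')] at hxy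
      have := h.lt x hx'; omega
    · rw [Function.update_of_ne (hne x hx'), Function.update_of_ne (hne y hy')] at hxy
      exact h.inj x hx' y hy' hxy
  · intro x hx
    rcases Finset.mem_insert.1 hx with rfl | hx
    · rw [Function.update_self]; omega
    · rw [Function.update_of_ne (hne x hx)]; have := h.lt x hx; omega
  · rw [Finset.card_insert_of_notMem hv, h.card]

/-- The slot of a deleted vertex becomes free. -/
theorem SlotOK.release {A : Finset ℕ} {slot free : ℕ → ℕ} {fc nn v : ℕ}
    (h : SlotOK A slot free fc nn) (hv : v ∈ A) :
    SlotOK (A.erase v) slot (Function.update free fc (slot v)) (fc + 1) nn := by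
  have hf : ∀ i < fc + 1, i ≠ fc → i < fc := fun i hi hne => by omega
  refine ⟨fun x hx y hy => h.inj x (Finset.mem_of_mem_erase hx) y (Finset.mem_of_mem_erase hy),
    fun x hx => h.lt x (Finset.mem_of_mem_erase hx), ?_, ?_, ?_, ?_⟩
  · intro i hi
    rw [Function.update_apply]; split_ifs with e
    · exact h.lt v hv
    · exact h.free_lt i (hf i hi e)
  · intro i hi x hx
    rw [Finset.mem_erase] at hx
    rw [Function.update_apply]; split_ifs with e
    · exact fun e' => hx.1 (h.inj x hx.2 v hv e')
    · exact h.free_ne i (hf i hi e) x hx.2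
  · intro i hi j hj hij
    rw [Function.update_apply, Function.update_apply] at hij
    split_ifs at hij with e e' e'
    · omega
    · exact absurd hij (h.free_ne j (hf j hj e') v hv)
    · exact absurd hij.symm (h.free_ne i (hf i hi e) v hv)
    · exact h.free_inj i (hf i hi e) j (hf j hj e') hij
  · have := Finset.card_pos.2 ⟨v, hv⟩
    rw [Finset.card_erase_of_mem hv, h.card]; omega

end Arrays
end DynLFMIS

namespace DynLFMIS

/-! ### Memory layout; queue operations, release of followers, scan of the current set -/

section Subroutines

/-- The size parameters: words are below `W`, the values in memory are at most `B`, and there are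
at most `M` active vertices at any time. -/
structure Bounds (W B M k : ℕ) : Prop where
  pos : 1 ≤ B
  word : 100 * (B * B) ≤ W
  cap : M < B
  k_le : k ≤ B

theorem Bounds.lt {W B M k : ℕ} (h : Bounds W B M k) : 4 * B + 4 < W := by
  have := h.word
  have := h.pos
  nlinarith

/-- The memory represents the configuration. -/
structure Rep (π : ℕ → unitInterval) (B M k : ℕ) (A S Q : Finset ℕ) (s : State) : Prop where
  -- Arrays: 0 the set `S`, 1 the leaders plus one, 2 the tree, 3 the slots, 4 the stack of free
  -- slots, 5, 6 and 7 the lists of followers, their lengths and the positions in them. Registers: 0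
  -- holds `k`, 3 the size of `S`, 4 the height of the tree, 5 the number of free slots, 6 the
  -- number of slots in all.
  arr_le : ∀ a x, s.arr a x ≤ B
  A_lt : ∀ u ∈ A, u < B
  reg_k : s.reg 0 = k
  out : Lists (s.arr 0) (s.reg 3) S
  tree : TreeOK π (s.arr 2) (s.arr 3) (s.reg 4) Q
  slots : SlotOK A (s.arr 3) (s.arr 4) (s.reg 5) (s.reg 6)
  slots_le : s.reg 6 ≤ M
  -- The number of leaves is stored minus one, so that zero memory is a valid tree with a single
  -- leaf.
  height : s.reg 7 + 1 = 2 ^ s.reg 4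
  room : s.reg 6 ≤ 2 ^ s.reg 4
  height_le : 2 ^ s.reg 4 ≤ 2 * M + 1
  fol : FolOK A (s.arr 1) (s.arr 5) (s.arr 6) (s.arr 7)

theorem Rep.height_le' {π : ℕ → unitInterval} {W B M k : ℕ} {A S Q : Finset ℕ} {s : State}
    (h : Rep π B M k A S Q s) (hb : Bounds W B M k) : s.reg 4 ≤ 2 * B := by
  have h1 := h.height_le
  have h2 := hb.cap
  have h3 := Nat.lt_two_pow_self (n := s.reg 4)
  omega

theorem Rep.card_le {π : ℕ → unitInterval} {B M k : ℕ} {A S Q : Finset ℕ} {s : State}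
    (h : Rep π B M k A S Q s) : A.card ≤ M := by
  have h1 := h.slots.card
  have h2 := h.slots_le
  omega

/-- Put the vertex in register 16 into the queue. -/
def queueInsert : Program := block [
  .assign 10 (.read 3 (.reg 16)),
  .assign 11 (.bin .add (.reg 16) (.lit 1)),
  treeUpdate]

/-- Remove the vertex in register 16 from the queue. -/
def queueErase : Program := block [
  .assign 10 (.read 3 (.reg 16)),
  .assign 11 (.lit 0),
  treeUpdate]

variable {W B M k : ℕ} {G : SimpleGraph ℕ} {π : ℕ → unitInterval} {A S Q O : Finset ℕ} {s : State}

theorem queueInsert_halts (hb : Bounds W B M k) (harr : ∀ a x, s.arr a x ≤ B) {u h : ℕ}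
    (hu : s.reg 16 = u) (huA : u ∈ A) (huB : u < B) (hh : s.reg 4 = h) (hhB : h ≤ 2 * B)
    (hQA : Q ⊆ A) (hinj : ∀ x ∈ A, ∀ y ∈ A, s.arr 3 x = s.arr 3 y → x = y)
    (ht : TreeOK π (s.arr 2) (s.arr 3) h Q) :
    Halts W G π queueInsert s (100 * h + 120) fun s' =>
      (∀ r, r < 10 ∨ 14 < r → s'.reg r = s.reg r) ∧ (∀ a, a ≠ 2 → s'.arr a = s.arr a) ∧
        (∀ a x, s'.arr a x ≤ B) ∧ TreeOK π (s'.arr 2) (s.arr 3) h (insert u Q) := by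
  have hlt := hb.lt
  have hA : ∀ a x, s.arr a x < W := fun a x => by have := harr a x; omega
  refine halts_assign_cons ?_ ?_ ?_
  · simp [Expr.Fits, Expr.eval, hA, hu]; omega
  · simp [Expr.cost]
  refine halts_assign_cons ?_ ?_ ?_
  · simp [Expr.Fits, Expr.eval, BinOp.eval, hu]; omega
  · simp [Expr.cost]
  simp only [Expr.eval, BinOp.eval, setReg_reg, hu]
  simp only [Nat.reduceEqDiff, if_false]
  change Halts W G π treeUpdate _ _ _
  refine (treeUpdate_halts (s := (s.setReg 10 (s.arr 3 u)).setReg 11 (u + 1)) (Q := insert u Q) (i := s.arr 3 u) (v := u + 1) (h := h) hb.pos hb.word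
    harr ?_ (harr _ _) ?_ huB ?_ hhB ?_ ?_ ht.above).mono ?_ ?_
  · simp
  · simp
  · simp [hh]
  -- Slots are not shared, so `u` is the only possible queue vertex at its leaf.
  · refine Or.inr ⟨u, Finset.mem_insert_self _ _, rfl, rfl, fun q hq e => ?_⟩
    rcases Finset.mem_insert.1 hq with rfl | hq
    · exact le_rfl
    · exact (congrArg π (hinj q (hQA hq) u huA e)).ge
  · intro j hj x hx
    refine (ht.node j hj x).congr rfl fun q => ?_
    rw [setReg_arr, setReg_arr, Finset.mem_insert]
    constructor
    · rintro ⟨h1, h2⟩; exact ⟨Or.inr h1, h2⟩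
    · rintro ⟨rfl | h1, h2⟩
      · exact absurd h2.symm hx
      · exact ⟨h1, h2⟩
  · simp [Expr.cost]; omega
  · rintro s' ⟨h1, h2, h3, h4⟩
    refine ⟨fun r hr => (h1 r hr).trans ?_, h2, h3, h4⟩
    have h5 : r ≠ 10 := by omega
    have h6 : r ≠ 11 := by omega
    simp [h5, h6]

theorem queueErase_halts (hb : Bounds W B M k) (harr : ∀ a x, s.arr a x ≤ B) {u h : ℕ}
    (hu : s.reg 16 = u) (huA : u ∈ A) (huB : u < B) (hh : s.reg 4 = h) (hhB : h ≤ 2 * B)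
    (hQA : Q ⊆ A) (hinj : ∀ x ∈ A, ∀ y ∈ A, s.arr 3 x = s.arr 3 y → x = y)
    (ht : TreeOK π (s.arr 2) (s.arr 3) h Q) :
    Halts W G π queueErase s (100 * h + 120) fun s' =>
      (∀ r, r < 10 ∨ 14 < r → s'.reg r = s.reg r) ∧ (∀ a, a ≠ 2 → s'.arr a = s.arr a) ∧
        (∀ a x, s'.arr a x ≤ B) ∧ TreeOK π (s'.arr 2) (s.arr 3) h (Q.erase u) := by
  have hlt := hb.lt
  have hA : ∀ a x, s.arr a x < W := fun a x => by have := harr a x; omega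
  refine halts_assign_cons ?_ ?_ ?_
  · simp [Expr.Fits, Expr.eval, hA, hu]; omega
  · simp [Expr.cost]
  refine halts_assign_cons ?_ ?_ ?_
  · simp [Expr.Fits]; omega
  · simp [Expr.cost]
  simp only [Expr.eval, hu]
  change Halts W G π treeUpdate _ _ _
  refine (treeUpdate_halts (s := (s.setReg 10 (s.arr 3 u)).setReg 11 0) (Q := Q.erase u) (i := s.arr 3 u) (v := 0) (h := h) hb.pos hb.word
    harr ?_ (harr _ _) ?_ (Nat.zero_le _) ?_ hhB ?_ ?_ ht.above).mono ?_ ?_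
  · simp
  · simp
  · simp [hh]
  · refine Or.inl ⟨rfl, fun q hq e => ?_⟩
    rw [Finset.mem_erase] at hq
    exact hq.1 (hinj q (hQA hq.2) u huA e)
  · intro j hj x hx
    refine (ht.node j hj x).congr rfl fun q => ?_
    rw [setReg_arr, setReg_arr, Finset.mem_erase]
    constructor
    · rintro ⟨h1, h2⟩
      exact ⟨⟨by rintro rfl; exact hx h2.symm, h1⟩, h2⟩
    · rintro ⟨⟨-, h1⟩, h2⟩; exact ⟨h1, h2⟩
  · simp [Expr.cost]; omega
  · rintro s' ⟨h1, h2, h3, h4⟩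
    refine ⟨fun r hr => (h1 r hr).trans ?_, h2, h3, h4⟩
    have h5 : r ≠ 10 := by omega
    have h6 : r ≠ 11 := by omega
    simp [h5, h6]

/-- Release all followers of the vertex in register 15. -/
def releaseAll : Program :=
  .while (.lt (.lit 0) (.read 6 (.reg 15))) (block [
    .write 6 (.reg 15) (.bin .sub (.read 6 (.reg 15)) (.lit 1)),
    .assign 16 (.read 5 (pairExpr (.reg 15) (.read 6 (.reg 15)))),
    .write 1 (.reg 16) (.lit 0),
    queueInsert])

/-- Each round costs one insertion into the queue. By `he`, no follower has `w` as its eliminator,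
so each of the `c` rounds is paid for by one unit of potential (`Inv.potential_release`). -/
theorem releaseAll_halts (hb : Bounds W B M k) {e : ℕ → ℕ} {w c : ℕ}
    (hrep : Rep π B M k A S Q s) (hinv : Inv G π k A S Q O (s.arr 1)) (hw : w ∈ A)
    (hreg : s.reg 15 = w) (hc : s.arr 6 w = c) (he : ∀ u ∈ A, s.arr 1 u = w + 1 → e u ≠ w) :
    Halts W G π releaseAll s ((100 * s.reg 4 + 150) * c + 10) fun s' =>
      ∃ Q', Q ⊆ Q' ∧ Rep π B M k A S Q' s' ∧ Inv G π k A S Q' O (s'.arr 1) ∧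
        (∀ u ∈ A, s'.arr 1 u ≠ w + 1) ∧
        (∀ u, s.arr 1 u = 0 → s'.arr 1 u = 0) ∧
        potential e A S Q' O (s'.arr 1) + c ≤ potential e A S Q O (s.arr 1) ∧
        (∀ u ∈ Q', u ∈ Q ∨ s.arr 1 u = w + 1) ∧
        (∀ r, r < 10 ∨ 16 < r → s'.reg r = s.reg r) ∧ s'.arr 3 = s.arr 3 := by
  have hlt := hb.lt
  refine halts_while (fun n s₁ => ∃ Q₁ c₁, Q ⊆ Q₁ ∧ n = (100 * s.reg 4 + 150) * c₁ + 10 ∧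
      s₁.arr 6 w = c₁ ∧ Rep π B M k A S Q₁ s₁ ∧ Inv G π k A S Q₁ O (s₁.arr 1) ∧
      (∀ u, s.arr 1 u = 0 → s₁.arr 1 u = 0) ∧ (∀ u ∈ A, s₁.arr 1 u = w + 1 → e u ≠ w) ∧
      potential e A S Q₁ O (s₁.arr 1) + c ≤ potential e A S Q O (s.arr 1) + c₁ ∧
      (∀ u ∈ Q₁, u ∈ Q ∨ s.arr 1 u = w + 1) ∧ (∀ u, s₁.arr 1 u ≠ 0 → s₁.arr 1 u = s.arr 1 u) ∧
      (∀ r, r < 10 ∨ 16 < r → s₁.reg r = s.reg r) ∧ s₁.reg 15 = w ∧ s₁.arr 3 = s.arr 3) ?_ ?_ ?_ ?_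
  · rintro n s₁ ⟨Q₁, c₁, -, -, h1, h2, -, -, -, -, -, -, -, h3, -⟩
    have := h2.arr_le 6 w
    have := h2.A_lt w hw
    simp only [Test.Fits, Expr.Fits, Expr.eval, h3]
    omega
  · rintro n s₁ ⟨Q₁, c₁, hQ₁, rfl, hc₁, hr, hi, h0, he₁, hp, hsub, hld, hreg₁, h15, h3⟩ hb'
    simp only [Test.Holds, Expr.eval, h15, hc₁] at hb'
    obtain ⟨c₂, rfl⟩ : ∃ c₂, c₁ = c₂ + 1 := ⟨c₁ - 1, by omega⟩
    refine ⟨100 * s.reg 4 + 145, (100 * s.reg 4 + 150) * c₂ + 10, ?_, ?_⟩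
    · simp [Test.cost, Expr.cost]; ring_nf; omega
    have hwB := hr.A_lt w hw
    have hA : ∀ a x, s₁.arr a x < W := fun a x => by have := hr.arr_le a x; omega
    have hcB : c₂ + 1 ≤ B := hc₁ ▸ hr.arr_le 6 w
    obtain ⟨hu1, hu2, hu3⟩ := hr.fol.list w hw c₂ (by omega)
    set u := s₁.arr 5 (pair w c₂) with hu
    have huB := hr.A_lt u hu1
    refine halts_write_cons ?_ ?_ ?_ ?_
    · simp [Expr.Fits, h15]; omega
    · simp [Expr.Fits, Expr.eval, BinOp.eval, h15, hc₁]; omega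
    · simp [Expr.cost]
    refine halts_assign_cons ?_ ?_ ?_
    · refine ⟨pairExpr_fits hb.pos hb.word ?_ ?_ ?_ ?_, ?_⟩ <;>
        simp [Expr.Fits, Expr.eval, BinOp.eval, h15, hc₁, setArr_arr_ne, hA] <;> omega
    · simp [Expr.cost, pairExpr]
    refine halts_write_cons ?_ ?_ ?_ ?_
    · simp [Expr.Fits, Expr.eval, BinOp.eval, h15, hc₁, setArr_arr_ne, hA]
    · simp [Expr.Fits]; omega
    · simp [Expr.cost, pairExpr]
    simp only [Expr.eval, BinOp.eval, pairExpr_eval, setReg_reg, h15, hc₁,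
      setArr_reg, setArr_arr_same, Function.update_self, Nat.add_sub_cancel,
      setArr_arr_ne _ _ _ (show (5 : ℕ) ≠ 6 by decide), if_true]
    rw [← hu]
    set s₂ := ((s₁.setArr 6 w c₂).setReg 16 u).setArr 1 u 0 with hs₂
    have e1 : s₂.arr 1 = Function.update (s₁.arr 1) u 0 := by simp [hs₂, setArr_arr_ne]
    have e6 : s₂.arr 6 = Function.update (s₁.arr 6) w c₂ := by simp [hs₂, setArr_arr_ne]
    have eo : ∀ a, a ≠ 1 → a ≠ 6 → s₂.arr a = s₁.arr a := by
      intro a h1 h6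
      rw [hs₂, setArr_arr_ne _ _ _ h1, setReg_arr, setArr_arr_ne _ _ _ h6]
    have er : ∀ r, r ≠ 16 → s₂.reg r = s₁.reg r := by
      intro r hr; simp [hs₂, hr]
    have harr₂ : ∀ a x, s₂.arr a x ≤ B :=
      setArr_arr_le (setArr_arr_le hr.arr_le (by omega)) (Nat.zero_le _)
    refine (queueInsert_halts (A := A) (Q := Q₁) (h := s₁.reg 4) (u := u) hb harr₂ ?_ hu1 huB ?_
      (hr.height_le' hb) hi.Q_sub ?_ ?_).mono ?_ ?_
    · simp [hs₂]
    · exact er 4 (by decide)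
    · rw [eo 3 (by decide) (by decide)]; exact hr.slots.inj
    · rw [eo 3 (by decide) (by decide), eo 2 (by decide) (by decide)]; exact hr.tree
    · rw [hreg₁ 4 (by omega)]; simp [Expr.cost, pairExpr]
    · rintro s' ⟨f1, f2, f3, f4⟩
      have g1 : s'.arr 1 = Function.update (s₁.arr 1) u 0 := (f2 1 (by decide)).trans e1
      have g6 : s'.arr 6 = Function.update (s₁.arr 6) w c₂ := (f2 6 (by decide)).trans e6
      have go : ∀ a, a ≠ 1 → a ≠ 6 → a ≠ 2 → s'.arr a = s₁.arr a := fun a h1 h6 h2 =>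
        (f2 a h2).trans (eo a h1 h6)
      have gr : ∀ r, r < 10 ∨ (14 < r ∧ r ≠ 16) → s'.reg r = s₁.reg r := fun r hr =>
        (f1 r (by omega)).trans (er r (by omega))
      refine ⟨insert u Q₁, c₂, hQ₁.trans (Finset.subset_insert _ _), rfl, ?_, ?_, ?_, ?_, ?_, ?_,
        ?_, ?_, ?_, ?_, ?_⟩
      · rw [g6, Function.update_self]
      · constructor
        · exact f3
        · exact hr.A_lt
        · rw [gr 0 (by omega)]; exact hr.reg_k
        · rw [gr 3 (by omega), go 0 (by decide) (by decide) (by decide)]; exact hr.out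
        · rw [gr 4 (by omega), go 3 (by decide) (by decide) (by decide)]
          rw [eo 3 (by decide) (by decide)] at f4
          exact f4
        · rw [gr 5 (by omega), gr 6 (by omega), go 3 (by decide) (by decide) (by decide),
            go 4 (by decide) (by decide) (by decide)]
          exact hr.slots
        · rw [gr 6 (by omega)]; exact hr.slots_le
        · rw [gr 7 (by omega), gr 4 (by omega)]; exact hr.height
        · rw [gr 6 (by omega), gr 4 (by omega)]; exact hr.room
        · rw [gr 4 (by omega)]; exact hr.height_le
        · rw [g1, g6, go 5 (by decide) (by decide) (by decide),
            go 7 (by decide) (by decide) (by decide)]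
          exact hr.fol.pop hw hc₁
      · rw [g1]; exact hi.release hu1 hu2
      · intro x hx
        rw [g1, Function.update_apply]
        split_ifs
        · rfl
        · exact h0 x hx
      · intro x hx hx'
        rw [g1, Function.update_apply] at hx'
        split_ifs at hx'
        exact he₁ x hx hx'
      · rw [g1]
        have := hi.potential_release hu1 hu2 (he₁ u hu1 hu2)
        omega
      · intro x hx
        rcases Finset.mem_insert.1 hx with rfl | hx'
        · right
          rw [← hld u (by omega)]; exact hu2
        · exact hsub x hx'
      · intro x hx
        rw [g1, Function.update_apply] at hx ⊢
        split_ifs at hx ⊢ with e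
        · exact absurd rfl hx
        · exact hld x hx
      · exact fun r hr' => (gr r (by omega)).trans (hreg₁ r hr')
      · rw [gr 15 (by omega)]; exact h15
      · rw [go 3 (by decide) (by decide) (by decide)]; exact h3
  · rintro n s₁ ⟨Q₁, c₁, hQ₁, rfl, hc₁, hr, hi, h0, he₁, hp, hsub, hld, hreg₁, h15, h3⟩ hb'
    simp only [Test.Holds, Expr.eval, h15, hc₁] at hb'
    obtain rfl : c₁ = 0 := by omega
    refine ⟨by simp [Test.cost, Expr.cost], Q₁, hQ₁, hr, hi, fun u hu e => ?_, h0, hp, hsub,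
      hreg₁, h3⟩
    have := (hr.fol.pos u hu w e).1
    omega
  · exact ⟨Q, c, subset_rfl, rfl, hc, hrep, hinv, fun _ => id, he, le_rfl, fun _ h => Or.inl h,
      fun _ _ => rfl, fun _ _ => rfl, hreg, rfl⟩

/-- The first dominator of `q` among the first `i` cells of the array `f`, plus one. -/
def BestOK (G : SimpleGraph ℕ) (π : ℕ → unitInterval) (f : ℕ → ℕ) (q i best : ℕ) : Prop :=
  (best = 0 ∧ ∀ j < i, π (f j) < π q → ¬ G.Adj (f j) q) ∨
    ∃ j < i, best = f j + 1 ∧ G.Adj (f j) q ∧ π (f j) < π q ∧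
      ∀ j' < i, π (f j') < π q → G.Adj (f j') q → π (f j) ≤ π (f j')

/-- The index of a neighbor of `q` that comes after `q`, plus one. -/
def LaterOK (G : SimpleGraph ℕ) (π : ℕ → unitInterval) (f : ℕ → ℕ) (q i nb : ℕ) : Prop :=
  (nb = 0 ∧ ∀ j < i, ¬ π (f j) < π q → ¬ G.Adj (f j) q) ∨
    ∃ j < i, nb = j + 1 ∧ G.Adj (f j) q ∧ ¬ π (f j) < π q

/-- The index of the last vertex. -/
def LastOK (π : ℕ → unitInterval) (f : ℕ → ℕ) (i m : ℕ) : Prop :=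
  -- The first alternative matters only for the empty prefix.
  (m = 0 ∨ m < i) ∧ ∀ j < i, π (f j) ≤ π (f m)

theorem BestOK.keep {f : ℕ → ℕ} {q i best : ℕ} (h : BestOK G π f q i best)
    (hx : π (f i) < π q → G.Adj (f i) q → best ≠ 0 ∧ ¬ π (f i) < π (best - 1)) :
    BestOK G π f q (i + 1) best := by
  rcases h with ⟨h1, h2⟩ | ⟨j, hj, h1, h2, h3, h4⟩
  · refine Or.inl ⟨h1, fun j hj h3 h4 => ?_⟩
    rcases Nat.lt_succ_iff_lt_or_eq.1 hj with hj | rfl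
    · exact h2 j hj h3 h4
    · exact (hx h3 h4).1 h1
  · refine Or.inr ⟨j, by omega, h1, h2, h3, fun j' hj' h5 h6 => ?_⟩
    rcases Nat.lt_succ_iff_lt_or_eq.1 hj' with hj' | rfl
    · exact h4 j' hj' h5 h6
    · have := (hx h5 h6).2
      rw [h1, Nat.add_sub_cancel] at this
      exact not_lt.1 this

theorem BestOK.update {f : ℕ → ℕ} {q i best : ℕ} (h : BestOK G π f q i best)
    (hx : π (f i) < π q) (had : G.Adj (f i) q) (hb : best = 0 ∨ π (f i) < π (best - 1)) :
    BestOK G π f q (i + 1) (f i + 1) := by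
  refine Or.inr ⟨i, by omega, rfl, had, hx, fun j' hj' h5 h6 => ?_⟩
  rcases Nat.lt_succ_iff_lt_or_eq.1 hj' with hj' | rfl
  · rcases h with ⟨h1, h2⟩ | ⟨j, hj, h1, h2, h3, h4⟩
    · exact absurd h6 (h2 j' hj' h5)
    · rw [h1, Nat.add_sub_cancel] at hb
      exact (hb.resolve_left (by omega)).le.trans (h4 j' hj' h5 h6)
  · exact le_rfl

theorem LaterOK.keep {f : ℕ → ℕ} {q i nb : ℕ} (h : LaterOK G π f q i nb)
    (hx : ¬ π (f i) < π q → ¬ G.Adj (f i) q) : LaterOK G π f q (i + 1) nb := by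
  rcases h with ⟨h1, h2⟩ | ⟨j, hj, h1, h2, h3⟩
  · refine Or.inl ⟨h1, fun j hj h3 => ?_⟩
    rcases Nat.lt_succ_iff_lt_or_eq.1 hj with hj | rfl
    · exact h2 j hj h3
    · exact hx h3
  · exact Or.inr ⟨j, by omega, h1, h2, h3⟩

theorem LastOK.step {f : ℕ → ℕ} {i m m' : ℕ} (h : LastOK π f i m)
    (h1 : π (f m) < π (f i) → m' = i) (h2 : ¬ π (f m) < π (f i) → m' = m) :
    LastOK π f (i + 1) m' := by
  by_cases hlt : π (f m) < π (f i)
  · rw [h1 hlt]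
    refine ⟨Or.inr (by omega), fun j hj => ?_⟩
    rcases Nat.lt_succ_iff_lt_or_eq.1 hj with hj | rfl
    · exact (h.2 j hj).trans hlt.le
    · exact le_rfl
  · rw [h2 hlt]
    refine ⟨h.1.imp_right fun h => by omega, fun j hj => ?_⟩
    rcases Nat.lt_succ_iff_lt_or_eq.1 hj with hj | rfl
    · exact h.2 j hj
    · exact not_lt.1 hlt

/-- Compare the vertex in register 26, whose index is in register 22, with the vertex in
register 21. -/
def compare : Program :=
  .ite (.adj (.reg 26) (.reg 21))
    (.ite (.rankLt (.reg 26) (.reg 21))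
      (.ite (.eq (.reg 23) (.lit 0))
        (.assign 23 (.bin .add (.reg 26) (.lit 1)))
        (.ite (.rankLt (.reg 26) (.bin .sub (.reg 23) (.lit 1)))
          (.assign 23 (.bin .add (.reg 26) (.lit 1)))
          .skip))
      (.assign 24 (.bin .add (.reg 22) (.lit 1))))
    .skip

theorem compare_halts {q i best nb : ℕ} {f : ℕ → ℕ} (hW : ∀ r, 21 ≤ r → r ≤ 26 → s.reg r + 1 < W)
    (hi : s.reg 22 = i) (hq : s.reg 21 = q) (hx : s.reg 26 = f i) (hbest : s.reg 23 = best)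
    (hnb : s.reg 24 = nb) (h1 : BestOK G π f q i best) (h2 : LaterOK G π f q i nb) :
    Halts W G π compare s 30 fun s' =>
      BestOK G π f q (i + 1) (s'.reg 23) ∧ LaterOK G π f q (i + 1) (s'.reg 24) ∧
        (∀ r, r ≠ 23 → r ≠ 24 → s'.reg r = s.reg r) ∧ s'.arr = s.arr := by
  have hW' : ∀ r, 21 ≤ r → r ≤ 26 → s.reg r < W := fun r h h' => by
    have := hW r h h'; omega
  have hW0 : 1 < W := by have := hW 21 (by decide) (by decide); omega
  have hr : ∀ r x r', r' ≠ r → (s.setReg r x).reg r' = s.reg r' := by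
    intro r x r' h; simp [h]
  have hbestW := hW 23 (by decide) (by decide)
  have hiW := hW 22 (by decide) (by decide)
  refine halts_ite ⟨hW' 26 (by decide) (by decide), hW' 21 (by decide) (by decide)⟩ (by decide) (fun hb => ?_) (fun hb => ?_)
  · simp only [Test.Holds, Expr.eval, hx, hq] at hb
    refine halts_ite ⟨hW' 26 (by decide) (by decide), hW' 21 (by decide) (by decide)⟩ (by decide) (fun hb' => ?_) (fun hb' => ?_)
    · simp only [Test.Holds, Expr.eval, hx, hq] at hb'
      have hl : LaterOK G π f q (i + 1) nb := h2.keep fun h => absurd hb' h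
      refine halts_ite ⟨hW' 23 (by decide) (by decide), by simp only [Expr.Fits]; omega⟩ (by decide) (fun h3 => ?_)
        (fun h3 => ?_)
      · simp only [Test.Holds, Expr.eval, hbest] at h3
        refine halts_assign ⟨hW' 26 (by decide) (by decide), hW0, hW 26 (by decide) (by decide)⟩ (by decide) ⟨?_, ?_, fun r h _ => hr _ _ _ h, rfl⟩
        · simp only [Expr.eval, BinOp.eval, setReg_reg, hx]
          exact h1.update hb' hb (Or.inl h3)
        · rw [hr 23 _ 24 (by decide), hnb]; exact hl
      · simp only [Test.Holds, Expr.eval, hbest] at h3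
        refine halts_ite ⟨hW' 26 (by decide) (by decide), hW' 23 (by decide) (by decide), hW0, ?_⟩ (by decide) (fun h4 => ?_) (fun h4 => ?_)
        · simp only [Expr.eval, BinOp.eval]; omega
        · simp only [Test.Holds, Expr.eval, BinOp.eval, hbest, hx] at h4
          refine halts_assign ⟨hW' 26 (by decide) (by decide), hW0, hW 26 (by decide) (by decide)⟩ (by decide)
            ⟨?_, ?_, fun r h _ => hr _ _ _ h, rfl⟩
          · simp only [Expr.eval, BinOp.eval, setReg_reg, hx]
            exact h1.update hb' hb (Or.inr h4)
          · rw [hr 23 _ 24 (by decide), hnb]; exact hl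
        · simp only [Test.Holds, Expr.eval, BinOp.eval, hbest, hx] at h4
          refine halts_skip (by decide) ⟨?_, by rw [hnb]; exact hl, fun _ _ _ => rfl, rfl⟩
          rw [hbest]; exact h1.keep fun _ _ => ⟨h3, h4⟩
    · simp only [Test.Holds, Expr.eval, hx, hq] at hb'
      refine halts_assign ⟨hW' 22 (by decide) (by decide), hW0, hW 22 (by decide) (by decide)⟩ (by decide) ⟨?_, ?_, fun r _ h => hr _ _ _ h, rfl⟩
      · rw [hr 24 _ 23 (by decide), hbest]
        exact h1.keep fun h => absurd h hb'
      · simp only [Expr.eval, BinOp.eval, setReg_reg, hi]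
        exact Or.inr ⟨i, by omega, rfl, hb, hb'⟩
  · simp only [Test.Holds, Expr.eval, hx, hq] at hb
    refine halts_skip (by decide) ⟨?_, ?_, fun _ _ _ => rfl, rfl⟩
    · rw [hbest]; exact h1.keep fun _ h => absurd h hb
    · rw [hnb]; exact h2.keep fun _ => hb

/-- Scan the current set for the vertex `q` in register 21: register 23 receives the successor of
the first vertex that dominates `q`, register 24 the successor of the index of a later neighbor,
and register 25 the index of the last vertex. -/
def scan : Program := block [
  .assign 22 (.lit 0),
  .assign 23 (.lit 0),
  .assign 24 (.lit 0),
  .assign 25 (.lit 0),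
  .while (.lt (.reg 22) (.reg 3)) (block [
    .assign 26 (.read 0 (.reg 22)),
    compare,
    .ite (.rankLt (.read 0 (.reg 25)) (.reg 26)) (.assign 25 (.reg 22)) .skip,
    .assign 22 (.bin .add (.reg 22) (.lit 1))])]

theorem scan_halts {q : ℕ} (h3W : s.reg 3 + 1 < W) (hqW : q + 1 < W) (hA : ∀ a x, s.arr a x + 2 < W)
    (hq : s.reg 21 = q) :
    Halts W G π scan s (70 * s.reg 3 + 20) fun s' =>
      BestOK G π (s.arr 0) q (s.reg 3) (s'.reg 23) ∧
      LaterOK G π (s.arr 0) q (s.reg 3) (s'.reg 24) ∧ LastOK π (s.arr 0) (s.reg 3) (s'.reg 25) ∧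
      (∀ r, r < 22 ∨ 26 < r → s'.reg r = s.reg r) ∧ s'.arr = s.arr := by
  have h0W : 1 < W := by omega
  iterate 4
    refine halts_assign_cons (by simp only [Expr.Fits]; omega) (by simp [Expr.cost]) ?_
  refine (halts_while (c := 70 * s.reg 3 + 10) (fun c s₁ => ∃ i ≤ s.reg 3,
    c = 70 * (s.reg 3 - i) + 10 ∧ s₁.reg 22 = i ∧ BestOK G π (s.arr 0) q i (s₁.reg 23) ∧
      LaterOK G π (s.arr 0) q i (s₁.reg 24) ∧ LastOK π (s.arr 0) i (s₁.reg 25) ∧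
      (∀ r, r < 22 ∨ 26 < r → s₁.reg r = s.reg r) ∧ (∀ r, 21 ≤ r → r ≤ 25 → s₁.reg r + 1 < W) ∧
      s₁.arr = s.arr) ?_ ?_ ?_ ?_).mono ?_ fun _ => id
  · rintro c s₁ ⟨i, -, -, -, -, -, -, h2, h, -⟩
    have h1 := h 22 (by decide) (by decide)
    have h2 := h2 3 (by decide)
    simp only [Test.Fits, Expr.Fits]
    omega
  · rintro c s₁ ⟨i, hi, rfl, h22, h1, h2, h3, h4, h5, h6⟩ hb
    simp only [Test.Holds, Expr.eval, h22, h4 3 (by omega)] at hb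
    refine ⟨60, 70 * (s.reg 3 - (i + 1)) + 10, by simp [Test.cost, Expr.cost]; omega, ?_⟩
    have h5' : ∀ r, 21 ≤ r → r ≤ 25 → s₁.reg r < W := fun r h h' => by
      have := h5 r h h'; omega
    have hA' : ∀ a x, s₁.arr a x < W := fun a x => by rw [h6]; have := hA a x; omega
    refine halts_assign_cons ⟨h5' 22 (by decide) (by decide), hA' _ _⟩ (by decide) ?_
    simp only [Expr.eval, h22, h6]
    refine halts_cons 30 20 ((compare_halts (f := s.arr 0) (q := q) (i := i)
      (best := s₁.reg 23) (nb := s₁.reg 24) ?_ ?_ ?_ ?_ ?_ ?_ h1 h2).mono le_rfl ?_) (by decide)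
    · intro r hr hr'
      rw [setReg_reg]
      split_ifs
      · have := hA 0 i; omega
      · exact h5 r hr (by omega)
    · simp [h22]
    · simp [h4, hq]
    · simp
    · simp
    · simp
    rintro s₂ ⟨e1, e2, e3, e4⟩
    have e3' : ∀ r, r < 23 ∨ (24 < r ∧ r ≠ 26) → s₂.reg r = s₁.reg r := by
      intro r hr
      rw [e3 r (by omega) (by omega), setReg_reg, if_neg (by omega)]
    have e26 : s₂.reg 26 = s.arr 0 i := by rw [e3 26 (by decide) (by decide)]; simp
    have e4' : s₂.arr = s.arr := e4.trans h6
    have h25 := h5' 25 (by decide) (by decide)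
    have f22 := h5 22 (by decide) (by decide)
    have f26 : s₂.reg 26 < W := by rw [e26]; have := hA 0 i; omega
    have f23 : s₂.reg 23 + 1 < W := by
      rcases e1 with ⟨h, -⟩ | ⟨j, -, h, -⟩ <;> rw [h]
      · omega
      · have := hA 0 j; omega
    have f24 : s₂.reg 24 + 1 < W := by
      rcases e2 with ⟨h, -⟩ | ⟨j, hj, h, -⟩ <;> rw [h]
      · omega
      · omega
    -- The end of the loop body, common to both outcomes of the comparison with the last vertex so
    -- far.
    have key : ∀ T s₃, 5 ≤ T → (∀ r, r ≠ 25 → s₃.reg r = s₂.reg r) → s₃.arr = s.arr →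
        LastOK π (s.arr 0) (i + 1) (s₃.reg 25) → s₃.reg 25 + 1 < W →
        Halts W G π (block [.assign 22 (.bin .add (.reg 22) (.lit 1))]) s₃ T fun s₄ => ∃ j ≤ s.reg 3,
        70 * (s.reg 3 - (i + 1)) + 10 = 70 * (s.reg 3 - j) + 10 ∧ s₄.reg 22 = j ∧
        BestOK G π (s.arr 0) q j (s₄.reg 23) ∧
        LaterOK G π (s.arr 0) q j (s₄.reg 24) ∧ LastOK π (s.arr 0) j (s₄.reg 25) ∧
        (∀ r, r < 22 ∨ 26 < r → s₄.reg r = s.reg r) ∧ (∀ r, 21 ≤ r → r ≤ 25 → s₄.reg r + 1 < W) ∧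
        s₄.arr = s.arr := by
      intro T s₃ hT g1 g2 g3 g4
      have g22 : s₃.reg 22 = i := by rw [g1 22 (by decide), e3' 22 (by omega), h22]
      refine halts_assign ?_ (by simp [Expr.cost]; omega) ?_
      · simp only [Expr.Fits, Expr.eval, BinOp.eval, g22]; omega
      · simp only [Expr.eval, BinOp.eval, g22]
        refine ⟨i + 1, hb, rfl, by simp, ?_, ?_, by simpa using g3, ?_, ?_, g2⟩
        · rw [setReg_reg, if_neg (by decide), g1 23 (by decide)]; exact e1
        · rw [setReg_reg, if_neg (by decide), g1 24 (by decide)]; exact e2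
        · intro r hr
          rw [setReg_reg, if_neg (by omega), g1 r (by omega), e3' r (by omega)]
          exact h4 r hr
        · intro r hr₁ hr₂
          rw [setReg_reg]
          split_ifs with h22'
          · omega
          · by_cases hr25 : r = 25
            · rw [hr25]; exact g4
            · rw [g1 r hr25]
              by_cases hr : r = 23
              · rw [hr]; exact f23
              · by_cases hr' : r = 24
                · rw [hr']; exact f24
                · rw [e3' r (by omega)]; exact h5 r hr₁ hr₂
    refine halts_cons 10 10 ?_ (by decide)
    refine halts_ite ⟨⟨?_, ?_⟩, f26⟩ (by decide) (fun hlt => ?_) (fun hlt => ?_)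
    · show s₂.reg 25 < W
      rw [e3' 25 (by omega)]; exact h25
    · rw [e4']; have := hA 0 ((Expr.reg 25).eval s₂); omega
    · simp only [Test.Holds, Expr.eval, e4', e26, e3' 25 (by omega)] at hlt
      refine halts_assign ?_ (by decide) (key _ _ (by decide) ?_ e4' ?_ ?_)
      · show s₂.reg 22 < W
        rw [e3' 22 (by omega)]; exact h5' 22 (by decide) (by decide)
      · intro r hr; simp [hr]
      · refine h3.step (fun _ => ?_) (fun h => absurd hlt h)
        simp [Expr.eval, e3' 22 (by omega), h22]
      · simp only [Expr.eval, setReg_reg, if_true, e3' 22 (by omega)]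
        exact f22
    · simp only [Test.Holds, Expr.eval, e4', e26, e3' 25 (by omega)] at hlt
      refine halts_skip (by decide) (key _ _ (by decide) (fun _ _ => rfl) e4' ?_ ?_)
      · exact h3.step (fun h => absurd h hlt) (fun _ => e3' 25 (by omega))
      · rw [e3' 25 (by omega)]; exact h5 25 (by decide) (by decide)
  · rintro c s₁ ⟨i, hi, rfl, h22, h1, h2, h3, h4, h5, h6⟩ hb
    simp only [Test.Holds, Expr.eval, h22, h4 3 (by omega)] at hb
    obtain rfl : i = s.reg 3 := by omega
    exact ⟨by simp [Test.cost, Expr.cost], h1, h2, h3, h4, h6⟩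
  · refine ⟨0, Nat.zero_le _, rfl, ?_, ?_, ?_, ?_, ?_, ?_, rfl⟩
    · simp [Expr.eval]
    · left; simp [Expr.eval]
    · left; simp [Expr.eval]
    · simp [LastOK, Expr.eval]
    · intro r hr
      have h1 : r ≠ 22 := by omega
      have h2 : r ≠ 23 := by omega
      have h3 : r ≠ 24 := by omega
      have h4 : r ≠ 25 := by omega
      simp [h1, h2, h3, h4]
    · intro r hr₁ hr₂
      simp only [setReg_reg, Expr.eval]
      split_ifs
      · omega
      · omega
      · omega
      · omega
      · obtain rfl : r = 21 := by omega
        omega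
  · simp [Expr.cost]

end Subroutines
end DynLFMIS

namespace DynLFMIS

/-! ### The four moves of the main loop -/

section MainLoop

variable {W B M k : ℕ} {G : SimpleGraph ℕ} {π : ℕ → unitInterval} {A S Q O : Finset ℕ} {s : State}

/-- A frame rule: the moves leave the slots and the shape of the tree alone, so only the list of
`S`, the tree entries and the lists of followers have to be verified. -/
theorem Rep.update {s' : State} {S' Q' : Finset ℕ} (h : Rep π B M k A S Q s)
    (hr : ∀ r, r = 0 ∨ (4 ≤ r ∧ r ≤ 7) → s'.reg r = s.reg r) (h3 : s'.arr 3 = s.arr 3)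
    (h4 : s'.arr 4 = s.arr 4) (harr : ∀ a x, s'.arr a x ≤ B)
    (hout : Lists (s'.arr 0) (s'.reg 3) S') (htree : TreeOK π (s'.arr 2) (s.arr 3) (s.reg 4) Q')
    (hfol : FolOK A (s'.arr 1) (s'.arr 5) (s'.arr 6) (s'.arr 7)) : Rep π B M k A S' Q' s' where
  arr_le := harr
  A_lt := h.A_lt
  reg_k := (hr 0 (by omega)).trans h.reg_k
  out := hout
  tree := by rw [hr 4 (by omega), h3]; exact htree
  slots := by rw [hr 5 (by omega), hr 6 (by omega), h3, h4]; exact h.slots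
  slots_le := by rw [hr 6 (by omega)]; exact h.slots_le
  height := by rw [hr 7 (by omega), hr 4 (by omega)]; exact h.height
  room := by rw [hr 6 (by omega), hr 4 (by omega)]; exact h.room
  height_le := by rw [hr 4 (by omega)]; exact h.height_le
  fol := hfol

theorem Rep.setReg (h : Rep π B M k A S Q s) {r x : ℕ} (hr : 10 ≤ r) :
    Rep π B M k A S Q (s.setReg r x) := by
  refine h.update (fun r' hr' => ?_) rfl rfl h.arr_le ?_ h.tree h.fol
  · rw [setReg_reg, if_neg (by omega)]
  · rw [setReg_reg, if_neg (by omega)]; exact h.out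

theorem queueInsert_rep (hb : Bounds W B M k) (h : Rep π B M k A S Q s) (hQA : Q ⊆ A) {u : ℕ}
    (hu : s.reg 16 = u) (huA : u ∈ A) :
    Halts W G π queueInsert s (100 * s.reg 4 + 120) fun s' =>
      Rep π B M k A S (insert u Q) s' ∧ (∀ r, r < 10 ∨ 14 < r → s'.reg r = s.reg r) ∧
        (∀ a, a ≠ 2 → s'.arr a = s.arr a) := by
  refine (queueInsert_halts hb h.arr_le hu huA (h.A_lt u huA) rfl (h.height_le' hb) hQA
    h.slots.inj h.tree).mono le_rfl ?_
  rintro s' ⟨h1, h2, h3, h4⟩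
  refine ⟨h.update (fun r hr => h1 r (by omega)) (h2 3 (by decide)) (h2 4 (by decide)) h3 ?_ h4 ?_,
    h1, h2⟩
  · rw [h2 0 (by decide), h1 3 (by omega)]; exact h.out
  · rw [h2 1 (by decide), h2 5 (by decide), h2 6 (by decide), h2 7 (by decide)]; exact h.fol

theorem queueErase_rep (hb : Bounds W B M k) (h : Rep π B M k A S Q s) (hQA : Q ⊆ A) {u : ℕ}
    (hu : s.reg 16 = u) (huA : u ∈ A) :
    Halts W G π queueErase s (100 * s.reg 4 + 120) fun s' =>
      Rep π B M k A S (Q.erase u) s' ∧ (∀ r, r < 10 ∨ 14 < r → s'.reg r = s.reg r) ∧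
        (∀ a, a ≠ 2 → s'.arr a = s.arr a) := by
  refine (queueErase_halts hb h.arr_le hu huA (h.A_lt u huA) rfl (h.height_le' hb) hQA
    h.slots.inj h.tree).mono le_rfl ?_
  rintro s' ⟨h1, h2, h3, h4⟩
  refine ⟨h.update (fun r hr => h1 r (by omega)) (h2 3 (by decide)) (h2 4 (by decide)) h3 ?_ h4 ?_,
    h1, h2⟩
  · rw [h2 0 (by decide), h1 3 (by omega)]; exact h.out
  · rw [h2 1 (by decide), h2 5 (by decide), h2 6 (by decide), h2 7 (by decide)]; exact h.fol

/-- The vertex in register 21 becomes a follower of the predecessor of register 23. -/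
def addFollower : Program := block [
  .assign 15 (.bin .sub (.reg 23) (.lit 1)),
  .write 1 (.reg 21) (.reg 23),
  .write 5 (pairExpr (.reg 15) (.read 6 (.reg 15))) (.reg 21),
  .write 7 (.reg 21) (.read 6 (.reg 15)),
  .write 6 (.reg 15) (.bin .add (.read 6 (.reg 15)) (.lit 1))]

def attachStep : Program := block [
  .assign 15 (.reg 21),
  releaseAll,
  .assign 16 (.reg 21),
  queueErase,
  addFollower]

def eliminateStep : Program := block [
  .assign 15 (.bin .sub (.reg 24) (.lit 1)),
  .assign 16 (.read 0 (.reg 15)),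
  .assign 3 (.bin .sub (.reg 3) (.lit 1)),
  .write 0 (.reg 15) (.read 0 (.reg 3)),
  queueInsert]

def enterStep : Program := block [
  .assign 16 (.reg 21),
  queueErase,
  .write 0 (.reg 3) (.reg 21),
  .assign 3 (.bin .add (.reg 3) (.lit 1))]

def replaceStep : Program := block [
  .assign 16 (.reg 21),
  queueErase,
  .assign 16 (.read 0 (.reg 25)),
  .write 0 (.reg 25) (.reg 21),
  queueInsert]

/-- Treat the vertex in register 21 after a scan; register 20 becomes `0` when it has to wait. -/
def treat : Program :=
  .ite (.not (.eq (.reg 23) (.lit 0))) attachStep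
    (.ite (.not (.eq (.reg 24) (.lit 0))) eliminateStep
      (.ite (.lt (.reg 3) (.reg 0)) enterStep
        (.ite (.rankLt (.reg 21) (.read 0 (.reg 25))) replaceStep
          (.assign 20 (.lit 0)))))

/-- Treat the first vertex of the queue; register 20 becomes `0` when nothing has to be done. -/
def mainStep : Program := block [
  .assign 27 (.read 2 (pairExpr (.reg 4) (.lit 0))),
  .ite (.eq (.reg 27) (.lit 0))
    (.assign 20 (.lit 0))
    (block [.assign 21 (.bin .sub (.reg 27) (.lit 1)), scan, treat])]

theorem addFollower_halts (hb : Bounds W B M k) (h : Rep π B M k A S Q s) {q w : ℕ}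
    (hq : s.reg 21 = q) (hw : s.reg 23 = w + 1) (hqA : q ∈ A) (hwA : w ∈ A)
    (hq0 : s.arr 1 q = 0) :
    Halts W G π addFollower s 60 fun s' => Rep π B M k A S Q s' ∧
      s'.arr 1 = Function.update (s.arr 1) q (w + 1) ∧
      (∀ r, r < 15 ∨ 15 < r → s'.reg r = s.reg r) := by
  have hlt := hb.lt
  have hA : ∀ a x, s.arr a x < W := fun a x => by have := h.arr_le a x; omega
  have hqB := h.A_lt q hqA
  have hwB := h.A_lt w hwA
  have hc : s.arr 6 w + 1 ≤ B := by
    have h1 := h.fol.cnt_le hwA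
    have h2 := h.card_le
    have h3 := hb.cap
    omega
  refine halts_assign_cons ?_ (by decide) ?_
  · simp [Expr.Fits, Expr.eval, BinOp.eval, hw]; omega
  simp only [Expr.eval, BinOp.eval, hw, Nat.add_sub_cancel]
  set s₁ := s.setReg 15 w with hs₁
  have e15 : s₁.reg 15 = w := by simp [hs₁]
  have e21 : s₁.reg 21 = q := by simp [hs₁, hq]
  have e23 : s₁.reg 23 = w + 1 := by simp [hs₁, hw]
  refine halts_write_cons ?_ ?_ (by decide) ?_
  · simp only [Expr.Fits, e21]; omega
  · simp only [Expr.Fits, e23]; omega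
  simp only [Expr.eval, e21, e23]
  refine halts_write_cons ?_ ?_ (by decide) ?_
  · refine pairExpr_fits hb.pos hb.word ?_ ?_ ?_ ?_ <;>
      simp [Expr.Fits, Expr.eval, hs₁, setArr_arr_ne, hA] <;> omega
  · simp only [Expr.Fits, setArr_reg, e21]; omega
  simp only [Expr.eval, pairExpr_eval, setArr_reg, e21, e15,
    setArr_arr_ne _ _ _ (show (6 : ℕ) ≠ 1 by decide)]
  refine halts_write_cons ?_ ?_ (by decide) ?_
  · simp only [Expr.Fits, setArr_reg, e21]; omega
  · simp [Expr.Fits, Expr.eval, hs₁, setArr_arr_ne, hA]; omega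
  simp only [Expr.eval, setArr_reg, e21, e15,
    setArr_arr_ne _ _ _ (show (6 : ℕ) ≠ 1 by decide),
    setArr_arr_ne _ _ _ (show (6 : ℕ) ≠ 5 by decide)]
  refine halts_write ?_ ?_ (by decide) ?_
  · simp only [Expr.Fits, setArr_reg, e15]; omega
  · simp [Expr.Fits, Expr.eval, BinOp.eval, hs₁, setArr_arr_ne, hA]; omega
  simp only [Expr.eval, BinOp.eval, setArr_reg, e15,
    setArr_arr_ne _ _ _ (show (6 : ℕ) ≠ 1 by decide),
    setArr_arr_ne _ _ _ (show (6 : ℕ) ≠ 5 by decide),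
    setArr_arr_ne _ _ _ (show (6 : ℕ) ≠ 7 by decide)]
  rw [hs₁]
  simp only [setReg_arr]
  refine ⟨h.update ?_ ?_ ?_ ?_ ?_ ?_ ?_, ?_, ?_⟩
  · intro r hr
    simp only [setArr_reg, setReg_reg]
    rw [if_neg (by omega)]
  · simp [setArr_arr]
  · simp [setArr_arr]
  · exact setArr_arr_le (setArr_arr_le (setArr_arr_le (setArr_arr_le h.arr_le (by omega))
      (by omega)) (by omega)) hc
  · simpa [setArr_arr] using h.out
  · simpa [setArr_arr] using h.tree
  · simpa [setArr_arr] using h.fol.push hwA hqA hq0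
  · simp [setArr_arr]
  · intro r hr
    simp only [setReg_reg]
    rw [if_neg (by omega)]

/-- `q` must lose its followers before it may follow `w`, as leaders lie in `S ∪ Q`. No active
vertex led by `q` has `q` as its eliminator, so the `c` releases pay for themselves, and `q` brings
3 more units by attaching to its eliminator. -/
theorem attachStep_halts (hb : Bounds W B M k) (h : Rep π B M k A S Q s)
    (hi : Inv G π k A S Q O (s.arr 1)) {e : ℕ → ℕ} (ho : OldLast π e S O) {q w : ℕ}
    (hq : s.reg 21 = q) (hw : s.reg 23 = w + 1) (hqQ : q ∈ Q) (hwS : w ∈ S)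
    (had : G.Adj w q) (hlt : π w < π q) (heq : e q = w) (he : ∀ u ∈ A, s.arr 1 u = q + 1 → e u ≠ q) :
    ∃ c, Halts W G π attachStep s ((100 * s.reg 4 + 150) * c + 100 * s.reg 4 + 220) fun s' =>
      ∃ Q' O', Rep π B M k A S Q' s' ∧ Inv G π k A S Q' O' (s'.arr 1) ∧ OldLast π e S O' ∧
        potential e A S Q' O' (s'.arr 1) + c + 3 ≤ potential e A S Q O (s.arr 1) ∧
        (∀ r, r < 10 ∨ 16 < r → s'.reg r = s.reg r) := by
  have hlt' := hb.lt
  have hqA := hi.Q_sub hqQ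
  have hwA := hi.S_sub hwS
  have hqB := h.A_lt q hqA
  refine ⟨s.arr 6 q, ?_⟩
  refine halts_assign_cons ?_ ?_ ?_
  · simp only [Expr.Fits, hq]; omega
  · simp [Expr.cost]
  simp only [Expr.eval, hq]
  refine halts_cons ((100 * s.reg 4 + 150) * s.arr 6 q + 10) (100 * s.reg 4 + 200)
    ((releaseAll_halts (e := e) (s := s.setReg 15 q) hb (h.setReg (by decide)) hi hqA (by simp)
      rfl he).mono ?_ ?_) ?_
  · simp
  · rintro s₁ ⟨Q₁, hQ₁, h1, hi1, hF, h0, hp, -, hreg, -⟩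
    have er : ∀ r, r < 10 ∨ 16 < r → s₁.reg r = s.reg r := fun r hr => by
      rw [hreg r hr, setReg_reg, if_neg (by omega)]
    refine halts_assign_cons ?_ ?_ ?_
    · simp only [Expr.Fits, er 21 (by omega), hq]; omega
    · simp [Expr.cost]
    simp only [Expr.eval, er 21 (by omega), hq]
    refine halts_cons (100 * s.reg 4 + 120) 70 ((queueErase_rep (u := q) hb
      (h1.setReg (r := 16) (x := q) (by decide)) hi1.Q_sub (by simp) hqA).mono ?_ ?_) ?_
    · simp [er 4 (by omega)]
    · rintro s₂ ⟨h2, er2, ea2⟩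
      have er2' : ∀ r, r < 10 ∨ 16 < r → s₂.reg r = s.reg r := fun r hr => by
        rw [er2 r (by omega), setReg_reg, if_neg (by omega), er r hr]
      have e1 : s₂.arr 1 = s₁.arr 1 := ea2 1 (by decide)
      refine (addFollower_halts (q := q) (w := w) hb h2 ?_ ?_ hqA hwA ?_).mono (by decide) ?_
      · rw [er2' 21 (by omega), hq]
      · rw [er2' 23 (by omega), hw]
      · rw [e1]; exact hi1.ld_Q q (hQ₁ hqQ)
      · rintro s₃ ⟨h3, e3, er3⟩
        refine ⟨Q₁.erase q, O.erase q, h3, ?_, ho.erase q, ?_, ?_⟩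
        · rw [e3, e1]
          exact hi1.attach (hQ₁ hqQ) hwS hF had hlt
        · rw [e3, e1]
          have := hi1.potential_attach (hQ₁ hqQ) hwS heq
          have hp' : potential e A S Q₁ O (s₁.arr 1) + s.arr 6 q ≤
            potential e A S Q O (s.arr 1) := hp
          omega
        · exact fun r hr => (er3 r (by omega)).trans (er2' r hr)
    · simp [Expr.cost]
  · simp [Expr.cost]; omega

theorem eliminateStep_halts (hb : Bounds W B M k) (h : Rep π B M k A S Q s)
    (hi : Inv G π k A S Q O (s.arr 1)) {e : ℕ → ℕ} (ho : OldLast π e S O) {j x : ℕ}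
    (hj : s.reg 24 = j + 1) (hjn : j < s.reg 3) (hx : s.arr 0 j = x) (he : e x ≠ x) :
    Halts W G π eliminateStep s (100 * s.reg 4 + 160) fun s' =>
      ∃ S' Q' O', Rep π B M k A S' Q' s' ∧ Inv G π k A S' Q' O' (s'.arr 1) ∧ OldLast π e S' O' ∧
        potential e A S' Q' O' (s'.arr 1) + 1 ≤ potential e A S Q O (s.arr 1) ∧
        (∀ r, r ≠ 3 → r < 10 ∨ 16 < r → s'.reg r = s.reg r) := by
  have hlt' := hb.lt
  have hA : ∀ a x, s.arr a x < W := fun a x => by have := h.arr_le a x; omega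
  have hxS : x ∈ S := hx ▸ h.out.mem hjn
  have hn : s.reg 3 ≤ B := by
    rw [← h.out.1]; exact hi.card_le.trans hb.k_le
  refine halts_assign_cons ?_ ?_ ?_
  · simp [Expr.Fits, Expr.eval, BinOp.eval, hj]; omega
  · simp [Expr.cost]
  simp only [Expr.eval, BinOp.eval, hj, Nat.add_sub_cancel]
  refine halts_assign_cons ?_ ?_ ?_
  · simp [Expr.Fits, Expr.eval, hA]; omega
  · simp [Expr.cost]
  simp only [Expr.eval, setReg_reg, setReg_arr, if_true, hx]
  refine halts_assign_cons ?_ ?_ ?_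
  · simp [Expr.Fits, Expr.eval, BinOp.eval]; omega
  · simp [Expr.cost]
  simp only [Expr.eval, BinOp.eval, setReg_reg]
  simp only [Nat.reduceEqDiff, if_false]
  refine halts_write_cons ?_ ?_ ?_ ?_
  · simp [Expr.Fits]; omega
  · simp [Expr.Fits, Expr.eval, hA]; omega
  · simp [Expr.cost]
  simp only [Expr.eval, setReg_reg, setReg_arr]
  simp only [Nat.reduceEqDiff, if_false, if_true]
  set s₁ := (((s.setReg 15 j).setReg 16 x).setReg 3 (s.reg 3 - 1)).setArr 0 j
    (s.arr 0 (s.reg 3 - 1)) with hs₁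
  have h1 : Rep π B M k A (S.erase x) Q s₁ := by
    refine h.update ?_ ?_ ?_ ?_ ?_ ?_ ?_
    · intro r hr
      simp only [hs₁, setArr_reg, setReg_reg]
      rw [if_neg (by omega), if_neg (by omega), if_neg (by omega)]
    · simp [hs₁, setArr_arr]
    · simp [hs₁, setArr_arr]
    · exact setArr_arr_le h.arr_le (h.arr_le _ _)
    · have := h.out.swapLast hjn
      rw [hx] at this
      simpa [hs₁, setArr_arr] using this
    · simpa [hs₁, setArr_arr] using h.tree
    · simpa [hs₁, setArr_arr] using h.fol
  have e1 : s₁.arr 1 = s.arr 1 := by simp [hs₁, setArr_arr]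
  change Halts W G π queueInsert _ _ _
  refine (queueInsert_rep (s := s₁) (u := x) hb h1 hi.Q_sub ?_ (hi.S_sub hxS)).mono ?_ ?_
  · simp [hs₁]
  · simp [hs₁, Expr.cost]
  · rintro s₂ ⟨h2, er, ea⟩
    have e1' : s₂.arr 1 = s.arr 1 := (ea 1 (by decide)).trans e1
    refine ⟨S.erase x, insert x Q, insert x O, h2, ?_, ho.drop fun h => absurd h he, ?_, ?_⟩
    · rw [e1']; exact hi.drop hxS
    · rw [e1']; exact hi.potential_eliminate hxS he
    · intro r hr3 hr
      rw [er r (by omega), hs₁]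
      simp only [setArr_reg, setReg_reg]
      rw [if_neg (by omega), if_neg (by omega), if_neg (by omega)]

theorem enterStep_halts (hb : Bounds W B M k) (h : Rep π B M k A S Q s)
    (hi : Inv G π k A S Q O (s.arr 1)) {e : ℕ → ℕ} (ho : OldLast π e S O) {q : ℕ}
    (hq : s.reg 21 = q) (hqQ : q ∈ Q) (had : ∀ w ∈ S, ¬ G.Adj w q) (hk : S.card < k)
    (he : e q = q) (hmin : ∀ u ∈ O, u ≠ q → π q < π u) :
    Halts W G π enterStep s (100 * s.reg 4 + 160) fun s' =>
      ∃ S' Q' O', Rep π B M k A S' Q' s' ∧ Inv G π k A S' Q' O' (s'.arr 1) ∧ OldLast π e S' O' ∧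
        potential e A S' Q' O' (s'.arr 1) + 1 ≤ potential e A S Q O (s.arr 1) ∧
        (∀ r, r ≠ 3 → r < 10 ∨ 16 < r → s'.reg r = s.reg r) := by
  have hlt' := hb.lt
  have hqA := hi.Q_sub hqQ
  have hqB := h.A_lt q hqA
  have hqS : q ∉ S := fun h' => hi.disj q h' hqQ
  have hn : s.reg 3 + 1 ≤ B := by
    rw [← h.out.1]; have := hb.k_le; omega
  refine halts_assign_cons ?_ ?_ ?_
  · simp only [Expr.Fits, hq]; omega
  · simp [Expr.cost]
  simp only [Expr.eval, hq]
  refine halts_cons (100 * s.reg 4 + 120) 20 ((queueErase_rep (u := q) hb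
    (h.setReg (r := 16) (x := q) (by decide)) hi.Q_sub (by simp) hqA).mono ?_ ?_) ?_
  · simp
  · rintro s₁ ⟨h1, er, ea⟩
    have er' : ∀ r, r < 10 ∨ 16 < r → s₁.reg r = s.reg r := fun r hr => by
      rw [er r (by omega), setReg_reg, if_neg (by omega)]
    have e1 : s₁.arr 1 = s.arr 1 := ea 1 (by decide)
    refine halts_write_cons ?_ ?_ (by decide) ?_
    · simp only [Expr.Fits, er' 3 (by omega)]; omega
    · simp only [Expr.Fits, er' 21 (by omega), hq]; omega
    simp only [Expr.eval, er' 3 (by omega), er' 21 (by omega), hq]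
    refine halts_assign ?_ (by decide) ?_
    · simp [Expr.Fits, Expr.eval, BinOp.eval, er' 3 (by omega)]; omega
    simp only [Expr.eval, BinOp.eval, setArr_reg, er' 3 (by omega)]
    refine ⟨insert q S, Q.erase q, O.erase q, ?_, ?_, ho.enter hmin, ?_, ?_⟩
    · refine h1.update ?_ ?_ ?_ ?_ ?_ ?_ ?_
      · intro r hr
        simp only [setArr_reg, setReg_reg]
        rw [if_neg (by omega)]
      · simp [setArr_arr]
      · simp [setArr_arr]
      · exact setArr_arr_le h1.arr_le (by omega)
      · have := h1.out
        rw [er' 3 (by omega)] at this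
        simpa [setArr_arr] using this.push hqS
      · simpa [setArr_arr] using h1.tree
      · simpa [setArr_arr] using h1.fol
    · simp only [setReg_arr, setArr_arr_ne _ _ _ (show (1 : ℕ) ≠ 0 by decide), e1]
      exact hi.enter hqQ had hk
    · simp only [setReg_arr, setArr_arr_ne _ _ _ (show (1 : ℕ) ≠ 0 by decide), e1]
      exact hi.potential_enter hqQ he
    · intro r hr3 hr
      simp only [setArr_reg, setReg_reg]
      rw [if_neg hr3, er' r hr]
  · simp [Expr.cost]

/-- The program takes `q` out of the queue first; the analysis drops `x` and then lets `q` enter, at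
a cost of at most 1 and a gain of 3. -/
theorem replaceStep_halts (hb : Bounds W B M k) (h : Rep π B M k A S Q s)
    (hi : Inv G π k A S Q O (s.arr 1)) {e : ℕ → ℕ} (ho : OldLast π e S O) {q m x : ℕ}
    (hq : s.reg 21 = q) (hm : s.reg 25 = m) (hmn : m < s.reg 3) (hx : s.arr 0 m = x)
    (hqQ : q ∈ Q) (had : ∀ w ∈ S, ¬ G.Adj w q) (hlt : π q < π x)
    (hlast : ∀ w ∈ S, w ≠ x → π w < π x)
    (he : e q = q) (hmin : ∀ u ∈ Q, u ≠ q → π q < π u) :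
    Halts W G π replaceStep s (200 * s.reg 4 + 280) fun s' =>
      ∃ S' Q' O', Rep π B M k A S' Q' s' ∧ Inv G π k A S' Q' O' (s'.arr 1) ∧ OldLast π e S' O' ∧
        potential e A S' Q' O' (s'.arr 1) + 1 ≤ potential e A S Q O (s.arr 1) ∧
        (∀ r, r < 10 ∨ 16 < r → s'.reg r = s.reg r) := by
  have hlt' := hb.lt
  have hqA := hi.Q_sub hqQ
  have hqB := h.A_lt q hqA
  have hqS : q ∉ S := fun h' => hi.disj q h' hqQ
  have hxS : x ∈ S := hx ▸ h.out.mem hmn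
  have hxq : x ≠ q := fun e => hqS (e ▸ hxS)
  -- This is the purpose of `OldLast`: an old vertex that is its own eliminator comes after all of
  -- `S`, whereas `q` precedes `x`.
  have hqO : q ∉ O := fun h' => lt_asymm hlt (ho q h' he x hxS)
  have hn : s.reg 3 ≤ B := by
    rw [← h.out.1]; exact hi.card_le.trans hb.k_le
  refine halts_assign_cons ?_ ?_ ?_
  · simp only [Expr.Fits, hq]; omega
  · simp [Expr.cost]
  simp only [Expr.eval, hq]
  refine halts_cons (100 * s.reg 4 + 120) (100 * s.reg 4 + 140) ((queueErase_rep (u := q) hb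
    (h.setReg (r := 16) (x := q) (by decide)) hi.Q_sub (by simp) hqA).mono ?_ ?_) ?_
  · simp
  · rintro s₁ ⟨h1, er, ea⟩
    have er' : ∀ r, r < 10 ∨ 16 < r → s₁.reg r = s.reg r := fun r hr => by
      rw [er r (by omega), setReg_reg, if_neg (by omega)]
    have ea' : ∀ a, a ≠ 2 → s₁.arr a = s.arr a := ea
    have hA₁ : ∀ a x, s₁.arr a x < W := fun a x => by have := h1.arr_le a x; omega
    refine halts_assign_cons ?_ ?_ ?_
    · simp [Expr.Fits, Expr.eval, er' 25 (by omega), hm, hA₁]; omega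
    · simp [Expr.cost]
    simp only [Expr.eval, er' 25 (by omega), hm, ea' 0 (by decide), hx]
    refine halts_write_cons ?_ ?_ ?_ ?_
    · simp [Expr.Fits, er' 25 (by omega), hm]; omega
    · simp [Expr.Fits, er' 21 (by omega), hq]; omega
    · simp [Expr.cost]
    simp only [Expr.eval, setReg_reg]
    simp only [Nat.reduceEqDiff, if_false, er' 25 (by omega), hm, er' 21 (by omega), hq]
    set s₂ := (s₁.setReg 16 x).setArr 0 m q with hs₂
    have h2 : Rep π B M k A (insert q (S.erase x)) (Q.erase q) s₂ := by
      refine h1.update ?_ ?_ ?_ ?_ ?_ ?_ ?_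
      · intro r hr
        simp only [hs₂, setArr_reg, setReg_reg]
        rw [if_neg (by omega)]
      · simp [hs₂, setArr_arr]
      · simp [hs₂, setArr_arr]
      · exact setArr_arr_le h1.arr_le (by omega)
      · have := h.out.replace hmn hqS
        rw [hx] at this
        simpa [hs₂, setArr_arr, ea' 0 (by decide), er' 3 (by omega)] using this
      · simpa [hs₂, setArr_arr] using h1.tree
      · simpa [hs₂, setArr_arr] using h1.fol
    have e1 : s₂.arr 1 = s.arr 1 := by
      rw [hs₂, setArr_arr_ne _ _ _ (by decide)]; exact ea' 1 (by decide)
    change Halts W G π queueInsert _ _ _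
    refine (queueInsert_rep (s := s₂) (u := x) hb h2 ((Finset.erase_subset _ _).trans hi.Q_sub) ?_
      (hi.S_sub hxS)).mono ?_ ?_
    · simp [hs₂]
    · simp [hs₂, Expr.cost, er' 4 (by omega)]
    · rintro s₃ ⟨h3, er3, ea3⟩
      have e1' : s₃.arr 1 = s.arr 1 := (ea3 1 (by decide)).trans e1
      have hset : (insert x Q).erase q = insert x (Q.erase q) := by
        rw [Finset.erase_insert_of_ne hxq]
      have hi2 := hi.drop hxS
      have hqQ' : q ∈ insert x Q := Finset.mem_insert_of_mem hqQ
      have hqO' : q ∉ insert x O := by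
        rw [Finset.mem_insert, not_or]; exact ⟨hxq.symm, hqO⟩
      have had' : ∀ w ∈ S.erase x, ¬ G.Adj w q := fun w hw => had w (Finset.mem_of_mem_erase hw)
      refine ⟨insert q (S.erase x), insert x (Q.erase q), (insert x O).erase q, h3, ?_, ?_, ?_, ?_⟩
      · rw [e1', ← hset]
        refine hi2.enter hqQ' had' ?_
        rw [Finset.card_erase_of_mem hxS]
        have := hi.card_le
        have := Finset.card_pos.2 ⟨x, hxS⟩
        omega
      · refine (ho.drop fun _ => hlast).enter fun u hu hne => ?_
        rcases Finset.mem_insert.1 hu with rfl | hu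
        · exact hlt
        · exact hmin u (hi.O_sub hu) hne
      · rw [e1', ← hset]
        have p1 := hi.potential_drop (e := e) hxS
        have p2 := hi2.potential_enter_new hqQ' hqO' he
        omega
      · intro r hr
        rw [er3 r (by omega), hs₂]
        simp only [setArr_reg, setReg_reg]
        rw [if_neg (by omega), er' r hr]
  · simp [Expr.cost]; omega

end MainLoop
end DynLFMIS

namespace DynLFMIS

/-! ### The main loop and its amortized cost -/

section Loop

variable {W B M k : ℕ} {G : SimpleGraph ℕ} {π : ℕ → unitInterval} {A S Q O : Finset ℕ} {s : State}

/-- A step of the main loop from the configuration `(S, Q, O)`: the time is paid by the potential,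
up to one unit of price `R` if the loop stops. -/
def Progress (W : ℕ) (G : SimpleGraph ℕ) (π : ℕ → unitInterval) (B M k R : ℕ)
    (A S Q O : Finset ℕ) (p : Program) (s : State) (d : ℕ) : Prop :=
  ∃ t s' S' Q' O', Exec W G π p s t s' ∧ Rep π B M k A S' Q' s' ∧
    Inv G π k A S' Q' O' (s'.arr 1) ∧ (∀ r, r ≠ 3 → r < 10 → s'.reg r = s.reg r) ∧
    ((s'.reg 20 = 1 ∧ OldLast π (elim G π A) S' O' ∧
        t + d + R * potential (elim G π A) A S' Q' O' (s'.arr 1) ≤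
          R * potential (elim G π A) A S Q O (s.arr 1)) ∨
      (s'.reg 20 = 0 ∧ Settled G π k S' Q' ∧
        t + d + R * potential (elim G π A) A S' Q' O' (s'.arr 1) ≤
          R * potential (elim G π A) A S Q O (s.arr 1) + R))

/-- The five outcomes of the scan. In each of them the eliminator of `q`, or of the expelled vertex,
is known well enough for the potential to fall, except when the loop stops. The allowance 70k + 90
pays for the scan that comes before. -/
theorem treat_progress (hπ : Function.Injective π) (hb : Bounds W B M k)
    (hk1 : 1 ≤ k)
    (h : Rep π B M k A S Q s) (hi : Inv G π k A S Q O (s.arr 1))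
    (ho : OldLast π (elim G π A) S O) {R q : ℕ} (hR : 200 * s.reg 4 + 70 * k + 400 ≤ R)
    (h20 : s.reg 20 = 1) (hq : s.reg 21 = q) (hqQ : q ∈ Q) (hmin : ∀ x ∈ Q, π q ≤ π x)
    (h1 : BestOK G π (s.arr 0) q (s.reg 3) (s.reg 23))
    (h2 : LaterOK G π (s.arr 0) q (s.reg 3) (s.reg 24))
    (h3 : LastOK π (s.arr 0) (s.reg 3) (s.reg 25)) :
    Progress W G π B M k R A S Q O treat s (70 * k + 90) := by
  have hlt := hb.lt
  have hA : ∀ a x, s.arr a x < W := fun a x => by have := h.arr_le a x; omega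
  have hqA := hi.Q_sub hqQ
  have hqB := h.A_lt q hqA
  have hkB := hb.k_le
  have hn : s.reg 3 ≤ k := by rw [← h.out.1]; exact hi.card_le
  have hqS : q ∉ S := fun h' => hi.disj q h' hqQ
  have hSq : ∀ w ∈ S, w ≠ q := fun w hw e => hqS (e ▸ hw)
  have hminO : ∀ u ∈ Q, u ≠ q → π q < π u := fun u hu hne =>
    lt_of_le_of_ne (hmin u hu) fun e => hne (hπ e).symm
  have h23 : s.reg 23 < W := by
    rcases h1 with ⟨e, -⟩ | ⟨j, -, e, -⟩
    · omega
    · have := h.arr_le 0 j; omega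
  have h24 : s.reg 24 < W := by
    rcases h2 with ⟨e, -⟩ | ⟨j, hj, e, -⟩ <;> omega
  have h25 : s.reg 25 < W := by
    have := h3.1; omega
  by_cases hbest : s.reg 23 = 0
  swap
  · obtain ⟨j, hj, e23, had, hltq, hfirst⟩ := h1.resolve_left fun h' => hbest h'.1
    have hwS := h.out.mem hj
    have he : elim G π A q = s.arr 0 j := hi.elim_of_min hπ hmin hwS had hltq fun x hx hxq hxad => by
      obtain ⟨i, hi', rfl⟩ := h.out.exists_index hx
      exact hfirst i hi' hxq hxad
    obtain ⟨c, t, s', ht, htc, Q', O', hr', hi', ho', hp, hreg⟩ :=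
      attachStep_halts hb h hi ho hq e23 hqQ hwS had hltq he fun u hu _ e => by
        -- An eliminator lies in the LFMIS and is its own eliminator, but that of `q` is `w`; so `q`
        -- eliminates nobody, and all its followers are wrongly led.
        have hqI : q ∈ lfmis G π A := e ▸ elim_mem hπ hu
        rw [elim_self hπ hqI] at he
        exact hSq _ hwS he.symm
    refine ⟨_, s', S, Q', O', .ite_true ?_ ?_ ht, hr', hi', fun r _ hr => hreg r (by omega),
      Or.inl ⟨(hreg 20 (by omega)).trans h20, ho', ?_⟩⟩
    · simp [Test.Fits, Expr.Fits]; omega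
    · simpa [Test.Holds, Expr.eval] using hbest
    · simp only [Test.cost, Expr.cost]
      have := Nat.mul_le_mul_left R hp
      -- Of the `c + 3` units gained, `c` pay for the releases and the others for the rest of the
      -- round.
      have : (100 * s.reg 4 + 150) * c ≤ R * c := Nat.mul_le_mul_right c (by omega)
      nlinarith
  have hdom := (h1.resolve_right fun ⟨j, _, e, _⟩ => by omega).2
  have hqI : q ∈ lfmis G π A := hi.mem_lfmis_of_min hπ hqQ hmin fun w hw hwq => by
    obtain ⟨i, hi', rfl⟩ := h.out.exists_index hw
    exact hdom i hi' hwq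
  by_cases hnb : s.reg 24 = 0
  swap
  · obtain ⟨j, hj, e24, had, hltq⟩ := h2.resolve_left fun h' => hnb h'.1
    have hxS := h.out.mem hj
    obtain ⟨t, s', ht, htc, S', Q', O', hr', hi', ho', hp, hreg⟩ :=
      eliminateStep_halts hb h hi ho e24 hj rfl fun e => by
        -- A neighbour of `q`, which is in the LFMIS, is not in it and hence not its own eliminator.
        have hxI : s.arr 0 j ∈ lfmis G π A := e ▸ elim_mem hπ (hi.S_sub hxS)
        exact not_adj_of_mem_lfmis hxI hqI had
    refine ⟨_, s', S', Q', O', .ite_false ?_ ?_ (.ite_true ?_ ?_ ht), hr', hi',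
      fun r h3 hr => hreg r h3 (by omega),
      Or.inl ⟨(hreg 20 (by omega) (by omega)).trans h20, ho', ?_⟩⟩
    · simp [Test.Fits, Expr.Fits]; omega
    · simpa [Test.Holds, Expr.eval] using hbest
    · simp [Test.Fits, Expr.Fits]; omega
    · simpa [Test.Holds, Expr.eval] using hnb
    · simp only [Test.cost, Expr.cost]
      have := Nat.mul_le_mul_left R hp
      rw [mul_add] at this
      omega
  have hlater := (h2.resolve_right fun ⟨j, _, e, _⟩ => by omega).2
  have had : ∀ w ∈ S, ¬ G.Adj w q := fun w hw => by
    obtain ⟨i, hi', rfl⟩ := h.out.exists_index hw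
    by_cases hwq : π (s.arr 0 i) < π q
    · exact hdom i hi' hwq
    · exact hlater i hi' hwq
  have he := elim_self hπ hqI
  by_cases hk : s.reg 3 < k
  · obtain ⟨t, s', ht, htc, S', Q', O', hr', hi', ho', hp, hreg⟩ :=
      enterStep_halts hb h hi ho hq hqQ had (h.out.1 ▸ hk) he fun u hu => hminO u (hi.O_sub hu)
    refine ⟨_, s', S', Q', O', .ite_false ?_ ?_ (.ite_false ?_ ?_ (.ite_true ?_ ?_ ht)), hr', hi',
      fun r h3 hr => hreg r h3 (by omega),
      Or.inl ⟨(hreg 20 (by omega) (by omega)).trans h20, ho', ?_⟩⟩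
    · simp [Test.Fits, Expr.Fits]; omega
    · simpa [Test.Holds, Expr.eval] using hbest
    · simp [Test.Fits, Expr.Fits]; omega
    · simpa [Test.Holds, Expr.eval] using hnb
    · simp [Test.Fits, Expr.Fits, h.reg_k]; omega
    · simpa [Test.Holds, Expr.eval, h.reg_k] using hk
    · simp only [Test.cost, Expr.cost]
      have := Nat.mul_le_mul_left R hp
      rw [mul_add] at this
      omega
  by_cases hlast : π q < π (s.arr 0 (s.reg 25))
  · have hm : s.reg 25 < s.reg 3 := by have := h3.1; omega
    obtain ⟨t, s', ht, htc, S', Q', O', hr', hi', ho', hp, hreg⟩ :=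
      replaceStep_halts hb h hi ho hq rfl hm rfl hqQ had hlast (fun w hw hne => by
        obtain ⟨i, hi', rfl⟩ := h.out.exists_index hw
        exact lt_of_le_of_ne (h3.2 i hi') fun e => hne (hπ e)) he hminO
    refine ⟨_, s', S', Q', O', .ite_false ?_ ?_ (.ite_false ?_ ?_ (.ite_false ?_ ?_
      (.ite_true ?_ ?_ ht))), hr', hi', fun r h3 hr => hreg r (by omega),
      Or.inl ⟨(hreg 20 (by omega)).trans h20, ho', ?_⟩⟩
    · simp [Test.Fits, Expr.Fits]; omega
    · simpa [Test.Holds, Expr.eval] using hbest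
    · simp [Test.Fits, Expr.Fits]; omega
    · simpa [Test.Holds, Expr.eval] using hnb
    · simp [Test.Fits, Expr.Fits, h.reg_k]; omega
    · simpa [Test.Holds, Expr.eval, h.reg_k] using hk
    · simp [Test.Fits, Expr.Fits, hA, hq]; omega
    · simpa [Test.Holds, Expr.eval, hq] using hlast
    · simp only [Test.cost, Expr.cost]
      have := Nat.mul_le_mul_left R hp
      rw [mul_add] at this
      omega
  · refine ⟨_, _, S, Q, O, .ite_false ?_ ?_ (.ite_false ?_ ?_ (.ite_false ?_ ?_
      (.ite_false ?_ ?_ (.assign _ _ _ ?_)))), h.setReg (by decide), hi, ?_,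
      Or.inr ⟨?_, Or.inr ⟨?_, q, hqQ, hmin, fun w hw => ⟨?_, had w hw⟩⟩, ?_⟩⟩
    · simp [Test.Fits, Expr.Fits]; omega
    · simpa [Test.Holds, Expr.eval] using hbest
    · simp [Test.Fits, Expr.Fits]; omega
    · simpa [Test.Holds, Expr.eval] using hnb
    · simp [Test.Fits, Expr.Fits, h.reg_k]; omega
    · simpa [Test.Holds, Expr.eval, h.reg_k] using hk
    · simp [Test.Fits, Expr.Fits, hA, hq]; omega
    · simpa [Test.Holds, Expr.eval, hq] using hlast
    · simp [Expr.Fits]; omega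
    · intro r _ hr
      rw [setReg_reg, if_neg (by omega)]
    · simp [Expr.eval]
    · rw [h.out.1]; omega
    · obtain ⟨i, hi', rfl⟩ := h.out.exists_index hw
      exact lt_of_le_of_ne ((h3.2 i hi').trans (not_lt.1 hlast)) fun e => hSq _ hw (hπ e)
    · simp only [Test.cost, Expr.cost, setReg_arr]
      omega

theorem mainStep_progress (hπ : Function.Injective π) (hb : Bounds W B M k)
    (hk1 : 1 ≤ k)
    (h : Rep π B M k A S Q s) (hi : Inv G π k A S Q O (s.arr 1))
    (ho : OldLast π (elim G π A) S O) {R : ℕ} (hR : 200 * s.reg 4 + 70 * k + 400 ≤ R)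
    (h20 : s.reg 20 = 1) : Progress W G π B M k R A S Q O mainStep s 20 := by
  have hlt := hb.lt
  have hkB := hb.k_le
  have hA : ∀ a x, s.arr a x < W := fun a x => by have := h.arr_le a x; omega
  have h4 := h.height_le' hb
  have hn : s.reg 3 ≤ k := by rw [← h.out.1]; exact hi.card_le
  have hfit : Expr.Fits W s (.read 2 (pairExpr (.reg 4) (.lit 0))) := by
    refine ⟨pairExpr_fits hb.pos hb.word ?_ ?_ ?_ ?_, hA _ _⟩ <;>
      simp [Expr.Fits, Expr.eval] <;> omega
  -- All slots are below the number of leaves, so the root covers the whole queue and holds its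
  -- first vertex.
  have hroot : ∀ x ∈ Q, s.arr 3 x / 2 ^ s.reg 4 = 0 := fun x hx => by
    have h1 := h.slots.lt x (hi.Q_sub hx)
    have h2 := h.room
    exact Nat.div_eq_of_lt (by omega)
  set s₁ := s.setReg 27 (s.arr 2 (pair (s.reg 4) 0)) with hs₁
  have e27 : s₁.reg 27 = s.arr 2 (pair (s.reg 4) 0) := by simp [hs₁]
  rcases h.tree.node _ le_rfl 0 with ⟨h0, hQ⟩ | ⟨q, hqQ, h0, -, hmin⟩
  · refine ⟨_, _, S, Q, O, .seq (.assign _ _ _ hfit) (.ite_true (s := s₁) ?_ ?_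
      (.assign _ _ _ ?_)), (h.setReg (by decide)).setReg (by decide), hi, ?_,
      Or.inr ⟨?_, Or.inl ?_, ?_⟩⟩
    · simp [Test.Fits, Expr.Fits, e27, h0]; omega
    · simp [Test.Holds, Expr.eval, e27, h0]
    · simp [Expr.Fits]; omega
    · intro r _ hr
      rw [setReg_reg, if_neg (by omega), hs₁, setReg_reg, if_neg (by omega)]
    · simp [Expr.eval]
    · exact Finset.eq_empty_of_forall_notMem fun x hx => hQ x hx (hroot x hx)
    · simp only [Test.cost, Expr.cost, setReg_arr, pairExpr, hs₁]
      omega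
  · have hmin' : ∀ x ∈ Q, π q ≤ π x := fun x hx => hmin x hx (hroot x hx)
    have hqB := h.A_lt q (hi.Q_sub hqQ)
    set s₂ := s₁.setReg 21 q with hs₂
    have e21 : s₂.reg 21 = q := by simp [hs₂]
    have hev : Expr.eval s₁ (.bin .sub (.reg 27) (.lit 1)) = q := by
      simp [Expr.eval, BinOp.eval, e27, h0]
    have h2 : Rep π B M k A S Q s₂ := (h.setReg (by decide)).setReg (by decide)
    have er2 : ∀ r, r < 20 ∨ 27 < r → s₂.reg r = s.reg r := fun r hr => by
      rw [hs₂, setReg_reg, if_neg (by omega), hs₁, setReg_reg, if_neg (by omega)]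
    obtain ⟨t, s₃, ht, htc, g1, g2, g3, g4, g5⟩ := scan_halts (W := W) (G := G) (π := π) (s := s₂)
      (q := q) (by rw [er2 3 (by omega)]; omega) (by omega)
      (fun a x => by have := h2.arr_le a x; omega) e21
    have er3 : ∀ r, r < 21 ∨ 27 < r → s₃.reg r = s₂.reg r := fun r hr => g4 r (by omega)
    have h3 : Rep π B M k A S Q s₃ := by
      refine h2.update (fun r hr => er3 r (by omega)) ?_ ?_ ?_ ?_ ?_ ?_
      · rw [g5]
      · rw [g5]
      · rw [g5]; exact h2.arr_le
      · rw [g5, er3 3 (by omega)]; exact h2.out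
      · rw [g5]; exact h2.tree
      · rw [g5]; exact h2.fol
    have e3 : s₃.reg 3 = s₂.reg 3 := er3 3 (by omega)
    have e20 : s₂.reg 20 = s.reg 20 := by simp [hs₂, hs₁]
    have e1 : s₃.arr 1 = s.arr 1 := by rw [g5]; rfl
    obtain ⟨t', s', S', Q', O', hx, hr', hi', hreg, hp⟩ := treat_progress (s := s₃) (R := R)
      (q := q) hπ hb hk1 h3 (by rw [e1]; exact hi) ho
      (by rw [er3 4 (by omega), er2 4 (by omega)]; exact hR)
      (by rw [er3 20 (by omega), e20]; exact h20) (by rw [g4 21 (by omega)]; exact e21) hqQ hmin'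
      (by rw [g5, e3]; exact g1) (by rw [g5, e3]; exact g2) (by rw [g5, e3]; exact g3)
    have hexec : Exec W G π mainStep s _ s' := .seq (.assign _ _ _ hfit) (.ite_false (s := s₁)
      (by simp [Test.Fits, Expr.Fits, e27, h0]; omega)
      (by simp [Test.Holds, Expr.eval, e27, h0])
      (.seq (.assign _ _ _ (by simp [Expr.Fits, Expr.eval, BinOp.eval, e27, h0]; omega))
        (.seq (by rw [hev]; exact ht) hx)))
    refine ⟨_, s', S', Q', O', hexec, hr', hi', fun r hr3 hr => ?_, ?_⟩
    · rw [hreg r hr3 hr, er3 r (by omega), er2 r (by omega)]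
    · rw [er2 3 (by omega)] at htc
      rw [e1] at hp
      simp only [Test.cost, Expr.cost, pairExpr]
      refine hp.imp ?_ ?_
      · rintro ⟨p1, p2, p3⟩
        exact ⟨p1, p2, by omega⟩
      · rintro ⟨p1, p2, p3⟩
        exact ⟨p1, p2, by omega⟩

/-- Treat the queue until nothing has to be done. -/
def mainLoop : Program := .while (.eq (.reg 20) (.lit 1)) mainStep

/-- Induction on the potential. A round that does not stop the loop is paid for by a fall of the
potential; the last round costs at most one extra unit `R`. -/
theorem mainLoop_exec (hπ : Function.Injective π) (hb : Bounds W B M k)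
    (hk1 : 1 ≤ k)
    (h : Rep π B M k A S Q s) (hi : Inv G π k A S Q O (s.arr 1))
    (ho : OldLast π (elim G π A) S O) {R : ℕ} (hR : 200 * s.reg 4 + 70 * k + 400 ≤ R)
    (h20 : s.reg 20 = 1) :
    ∃ t s' S' Q' O', Exec W G π mainLoop s t s' ∧ Rep π B M k A S' Q' s' ∧
      Inv G π k A S' Q' O' (s'.arr 1) ∧ Settled G π k S' Q' ∧
      t + R * potential (elim G π A) A S' Q' O' (s'.arr 1) ≤
        R * potential (elim G π A) A S Q O (s.arr 1) + R := by
  have hlt := hb.lt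
  generalize hp : potential (elim G π A) A S Q O (s.arr 1) = P
  induction P using Nat.strong_induction_on generalizing s S Q O with
  | _ P ih =>
    obtain ⟨t, s₁, S₁, Q₁, O₁, hx, h1, hi1, hreg, hcase⟩ := mainStep_progress hπ hb hk1 h hi ho hR h20
    have hfit : ∀ s₀ : State, s₀.reg 20 ≤ 1 → Test.Fits W s₀ (.eq (.reg 20) (.lit 1)) := by
      intro s₀ h0
      simp only [Test.Fits, Expr.Fits]; omega
    have hholds : Test.Holds G π s (.eq (.reg 20) (.lit 1)) := h20
    rw [hp] at hcase
    rcases hcase with ⟨g20, ho1, hle⟩ | ⟨g20, hset, hle⟩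
    -- Time is positive, so a round paid for by the potential must lower it strictly.
    · have hPlt : potential (elim G π A) A S₁ Q₁ O₁ (s₁.arr 1) < P := by
        by_contra hne
        have := Nat.mul_le_mul_left R (not_lt.1 hne)
        omega
      obtain ⟨t', s', S', Q', O', hx', h', hi', hs', hle'⟩ := ih _ hPlt h1 hi1 ho1
        (by rw [hreg 4 (by omega) (by omega)]; exact hR) g20 rfl
      refine ⟨_, s', S', Q', O', .while_true (hfit s (by omega)) hholds hx hx', h', hi', hs', ?_⟩
      simp only [Test.cost, Expr.cost]
      omega
    · refine ⟨_, s₁, S₁, Q₁, O₁, .while_true (hfit s (by omega)) hholds hx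
        (.while_false (hfit s₁ (by omega)) ?_), h1, hi1, hset, ?_⟩
      · simp [Test.Holds, Expr.eval, g20]
      · simp only [Test.cost, Expr.cost]
        omega

end Loop
end DynLFMIS

namespace DynLFMIS

/-! ### Insertion and deletion of a vertex -/

section Updates

variable {W B M k : ℕ} {G : SimpleGraph ℕ} {π : ℕ → unitInterval} {A S Q O : Finset ℕ} {s : State}

/-- Put a free slot into register 10, extending the tree if necessary. -/
def allocate : Program :=
  .ite (.lt (.lit 0) (.reg 5))
    (block [
      .assign 5 (.bin .sub (.reg 5) (.lit 1)),
      .assign 10 (.read 4 (.reg 5))])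
    (block [
      .ite (.lt (.reg 7) (.reg 6))
        (block [
          .assign 4 (.bin .add (.reg 4) (.lit 1)),
          .assign 7 (.bin .add (.bin .add (.reg 7) (.reg 7)) (.lit 1))])
        .skip,
      .assign 10 (.reg 6),
      .assign 6 (.bin .add (.reg 6) (.lit 1))])

/-- A new slot is opened only when none is free, so the number of slots never exceeds the largest
number of active vertices. Hence the height is logarithmic in that number, which the program does
not know, and not in the vertex names. -/
theorem allocate_halts (hb : Bounds W B M k) (h : Rep π B M k A S Q s) {v : ℕ} (hv : v ∉ A)
    (hM : A.card + 1 ≤ M) :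
    Halts W G π allocate s 40 fun s' =>
      s'.arr = s.arr ∧ (∀ r, r < 4 ∨ 10 < r → s'.reg r = s.reg r) ∧
      s.reg 4 ≤ s'.reg 4 ∧ s'.reg 4 ≤ s.reg 4 + 1 ∧
      SlotOK (insert v A) (Function.update (s.arr 3) v (s'.reg 10)) (s.arr 4) (s'.reg 5)
        (s'.reg 6) ∧
      s'.reg 6 ≤ M ∧ s'.reg 7 + 1 = 2 ^ s'.reg 4 ∧ s'.reg 6 ≤ 2 ^ s'.reg 4 ∧
      2 ^ s'.reg 4 ≤ 2 * M + 1 := by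
  have hlt := hb.lt
  have hA : ∀ a x, s.arr a x < W := fun a x => by have := h.arr_le a x; omega
  have hcap := hb.cap
  have h6 := h.slots_le
  have h4 := h.height_le' hb
  have h7 := h.height
  have hle := h.height_le
  have hroom := h.room
  have hcard := h.slots.card
  refine halts_ite ?_ (by decide) (fun hc => ?_) (fun hc => ?_)
  · simp only [Test.Fits, Expr.Fits]; omega
  · simp only [Test.Holds, Expr.eval] at hc
    refine halts_assign_cons ?_ (by decide) ?_
    · simp only [Expr.Fits, Expr.eval, BinOp.eval]; omega
    refine halts_assign ?_ (by decide) ?_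
    · simp only [Expr.Fits, Expr.eval, BinOp.eval, setReg_reg, setReg_arr, if_true]
      exact ⟨by omega, hA _ _⟩
    simp only [Expr.eval, BinOp.eval, setReg_reg, setReg_arr, if_true]
    simp only [Nat.reduceEqDiff, if_false]
    refine ⟨trivial, fun r hr => ?_, le_rfl, by omega, ?_, h6, h7, hroom, hle⟩
    · rw [if_neg (by omega), if_neg (by omega)]
    · have := h.slots
      obtain ⟨fc, hfc⟩ : ∃ fc, s.reg 5 = fc + 1 := ⟨s.reg 5 - 1, by omega⟩
      rw [hfc] at this
      rw [hfc, Nat.add_sub_cancel]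
      exact this.pop hv
  · simp only [Test.Holds, Expr.eval, not_lt, Nat.le_zero] at hc
    rw [hc] at hcard
    refine halts_cons 20 10 (Halts.mono (T := 20)
      (Q := fun s' => s'.arr = s.arr ∧ (∀ r, r ≠ 4 → r ≠ 7 → s'.reg r = s.reg r) ∧
        s.reg 4 ≤ s'.reg 4 ∧ s'.reg 4 ≤ s.reg 4 + 1 ∧ s'.reg 7 + 1 = 2 ^ s'.reg 4 ∧
        s.reg 6 + 1 ≤ 2 ^ s'.reg 4 ∧ 2 ^ s'.reg 4 ≤ 2 * M + 1)
      (halts_ite ?_ (by decide) (fun hc' => ?_) (fun hc' => ?_)) le_rfl ?_) (by decide)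
    · simp only [Test.Fits, Expr.Fits]; omega
    -- All leaves are taken, and the tree grows by one level.
    · simp only [Test.Holds, Expr.eval] at hc'
      refine halts_assign_cons ?_ (by decide) ?_
      · simp only [Expr.Fits, Expr.eval, BinOp.eval]; omega
      refine halts_assign ?_ (by decide) ?_
      · simp only [Expr.Fits, Expr.eval, BinOp.eval, setReg_reg, Nat.reduceEqDiff, if_false]; omega
      simp only [Expr.eval, BinOp.eval, setReg_reg, setReg_arr, if_true]
      simp only [Nat.reduceEqDiff, if_false]
      refine ⟨trivial, fun r h4 h7 => by rw [if_neg h7, if_neg h4], by omega, le_rfl, ?_, ?_, ?_⟩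
      all_goals rw [pow_succ]; omega
    · simp only [Test.Holds, Expr.eval] at hc'
      exact halts_skip (by decide) ⟨rfl, fun _ _ _ => rfl, le_rfl, by omega, h7, by omega, hle⟩
    · rintro s₁ ⟨g1, g2, g3, g4, g5, g6, g7⟩
      have e6 : s₁.reg 6 = s.reg 6 := g2 6 (by decide) (by decide)
      refine halts_assign_cons ?_ (by decide) ?_
      · simp only [Expr.Fits]; omega
      refine halts_assign ?_ (by decide) ?_
      · simp only [Expr.Fits, Expr.eval, BinOp.eval, setReg_reg, Nat.reduceEqDiff, if_false]; omega
      simp only [Expr.eval, BinOp.eval, setReg_reg, setReg_arr, if_true]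
      simp only [Nat.reduceEqDiff, if_false]
      refine ⟨g1, fun r hr => ?_, g3, g4, ?_, by omega, g5, by omega, g7⟩
      · rw [if_neg (by omega), if_neg (by omega)]
        exact g2 r (by omega) (by omega)
      · rw [e6, g2 5 (by decide) (by decide), hc]
        have := h.slots
        rw [hc] at this
        exact this.extend hv

/-- Insert the vertex in register 1. -/
def insertProgram : Program := block [
  allocate,
  .write 3 (.reg 1) (.reg 10),
  .write 1 (.reg 1) (.lit 0),
  .write 6 (.reg 1) (.lit 0),
  .assign 11 (.bin .add (.reg 1) (.lit 1)),
  treeUpdate]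

theorem insertProgram_halts (hb : Bounds W B M k) (h : Rep π B M k A S Q s)
    (hi : Inv G π k A S Q O (s.arr 1)) {v : ℕ} (hv : v ∉ A) (hvB : v < B) (h1 : s.reg 1 = v)
    (hM : A.card + 1 ≤ M) :
    Halts W G π insertProgram s (100 * s.reg 4 + 300) fun s' =>
      Rep π B M k (insert v A) S (insert v Q) s' ∧
        s'.arr 1 = Function.update (s.arr 1) v 0 ∧
        (∀ r, r < 4 ∨ 14 < r → s'.reg r = s.reg r) := by
  have hlt := hb.lt
  have hcap := hb.cap
  refine halts_cons 40 (100 * s.reg 4 + 260) ((allocate_halts hb h hv hM).mono le_rfl ?_) (by omega)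
  rintro s₁ ⟨ga, gr, g1, g2, gs, g6, g7, groom, gle⟩
  have e1 : s₁.reg 1 = v := (gr 1 (by omega)).trans h1
  have h10 : s₁.reg 10 < s₁.reg 6 := by
    have := gs.lt v (Finset.mem_insert_self _ _)
    rwa [Function.update_self] at this
  have g4B : s₁.reg 4 ≤ 2 * B := by
    have := Nat.lt_two_pow_self (n := s₁.reg 4)
    omega
  refine halts_write_cons ?_ ?_ ?_ ?_
  · simp only [Expr.Fits]; omega
  · simp only [Expr.Fits]; omega
  · simp only [Expr.cost]; omega
  simp only [Expr.eval, e1]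
  refine halts_write_cons ?_ ?_ ?_ ?_
  · simp only [Expr.Fits, setArr_reg]; omega
  · simp only [Expr.Fits]; omega
  · simp only [Expr.cost]; omega
  simp only [Expr.eval, setArr_reg, e1]
  refine halts_write_cons ?_ ?_ ?_ ?_
  · simp only [Expr.Fits, setArr_reg]; omega
  · simp only [Expr.Fits]; omega
  · simp only [Expr.cost]; omega
  simp only [Expr.eval, setArr_reg, e1]
  refine halts_assign_cons ?_ ?_ ?_
  · simp only [Expr.Fits, Expr.eval, BinOp.eval, setArr_reg]; omega
  · simp only [Expr.cost]; omega
  simp only [Expr.eval, BinOp.eval, setArr_reg, e1]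
  set s₂ := (((s₁.setArr 3 v (s₁.reg 10)).setArr 1 v 0).setArr 6 v 0).setReg 11 (v + 1) with hs₂
  have a3 : s₂.arr 3 = Function.update (s.arr 3) v (s₁.reg 10) := by simp [hs₂, setArr_arr, ga]
  have a1 : s₂.arr 1 = Function.update (s.arr 1) v 0 := by simp [hs₂, setArr_arr, ga]
  have a6 : s₂.arr 6 = Function.update (s.arr 6) v 0 := by simp [hs₂, setArr_arr, ga]
  have ao : ∀ a, a ≠ 3 → a ≠ 1 → a ≠ 6 → s₂.arr a = s.arr a := fun a h3 h1 h6 => by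
    simp [hs₂, setArr_arr, ga, h3, h1, h6]
  have er : ∀ r, r ≠ 11 → s₂.reg r = s₁.reg r := fun r hr => by simp [hs₂, hr]
  have hQA : ∀ q ∈ Q, q ≠ v := fun q hq e => hv (e ▸ hi.Q_sub hq)
  have harr₁ : ∀ a x, s₁.arr a x ≤ B := by rw [ga]; exact h.arr_le
  change Halts W G π treeUpdate s₂ _ _
  refine (treeUpdate_halts (s := s₂) (Q := insert v Q) (i := s₁.reg 10) (v := v + 1)
    (h := s₁.reg 4) hb.pos hb.word ?_ ?_ ?_ ?_ hvB ?_ g4B ?_ ?_ ?_).mono ?_ ?_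
  · exact setArr_arr_le (setArr_arr_le (setArr_arr_le harr₁ (by omega)) (by omega)) (by omega)
  · exact er 10 (by decide)
  · omega
  · simp [hs₂]
  · exact er 4 (by decide)
  · refine Or.inr ⟨v, Finset.mem_insert_self _ _, rfl, by simp [a3], fun q hq e => ?_⟩
    rw [a3] at e
    have hqv : q = v := gs.inj q (Finset.insert_subset_insert v hi.Q_sub hq) v
      (Finset.mem_insert_self _ _) (by rw [e, Function.update_self])
    rw [hqv]
  · intro j hj x hx
    rw [ao 2 (by decide) (by decide) (by decide), a3]
    by_cases hjh : j ≤ s.reg 4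
    · refine (h.tree.node j hjh x).congr rfl fun q => ?_
      rw [Finset.mem_insert]
      constructor
      · rintro ⟨h1, h2⟩
        rw [Function.update_of_ne (hQA q h1)]
        exact ⟨Or.inr h1, h2⟩
      · rintro ⟨rfl | h1, h2⟩
        · rw [Function.update_self] at h2
          exact absurd h2.symm hx
        · rw [Function.update_of_ne (hQA q h1)] at h2
          exact ⟨h1, h2⟩
    · have hj' : j = s₁.reg 4 := by omega
      refine Or.inl ⟨h.tree.above j (by omega) x, fun q hq e => hx ?_⟩
      have h2 := gs.lt q (Finset.insert_subset_insert v hi.Q_sub hq)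
      rw [Nat.div_eq_of_lt (by rw [hj']; omega)] at e
      rw [Nat.div_eq_of_lt (by rw [hj']; omega), e]
  · intro j hj x
    rw [ao 2 (by decide) (by decide) (by decide)]
    exact h.tree.above j (by omega) x
  · simp only [Expr.cost]; omega
  · rintro s₃ ⟨f1, f2, f3, f4⟩
    have er3 : ∀ r, r < 10 ∨ 14 < r → s₃.reg r = s₁.reg r := fun r hr =>
      (f1 r hr).trans (er r (by omega))
    refine ⟨⟨f3, ?_, ?_, ?_, ?_, ?_, ?_, ?_, ?_, ?_, ?_⟩, ?_, ?_⟩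
    · intro u hu
      rcases Finset.mem_insert.1 hu with rfl | hu
      · exact hvB
      · exact h.A_lt u hu
    · rw [er3 0 (by omega), gr 0 (by omega)]; exact h.reg_k
    · rw [f2 0 (by decide), ao 0 (by decide) (by decide) (by decide), er3 3 (by omega),
        gr 3 (by omega)]
      exact h.out
    · rw [f2 3 (by decide), er3 4 (by omega)]; exact f4
    · rw [f2 3 (by decide), f2 4 (by decide), a3, ao 4 (by decide) (by decide) (by decide),
        er3 5 (by omega), er3 6 (by omega)]
      exact gs
    · rw [er3 6 (by omega)]; exact g6
    · rw [er3 7 (by omega), er3 4 (by omega)]; exact g7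
    · rw [er3 6 (by omega), er3 4 (by omega)]; exact groom
    · rw [er3 4 (by omega)]; exact gle
    · rw [f2 1 (by decide), f2 5 (by decide), f2 6 (by decide), f2 7 (by decide), a1, a6,
        ao 5 (by decide) (by decide) (by decide), ao 7 (by decide) (by decide) (by decide)]
      refine h.fol.insert hv fun u hu e => ?_
      -- Leaders are active, so no active vertex can already follow the new vertex.
      by_cases hS : u ∈ S
      · have := hi.ld_S u hS; omega
      by_cases hQ : u ∈ Q
      · have := hi.ld_Q u hQ; omega
      obtain ⟨w, h2, h3, -⟩ := hi.ld_F u hu hS hQ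
      obtain rfl : w = v := by omega
      exact hv (h3.elim (fun h' => hi.S_sub h') fun h' => hi.Q_sub h')
    · rw [f2 1 (by decide), a1]
    · exact fun r hr => (er3 r (by omega)).trans (gr r (by omega))

/-- If the vertex in register 1 is a follower, move it to the queue. -/
def detach : Program :=
  .ite (.eq (.read 1 (.reg 1)) (.lit 0)) .skip
    (block [
      .assign 15 (.bin .sub (.read 1 (.reg 1)) (.lit 1)),
      .assign 16 (.bin .sub (.read 6 (.reg 15)) (.lit 1)),
      .assign 17 (.read 5 (pairExpr (.reg 15) (.reg 16))),
      .assign 18 (.read 7 (.reg 1)),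
      .write 5 (pairExpr (.reg 15) (.reg 18)) (.reg 17),
      .write 7 (.reg 17) (.reg 18),
      .write 6 (.reg 15) (.reg 16),
      .write 1 (.reg 1) (.lit 0),
      .assign 16 (.reg 1),
      queueInsert])

/-- The last follower of the leader of `v` takes the place of `v` in the list, which needs no
search. A follower weighs at least 1 and a new queue vertex 4, whence the loss of at most 3. -/
theorem detach_halts (hb : Bounds W B M k) (h : Rep π B M k A S Q s)
    (hi : Inv G π k A S Q O (s.arr 1)) {e : ℕ → ℕ} {v : ℕ} (hv : v ∈ A) (h1 : s.reg 1 = v) :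
    Halts W G π detach s (100 * s.reg 4 + 220) fun s' => ∃ Q',
      Rep π B M k A S Q' s' ∧ Inv G π k A S Q' O (s'.arr 1) ∧ s'.arr 1 v = 0 ∧
        s'.arr 6 v = s.arr 6 v ∧
        potential e A S Q' O (s'.arr 1) ≤ potential e A S Q O (s.arr 1) + 3 ∧
        (∀ r, r < 10 ∨ 18 < r → s'.reg r = s.reg r) := by
  have hlt := hb.lt
  have hA : ∀ a x, s.arr a x < W := fun a x => by have := h.arr_le a x; omega
  have hvB := h.A_lt v hv
  refine halts_ite ?_ (by simp only [Test.cost, Expr.cost]; omega) (fun hc => ?_) (fun hc => ?_)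
  · simp only [Test.Fits, Expr.Fits, Expr.eval]
    exact ⟨⟨by omega, hA _ _⟩, by omega⟩
  · simp only [Test.Holds, Expr.eval, h1] at hc
    exact halts_skip (by simp only [Test.cost, Expr.cost]; omega)
      ⟨Q, h, hi, hc, rfl, Nat.le_add_right _ _, fun _ _ => rfl⟩
  · simp only [Test.Holds, Expr.eval, h1] at hc
    obtain ⟨w, hw⟩ : ∃ w, s.arr 1 v = w + 1 := ⟨s.arr 1 v - 1, by omega⟩
    have hvS : v ∉ S := fun h' => hc (hi.ld_S v h')
    have hvQ : v ∉ Q := fun h' => hc (hi.ld_Q v h')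
    obtain ⟨w', hw', hwm, -⟩ := hi.ld_F v hv hvS hvQ
    obtain rfl : w' = w := by omega
    have hwA : w' ∈ A := hwm.elim (fun h' => hi.S_sub h') fun h' => hi.Q_sub h'
    have hwv : v ≠ w' := fun e => hwm.elim (fun h' => hvS (e ▸ h')) fun h' => hvQ (e ▸ h')
    generalize w' = w at *
    have hwB := h.A_lt w hwA
    obtain ⟨p1, p2⟩ := h.fol.pos v hv w hw
    obtain ⟨c, hcw⟩ : ∃ c, s.arr 6 w = c + 1 := ⟨s.arr 6 w - 1, by omega⟩
    have hcB : c + 1 ≤ B := hcw ▸ h.arr_le 6 w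
    obtain ⟨l1, -, -⟩ := h.fol.list w hwA c (by omega)
    have hfol := h.fol.remove hwA hv hw hcw
    set x := s.arr 5 (pair w c) with hx
    set p := s.arr 7 v with hp
    have hxB := h.A_lt x l1
    have hpB : p ≤ B := h.arr_le 7 v
    refine halts_assign_cons ?_ ?_ ?_
    · simp only [Expr.Fits, Expr.eval, BinOp.eval, h1, hw]
      have := hA 1 v
      omega
    · simp [Test.cost, Expr.cost]
    simp only [Expr.eval, BinOp.eval, h1, hw, Nat.add_sub_cancel]
    refine halts_assign_cons ?_ ?_ ?_
    · simp [Expr.Fits, Expr.eval, BinOp.eval, hcw]; omega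
    · simp [Test.cost, Expr.cost]
    simp only [Expr.eval, BinOp.eval, setReg_reg, setReg_arr, if_true, hcw, Nat.add_sub_cancel]
    refine halts_assign_cons ?_ ?_ ?_
    · refine ⟨pairExpr_fits hb.pos hb.word ?_ ?_ ?_ ?_, ?_⟩ <;>
        simp [Expr.Fits, Expr.eval, hA] <;> omega
    · simp [Test.cost, Expr.cost, pairExpr]
    simp only [Expr.eval, pairExpr_eval, setReg_reg, setReg_arr, if_true]
    simp only [Nat.reduceEqDiff, if_false, ← hx]
    refine halts_assign_cons ?_ ?_ ?_
    · simp [Expr.Fits, Expr.eval, hA, h1]; omega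
    · simp [Test.cost, Expr.cost, pairExpr]
    simp only [Expr.eval, setReg_reg, setReg_arr]
    simp only [Nat.reduceEqDiff, if_false, h1, ← hp]
    refine halts_write_cons ?_ ?_ ?_ ?_
    · refine pairExpr_fits hb.pos hb.word ?_ ?_ ?_ ?_ <;> simp [Expr.Fits, Expr.eval] <;> omega
    · simp [Expr.Fits]; omega
    · simp [Test.cost, Expr.cost, pairExpr]
    simp only [Expr.eval, pairExpr_eval, setReg_reg]
    simp only [Nat.reduceEqDiff, if_false, if_true]
    refine halts_write_cons ?_ ?_ ?_ ?_
    · simp [Expr.Fits]; omega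
    · simp [Expr.Fits]; omega
    · simp [Test.cost, Expr.cost, pairExpr]
    simp only [Expr.eval, setReg_reg, setArr_reg]
    simp only [Nat.reduceEqDiff, if_false, if_true]
    refine halts_write_cons ?_ ?_ ?_ ?_
    · simp [Expr.Fits]; omega
    · simp [Expr.Fits]; omega
    · simp [Test.cost, Expr.cost, pairExpr]
    simp only [Expr.eval, setReg_reg, setArr_reg]
    simp only [Nat.reduceEqDiff, if_false, if_true]
    refine halts_write_cons ?_ ?_ ?_ ?_
    · simp [Expr.Fits, h1]; omega
    · simp [Expr.Fits]; omega
    · simp [Test.cost, Expr.cost, pairExpr]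
    simp only [Expr.eval, setReg_reg, setArr_reg]
    simp only [Nat.reduceEqDiff, if_false, h1]
    refine halts_assign_cons ?_ ?_ ?_
    · simp [Expr.Fits, h1]; omega
    · simp [Test.cost, Expr.cost, pairExpr]
    simp only [Expr.eval, setReg_reg, setArr_reg]
    simp only [Nat.reduceEqDiff, if_false, h1]
    set s₁ := (((((((((s.setReg 15 w).setReg 16 c).setReg 17 x).setReg 18 p).setArr 5
      (pair w p) x).setArr 7 x p).setArr 6 w c).setArr 1 v 0).setReg 16 v) with hs₁
    have a1 : s₁.arr 1 = Function.update (s.arr 1) v 0 := by simp [hs₁, setArr_arr]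
    have a5 : s₁.arr 5 = Function.update (s.arr 5) (pair w p) x := by simp [hs₁, setArr_arr]
    have a6 : s₁.arr 6 = Function.update (s.arr 6) w c := by simp [hs₁, setArr_arr]
    have a7 : s₁.arr 7 = Function.update (s.arr 7) x p := by simp [hs₁, setArr_arr]
    have er : ∀ r, r < 10 ∨ 18 < r → s₁.reg r = s.reg r := fun r hr => by
      simp only [hs₁, setReg_reg, setArr_reg]
      iterate 5 rw [if_neg (by omega)]
    have h2 : Rep π B M k A S Q s₁ := by
      refine h.update (fun r hr => er r (by omega)) (by simp [hs₁, setArr_arr])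
        (by simp [hs₁, setArr_arr]) ?_ ?_ ?_ ?_
      · exact setArr_arr_le (setArr_arr_le (setArr_arr_le (setArr_arr_le h.arr_le (by omega))
          (by omega)) (by omega)) (by omega)
      · rw [er 3 (by omega)]; simpa [hs₁, setArr_arr] using h.out
      · simpa [hs₁, setArr_arr] using h.tree
      · rw [a1, a5, a6, a7]; exact hfol
    have hi2 := hi.release hv hw
    change Halts W G π queueInsert s₁ _ _
    refine (queueInsert_rep (s := s₁) (u := v) hb h2 hi.Q_sub (by simp [hs₁]) hv).mono ?_ ?_
    · simp only [er 4 (by omega), Test.cost, Expr.cost, pairExpr]; omega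
    · rintro s₂ ⟨h3, er2, ea⟩
      refine ⟨insert v Q, h3, ?_, ?_, ?_, ?_, fun r hr => (er2 r (by omega)).trans (er r hr)⟩
      · rw [ea 1 (by decide), a1]; exact hi2
      · rw [ea 1 (by decide), a1, Function.update_self]
      · rw [ea 6 (by decide), a6, Function.update_of_ne hwv]
      · rw [ea 1 (by decide), a1]
        refine potential_change (a := 0) hv (fun y _ hy => ?_) ?_
        · simp [hy]
        · have h1 : v ∉ O := fun h' => hvQ (hi.O_sub h')
          have := weight_pos e S Q O (s.arr 1) v
          simp only [weight, hvS, h1, if_false, Finset.mem_insert_self, if_true] at this ⊢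
          split_ifs at this ⊢ <;> omega

/-- Remove the vertex in register 1 from the current set. -/
def outErase : Program := block [
  .assign 15 (.lit 0),
  .while (.not (.eq (.read 0 (.reg 15)) (.reg 1))) (.assign 15 (.bin .add (.reg 15) (.lit 1))),
  .assign 3 (.bin .sub (.reg 3) (.lit 1)),
  .write 0 (.reg 15) (.read 0 (.reg 3))]

theorem outErase_halts (hb : Bounds W B M k) (h : Rep π B M k A S Q s) (hk : S.card ≤ k)
    (hSA : S ⊆ A) {v : ℕ} (hv : v ∈ S) (h1 : s.reg 1 = v) :
    Halts W G π outErase s (20 * k + 40) fun s' => Rep π B M k A (S.erase v) Q s' ∧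
      s'.arr 1 = s.arr 1 ∧ (∀ r, r ≠ 3 → r ≠ 15 → s'.reg r = s.reg r) := by
  have hlt := hb.lt
  have hkB := hb.k_le
  have hA : ∀ a x, s.arr a x < W := fun a x => by have := h.arr_le a x; omega
  have hvB := h.A_lt v (hSA hv)
  have hn : s.reg 3 ≤ k := by rw [← h.out.1]; exact hk
  obtain ⟨m, hm, hmv⟩ := h.out.exists_index hv
  refine halts_assign_cons ?_ ?_ ?_
  · simp only [Expr.Fits]; omega
  · simp only [Expr.cost]; omega
  simp only [Expr.eval]
  refine halts_cons (20 * m + 10) 20 ((halts_while (fun n s₁ => ∃ i ≤ m, n = 20 * (m - i) + 10 ∧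
    s₁ = s.setReg 15 i) ?_ ?_ (Q := fun s₁ => s₁ = s.setReg 15 m) ?_
    ⟨0, by omega, rfl, rfl⟩).mono le_rfl ?_) ?_
  · rintro n s₁ ⟨i, hi, -, rfl⟩
    simp [Test.Fits, Expr.Fits, Expr.eval, hA, h1]
    omega
  · rintro n s₁ ⟨i, hi, rfl, rfl⟩ hc
    simp only [Test.Holds, Expr.eval, setReg_reg, setReg_arr, if_true] at hc
    simp only [Nat.reduceEqDiff, if_false, h1] at hc
    have him : i ≠ m := fun e => hc (e ▸ hmv)
    refine ⟨4, 20 * (m - (i + 1)) + 10, ?_, halts_assign ?_ (by decide) ⟨i + 1, by omega, rfl, ?_⟩⟩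
    · simp only [Test.cost, Expr.cost]; omega
    · simp [Expr.Fits, Expr.eval, BinOp.eval]; omega
    · simp [State.setReg, Expr.eval, BinOp.eval]
  · rintro n s₁ ⟨i, hi, rfl, rfl⟩ hc
    simp only [Test.Holds, Expr.eval, setReg_reg, setReg_arr, if_true, not_not] at hc
    simp only [Nat.reduceEqDiff, if_false, h1] at hc
    -- The entries are distinct, so the search ends at the index of `v`; its cost is linear in `k`,
    -- within the price of one unit up to a constant.
    obtain rfl : i = m := h.out.injOn (by omega) hm (hc.trans hmv.symm)
    exact ⟨by simp only [Test.cost, Expr.cost]; omega, rfl⟩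
  · rintro s₁ rfl
    refine halts_assign_cons ?_ (by decide) ?_
    · simp [Expr.Fits, Expr.eval, BinOp.eval]; omega
    refine halts_write ?_ ?_ (by decide) ?_
    · simp [Expr.Fits]; omega
    · simp [Expr.Fits, Expr.eval, BinOp.eval, hA]; omega
    simp only [Expr.eval, BinOp.eval, setReg_reg, setReg_arr, if_true]
    simp only [Nat.reduceEqDiff, if_false]
    refine ⟨h.update ?_ (by simp [setArr_arr]) (by simp [setArr_arr]) ?_ ?_ ?_ ?_, ?_, ?_⟩
    · intro r hr
      simp only [setArr_reg, setReg_reg]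
      rw [if_neg (by omega), if_neg (by omega)]
    · exact setArr_arr_le h.arr_le (h.arr_le _ _)
    · have := h.out.swapLast hm
      rw [hmv] at this
      simpa [setArr_arr] using this
    · simpa [setArr_arr] using h.tree
    · simpa [setArr_arr] using h.fol
    · simp [setArr_arr]
    · intro r h3 h15
      simp [h3, h15]
  · simp only [Expr.cost]; omega

/-- Free the slot of the vertex in register 1. -/
def freeSlot : Program := block [
  .write 4 (.reg 5) (.read 3 (.reg 1)),
  .assign 5 (.bin .add (.reg 5) (.lit 1))]

theorem freeSlot_halts (hb : Bounds W B M k) (h : Rep π B M k A S Q s) {v : ℕ} (hv : v ∈ A)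
    (h1 : s.reg 1 = v) (h0 : s.arr 1 v = 0) :
    Halts W G π freeSlot s 20 fun s' => Rep π B M k (A.erase v) S Q s' ∧
      s'.arr 1 = s.arr 1 ∧ (∀ r, r ≠ 5 → s'.reg r = s.reg r) := by
  have hlt := hb.lt
  have hcap := hb.cap
  have hA : ∀ a x, s.arr a x < W := fun a x => by have := h.arr_le a x; omega
  have hvB := h.A_lt v hv
  have h5 : s.reg 5 < B := by
    have h1 := h.slots.card
    have h2 := h.slots_le
    omega
  refine halts_write_cons ?_ ?_ (by decide) ?_
  · simp only [Expr.Fits]; omega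
  · exact ⟨by simp only [Expr.Fits]; omega, hA _ _⟩
  refine halts_assign ?_ (by decide) ?_
  · simp only [Expr.Fits, Expr.eval, BinOp.eval, setArr_reg]; omega
  simp only [Expr.eval, BinOp.eval, setArr_reg, h1]
  have er : ∀ r, r ≠ 5 → ((s.setArr 4 (s.reg 5) (s.arr 3 v)).setReg 5 (s.reg 5 + 1)).reg r =
      s.reg r := fun r hr => by simp [hr]
  have ea : ∀ a, a ≠ 4 → ((s.setArr 4 (s.reg 5) (s.arr 3 v)).setReg 5 (s.reg 5 + 1)).arr a =
      s.arr a := fun a ha => by simp [setArr_arr, ha]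
  refine ⟨⟨setArr_arr_le h.arr_le (h.arr_le _ _), fun u hu => h.A_lt u (Finset.mem_of_mem_erase hu),
    ?_, ?_, ?_, ?_, ?_, ?_, ?_, ?_, ?_⟩, ea 1 (by decide), er⟩
  · rw [er 0 (by decide)]; exact h.reg_k
  · rw [er 3 (by decide), ea 0 (by decide)]; exact h.out
  · rw [er 4 (by decide), ea 2 (by decide), ea 3 (by decide)]; exact h.tree
  · rw [er 6 (by decide), ea 3 (by decide)]
    simpa using h.slots.release hv
  · rw [er 6 (by decide)]; exact h.slots_le
  · rw [er 7 (by decide), er 4 (by decide)]; exact h.height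
  · rw [er 6 (by decide), er 4 (by decide)]; exact h.room
  · rw [er 4 (by decide)]; exact h.height_le
  · rw [ea 1 (by decide), ea 5 (by decide), ea 6 (by decide), ea 7 (by decide)]
    exact h.fol.erase h0

/-- Remove the vertex in register 1 from the queue or from the current set. -/
def removeVertex : Program :=
  .ite (.eq (.read 2 (pairExpr (.lit 0) (.read 3 (.reg 1)))) (.bin .add (.reg 1) (.lit 1)))
    (block [.assign 16 (.reg 1), queueErase]) outErase

theorem removeVertex_halts (hb : Bounds W B M k) (h : Rep π B M k A S Q s)
    (hi : Inv G π k A S Q O (s.arr 1)) {v : ℕ} (hv : v ∈ A) (h1 : s.reg 1 = v)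
    (h0 : s.arr 1 v = 0) :
    Halts W G π removeVertex s (100 * s.reg 4 + 20 * k + 200) fun s' =>
      Rep π B M k A (S.erase v) (Q.erase v) s' ∧ s'.arr 1 = s.arr 1 ∧
        (∀ r, r ≠ 3 → r < 10 ∨ 18 < r → s'.reg r = s.reg r) := by
  have hlt := hb.lt
  have hA : ∀ a x, s.arr a x < W := fun a x => by have := h.arr_le a x; omega
  have hvB := h.A_lt v hv
  -- Membership in the queue can be read off the leaf of `v`, which no other active vertex shares.
  have hleaf : s.arr 2 (pair 0 (s.arr 3 v)) = v + 1 ↔ v ∈ Q := by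
    have hinj : ∀ q ∈ Q, s.arr 3 q = s.arr 3 v → q = v := fun q hq =>
      h.slots.inj q (hi.Q_sub hq) v hv
    rcases h.tree.node 0 (Nat.zero_le _) (s.arr 3 v) with ⟨g1, g2⟩ | ⟨q, hq, g1, g2, -⟩
    · simp only [pow_zero, Nat.div_one] at g2
      exact ⟨fun e => by omega, fun hvQ => absurd rfl (g2 v hvQ)⟩
    · simp only [pow_zero, Nat.div_one] at g2
      obtain rfl := hinj q hq g2
      exact ⟨fun _ => hq, fun _ => g1⟩
  refine halts_ite ?_ ?_ (fun hc => ?_) (fun hc => ?_)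
  · refine ⟨⟨pairExpr_fits hb.pos hb.word ?_ ?_ ?_ ?_, hA _ _⟩, ?_⟩
    · simp only [Expr.Fits]; omega
    · exact ⟨by simp only [Expr.Fits]; omega, hA _ _⟩
    · simp [Expr.eval]
    · have := h.arr_le 3 (s.reg 1)
      simp only [Expr.eval]; omega
    · simp only [Expr.Fits, Expr.eval, BinOp.eval]; omega
  · simp only [Test.cost, Expr.cost, pairExpr]; omega
  · simp only [Test.Holds, Expr.eval, BinOp.eval, pairExpr_eval, h1] at hc
    have hvQ := hleaf.1 hc
    have hvS : v ∉ S := fun h' => hi.disj v h' hvQ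
    rw [Finset.erase_eq_of_notMem hvS]
    refine halts_assign_cons ?_ ?_ ?_
    · simp only [Expr.Fits]; omega
    · simp only [Test.cost, Expr.cost, pairExpr]; omega
    simp only [Expr.eval, h1]
    refine (queueErase_rep (s := s.setReg 16 v) (u := v) hb (h.setReg (by decide)) hi.Q_sub
      (by simp) hv).mono ?_ ?_
    · simp [Test.cost, Expr.cost, pairExpr]; omega
    · rintro s' ⟨g1, g2, g3⟩
      refine ⟨g1, g3 1 (by decide), fun r _ hr => ?_⟩
      rw [g2 r (by omega), setReg_reg, if_neg (by omega)]
  · simp only [Test.Holds, Expr.eval, BinOp.eval, pairExpr_eval, h1] at hc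
    have hvQ : v ∉ Q := fun h' => hc (hleaf.2 h')
    have hvS : v ∈ S := by
      by_contra hvS
      obtain ⟨w, hw, -⟩ := hi.ld_F v hv hvS hvQ
      omega
    rw [Finset.erase_eq_of_notMem hvQ]
    refine (outErase_halts hb h hi.card_le hi.S_sub hvS h1).mono ?_ ?_
    · simp only [Test.cost, Expr.cost, pairExpr]; omega
    · rintro s' ⟨g1, g2, g3⟩
      exact ⟨g1, g2, fun r h3 hr => g3 r h3 (by omega)⟩

/-- Delete the vertex in register 1. -/
def deleteProgram : Program := block [
  detach,
  .assign 15 (.reg 1),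
  releaseAll,
  removeVertex,
  freeSlot]

/-- The potential is taken with respect to eliminators for which `v` eliminates no other vertex, as
is the case after the deletion. The followers of `v` are then all wrongly led, so their release is
paid for, however many they are. -/
theorem deleteProgram_halts (hb : Bounds W B M k) (h : Rep π B M k A S Q s)
    (hi : Inv G π k A S Q O (s.arr 1)) {e : ℕ → ℕ} {v : ℕ} (hv : v ∈ A) (h1 : s.reg 1 = v)
    (he : ∀ u ∈ A, u ≠ v → e u ≠ v) :
    ∃ c, Halts W G π deleteProgram s ((100 * s.reg 4 + 150) * c + 200 * s.reg 4 + 20 * k + 500)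
      fun s' => ∃ Q', Rep π B M k (A.erase v) (S.erase v) Q' s' ∧
        Inv G π k (A.erase v) (S.erase v) Q' (O.erase v) (s'.arr 1) ∧
        potential e (A.erase v) (S.erase v) Q' (O.erase v) (s'.arr 1) + c ≤
          potential e A S Q O (s.arr 1) + 3 ∧
        (∀ r, r ≠ 3 → r ≠ 5 → r < 10 ∨ 18 < r → s'.reg r = s.reg r) := by
  have hlt := hb.lt
  have hvB := h.A_lt v hv
  refine ⟨s.arr 6 v, ?_⟩
  refine halts_cons (100 * s.reg 4 + 220)
    ((100 * s.reg 4 + 150) * s.arr 6 v + 100 * s.reg 4 + 20 * k + 280)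
    ((detach_halts (e := e) hb h hi hv h1).mono le_rfl ?_) (by omega)
  rintro s₁ ⟨Q₁, g1, gi, g0, g6, gp, gr⟩
  refine halts_assign_cons ?_ ?_ ?_
  · simp only [Expr.Fits, gr 1 (by omega)]; omega
  · simp only [Expr.cost]; omega
  simp only [Expr.eval, gr 1 (by omega), h1]
  refine halts_cons ((100 * s.reg 4 + 150) * s.arr 6 v + 10) (100 * s.reg 4 + 20 * k + 220)
    ((releaseAll_halts (e := e) (s := s₁.setReg 15 v) (c := s.arr 6 v) hb (g1.setReg (by decide))
      gi hv (by simp) (by simpa using g6) fun u hu hu' => he u hu ?_).mono ?_ ?_) ?_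
  · rintro rfl
    simp only [setReg_arr] at hu'
    omega
  · simp [gr 4 (by omega)]
  · rintro s₂ ⟨Q₂, -, h2, hi2, hF, hz, hp, -, hr2, -⟩
    have er2 : ∀ r, r < 10 ∨ 18 < r → s₂.reg r = s.reg r := fun r hr => by
      rw [hr2 r (by omega), setReg_reg, if_neg (by omega), gr r hr]
    have z2 : s₂.arr 1 v = 0 := hz v g0
    refine halts_cons (100 * s.reg 4 + 20 * k + 200) 20 ((removeVertex_halts hb h2 hi2 hv
      ((er2 1 (by omega)).trans h1) z2).mono (by rw [er2 4 (by omega)]) ?_) (by omega)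
    rintro s₃ ⟨h3, e3, hr3⟩
    refine (freeSlot_halts hb h3 hv ((hr3 1 (by omega) (by omega)).trans ((er2 1 (by omega)).trans h1))
      (by rw [e3]; exact z2)).mono le_rfl ?_
    rintro s₄ ⟨h4, e4, hr4⟩
    refine ⟨Q₂.erase v, h4, ?_, ?_, fun r h3 h5 hr => ?_⟩
    · rw [e4, e3]; exact hi2.delete hF
    · rw [e4, e3]
      have := potential_delete (e := e) (A := A) (S := S) (Q := Q₂) (O := O) (ld := s₂.arr 1) v
      simp only [setReg_arr] at hp
      omega
    · rw [hr4 r h5, hr3 r h3 hr, er2 r hr]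
  · simp only [Expr.cost]; omega

end Updates
end DynLFMIS

namespace DynLFMIS

/-! ### Streams of updates and the expected total work -/

section Stream

variable {W B M k : ℕ} {G : SimpleGraph ℕ} {π : ℕ → unitInterval} {A S Q O : Finset ℕ} {s : State}

/-- The algorithm. -/
def dynamicProgram : Program := block [
  .assign 20 (.lit 1),
  .ite (.eq (.reg 2) (.lit 1)) insertProgram deleteProgram,
  mainLoop]

/-- The memory holds a configuration of potential `P` that waits for the next update. -/
def Waiting (G : SimpleGraph ℕ) (π : ℕ → unitInterval) (B M k : ℕ) (A : Finset ℕ) (s : State)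
    (P : ℕ) : Prop :=
  ∃ S Q O, Rep π B M k A S Q s ∧ Inv G π k A S Q O (s.arr 1) ∧ Settled G π k S Q ∧
    potential (elim G π A) A S Q O (s.arr 1) = P

theorem waiting_init (G : SimpleGraph ℕ) (π : ℕ → unitInterval) (B M k : ℕ) :
    Waiting G π B M k ∅ (initState k) 0 := by
  refine ⟨∅, ∅, ∅, ?_, ?_, Or.inl rfl, rfl⟩
  · constructor <;> simp [initState, Lists]
    · exact ⟨fun j _ i => Or.inl ⟨rfl, by simp⟩, fun j _ i => rfl⟩
    · constructor <;> simp
    · constructor <;> simp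
  · constructor <;> simp

theorem Waiting.maintains {P : ℕ} (h : Waiting G π B M k A s P) (hπ : Function.Injective π) :
    Maintains G π A k s := by
  obtain ⟨S, Q, O, hr, hi, hs, -⟩ := h
  have hS : s.outSet = S := hr.out.2
  refine ⟨by rw [hS, hr.out.1], hS ▸ hi.isTop_of_settled hπ hs ?_ ?_⟩
  · intro u hu
    simp [State.leader, hu]
  · intro u w hu
    simp [State.leader, hu]

-- One inequality for insertions and deletions, which differ in which of the eliminator maps is the
-- old one. The extra 1 accounts for `v` itself, about which `changes` says nothing.
open Classical in
theorem potential_elim_insert (hπ : Function.Injective π) {v : ℕ} (hv : v ∉ A)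
    {e e' : ℕ → ℕ} (he : e = elim G π A ∧ e' = elim G π (insert v A) ∨
      e = elim G π (insert v A) ∧ e' = elim G π A) {ld : ℕ → ℕ} :
    potential e' (insert v A) S Q O ld ≤
      potential e (insert v A) S Q O ld + 6 * (changes π G A v + 1) := by
  refine potential_le_of_elim.trans (Nat.add_le_add_left (Nat.mul_le_mul_left 6 ?_) _)
  rw [Finset.filter_insert]
  have key : (A.filter fun u => e u ≠ e' u).card ≤ changes π G A v := by
    have := card_elim_ne_le_changes (G := G) hπ hv
    rcases he with ⟨rfl, rfl⟩ | ⟨rfl, rfl⟩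
    · exact this
    · refine le_trans (Finset.card_le_card fun u hu => ?_) this
      rw [Finset.mem_filter] at hu ⊢
      exact ⟨hu.1, hu.2.symm⟩
  split_ifs
  · exact (Finset.card_insert_le _ _).trans (by omega)
  · omega

/-- The rest of the memory after loading an update. -/
theorem Rep.load (h : Rep π B M k A S Q s) (x y : ℕ) :
    Rep π B M k A S Q (((s.setReg 1 x).setReg 2 y).setReg 20 1) := by
  refine h.update (fun r' hr' => ?_) rfl rfl h.arr_le ?_ h.tree h.fol
  · simp only [setReg_reg]
    rw [if_neg (by omega), if_neg (by omega), if_neg (by omega)]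
  · simpa using h.out

/-- The update `u` is possible when `A` is the set of active vertices. -/
def Update.Valid (A : Finset ℕ) : Update → Prop
  | .ins v => v ∉ A
  | .del v => v ∈ A

theorem validFrom_cons {u : Update} {L : List Update} :
    ValidFrom A (u :: L) ↔ u.Valid A ∧ ValidFrom (u.apply A) L := by
  cases u <;> rfl

/-- The constant 20 covers the update itself (two units), the final round of the loop (one), the
weight of the inserted or detached vertex (at most four) and the possible change of the eliminator
of the updated vertex (six). -/
theorem dynamicProgram_exec (hπ : Function.Injective π) (hb : Bounds W B M k) (hk : 1 ≤ k)
    {R : ℕ} (hR : ∀ h, 2 ^ h ≤ 2 * M + 1 → 200 * h + 70 * k + 400 ≤ R) {P : ℕ}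
    (h : Waiting G π B M k A s P) {u : Update} (hu : u.Valid A) (huB : u.vertex < B)
    (hM : (u.apply A).card ≤ M) :
    ∃ t s' P', Exec W G π dynamicProgram (u.load s) t s' ∧
      Waiting G π B M k (u.apply A) s' P' ∧
      t + R * P' ≤
        R * P + R * (6 * changes π G (A.erase u.vertex) u.vertex + 20) := by
  obtain ⟨S, Q, O, hr, hi, hs, rfl⟩ := h
  have hlt := hb.lt
  have hh : 200 * s.reg 4 + 70 * k + 400 ≤ R := hR _ hr.height_le
  cases u with
  | ins v =>
    have hv : v ∉ A := hu
    replace huB : v < B := huB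
    simp only [Update.vertex, Update.apply] at hM ⊢
    rw [Finset.erase_eq_of_notMem hv]
    rw [Finset.card_insert_of_notMem hv] at hM
    set s₁ := (((s.setReg 1 v).setReg 2 1).setReg 20 1) with hs₁
    have e4 : s₁.reg 4 = s.reg 4 := by simp [hs₁]
    obtain ⟨t₁, s₂, hx₁, ht₁, h2, e2, r2⟩ := insertProgram_halts (G := G) (s := s₁) hb (hr.load v 1) hi hv huB
      (by simp [hs₁]) hM
    have hi2 : Inv G π k (insert v A) S (insert v Q) O (s₂.arr 1) := by
      rw [e2]; exact hi.insert hv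
    have ho2 : OldLast π (elim G π (insert v A)) S O := hs.oldLast hi.O_sub _
    obtain ⟨t₂, s', S', Q', O', hx₂, h', hi', hs', hle⟩ := mainLoop_exec hπ hb hk h2 hi2 ho2
      (hR _ h2.height_le) ((r2 20 (by omega)).trans (by simp [hs₁]))
    refine ⟨_, s', _, .seq (.assign _ _ _ ?_) (.seq (.ite_true ?_ ?_ hx₁) hx₂),
      ⟨S', Q', O', h', hi', hs', rfl⟩, ?_⟩
    · simp only [Expr.Fits]; omega
    · simp [Test.Fits, Expr.Fits, Update.load]; omega
    · simp [Test.Holds, Expr.eval, Update.load]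
    -- Insertion: the vertex is added under the old eliminators, and these are exchanged afterwards.
    · have p1 := hi.potential_insert (e := elim G π A) hv
      have p2 : potential (elim G π (insert v A)) (insert v A) S (insert v Q) O (s₂.arr 1) ≤ _ :=
        potential_elim_insert (G := G) hπ hv (Or.inl ⟨rfl, rfl⟩)
      have e2' : s₂.arr 1 = Function.update (s.arr 1) v 0 := e2
      rw [e2'] at p2 hle
      have p3 := Nat.mul_le_mul_left R (p2.trans (Nat.add_le_add_right p1 _))
      rw [e4] at ht₁
      simp only [Test.cost, Expr.cost]
      simp only [mul_add] at p3 ⊢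
      omega
  | del v =>
    have hv : v ∈ A := hu
    simp only [Update.vertex, Update.apply] at hM ⊢
    set s₁ := (((s.setReg 1 v).setReg 2 0).setReg 20 1) with hs₁
    have e4 : s₁.reg 4 = s.reg 4 := by simp [hs₁]
    obtain ⟨c, t₁, s₂, hx₁, ht₁, Q₂, h2, hi2, hp, r2⟩ := deleteProgram_halts (G := G) (s := s₁)
      (e := elim G π (A.erase v)) hb (hr.load v 0) hi hv (by simp [hs₁]) (fun u hu huv e => by
        have := lfmis_subset G π (A.erase v) (elim_mem hπ (Finset.mem_erase.2 ⟨huv, hu⟩))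
        rw [e] at this
        exact Finset.notMem_erase v A this)
    have ho2 : OldLast π (elim G π (A.erase v)) (S.erase v) (O.erase v) := fun u hu he w hw =>
      hs.oldLast hi.O_sub _ u (Finset.mem_of_mem_erase hu) he w (Finset.mem_of_mem_erase hw)
    obtain ⟨t₂, s', S', Q', O', hx₂, h', hi', hs', hle⟩ := mainLoop_exec hπ hb hk h2 hi2 ho2
      (hR _ h2.height_le) ((r2 20 (by omega) (by omega) (by omega)).trans (by simp [hs₁]))
    refine ⟨_, s', _, .seq (.assign _ _ _ ?_) (.seq (.ite_false ?_ ?_ hx₁) hx₂),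
      ⟨S', Q', O', h', hi', hs', rfl⟩, ?_⟩
    · simp only [Expr.Fits]; omega
    · simp [Test.Fits, Expr.Fits, Update.load]; omega
    · simp [Test.Holds, Expr.eval, Update.load]
    -- Deletion: the eliminators are exchanged before the vertex is removed, so that the release of
    -- its followers lowers the potential.
    · have p2 : potential (elim G π (A.erase v)) (insert v (A.erase v)) S Q O (s.arr 1) ≤ _ :=
        potential_elim_insert (G := G) hπ (Finset.notMem_erase v A) (Or.inr ⟨rfl, rfl⟩)
      rw [Finset.insert_erase hv] at p2
      have hp' : potential (elim G π (A.erase v)) (A.erase v) (S.erase v) Q₂ (O.erase v)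
        (s₂.arr 1) + c ≤ potential (elim G π (A.erase v)) A S Q O (s.arr 1) + 3 := hp
      have p3 := Nat.mul_le_mul_left R (hp'.trans (Nat.add_le_add_right p2 _))
      have p4 : (100 * s.reg 4 + 150) * c ≤ R * c := Nat.mul_le_mul_right c (by omega)
      rw [e4] at ht₁
      simp only [Test.cost, Expr.cost]
      simp only [mul_add] at p3 ⊢
      omega

/-- The work caused by a stream of updates from the active set `A` on. -/
noncomputable def work (G : SimpleGraph ℕ) (π : ℕ → unitInterval) : Finset ℕ → List Update → ℕ
  | _, [] => 0
  | A, u :: L => 6 * changes π G (A.erase u.vertex) u.vertex + 20 + work G π (u.apply A) L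

/-- The potentials telescope. The bound `M` on the active vertices occurs only in the analysis,
through `R`. -/
theorem dynamicProgram_run (hπ : Function.Injective π) (hb : Bounds W B M k) (hk : 1 ≤ k)
    {R : ℕ} (hR : ∀ h, 2 ^ h ≤ 2 * M + 1 → 200 * h + 70 * k + 400 ≤ R) {L : List Update}
    {P : ℕ} (h : Waiting G π B M k A s P) (hL : ValidFrom A L) (hB : ∀ u ∈ L, u.vertex < B)
    (hM : ∀ t ≤ L.length, ((L.take t).foldl Update.apply A).card ≤ M) :
    ∃ t s' P', Run W G π dynamicProgram s L t s' ∧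
      Waiting G π B M k (L.foldl Update.apply A) s' P' ∧ t + R * P' ≤ R * P + R * work G π A L := by
  induction L generalizing A s P with
  | nil => exact ⟨0, s, P, .nil s, h, by simp⟩
  | cons u L ih =>
    rw [validFrom_cons] at hL
    obtain ⟨t₁, s₁, P₁, hx, h1, hle₁⟩ := dynamicProgram_exec hπ hb hk hR h hL.1
      (hB u (by simp)) (by simpa using hM 1 (by simp))
    obtain ⟨t₂, s₂, P₂, hx₂, h2, hle₂⟩ := ih h1 hL.2 (fun u' hu' => hB u' (by simp [hu']))
      fun t ht => by simpa using hM (t + 1) (by simpa using ht)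
    refine ⟨_, s₂, P₂, .cons hx hx₂, h2, ?_⟩
    rw [work, mul_add]
    omega

theorem ValidFrom.take {L : List Update} (h : ValidFrom A L) (m : ℕ) : ValidFrom A (L.take m) := by
  induction L generalizing A m with
  | nil => simpa using h
  | cons u L ih =>
    cases m with
    | zero => trivial
    | succ m =>
      rw [List.take_succ_cons, validFrom_cons]
      rw [validFrom_cons] at h
      exact ⟨h.1, ih h.2 m⟩

/-- The machine uses the ranks of words only. -/
theorem Exec.congr {π π' : ℕ → unitInterval} (hπ : ∀ a < W, ∀ b < W, π a < π b ↔ π' a < π' b)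
    {p : Program} {s s' : State} {t : ℕ} (h : Exec W G π p s t s') : Exec W G π' p s t s' := by
  -- A rank is only ever requested for the value of an expression that fits into a word.
  have hfit : ∀ (x : Expr) (s : State), x.Fits W s → x.eval s < W := by
    intro x s hx
    cases x with
    | lit n => exact hx
    | reg r => exact hx
    | read a i => exact hx.2
    | bin o x y => exact hx.2.2
  have htest : ∀ (b : Test) (s : State), b.Fits W s → (b.Holds G π s ↔ b.Holds G π' s) := by
    intro b s hb
    induction b with
    | lt | eq | adj => rfl
    | rankLt x y => exact hπ _ (hfit x s hb.1) _ (hfit y s hb.2)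
    | not b ih => exact not_congr (ih hb)
    | and b c ihb ihc => exact and_congr (ihb hb.1) (ihc hb.2)
  induction h with
  | skip s => exact .skip s
  | assign s r x hx => exact .assign s r x hx
  | write s a i x hi hx => exact .write s a i x hi hx
  | seq _ _ ih1 ih2 => exact .seq ih1 ih2
  | ite_true hf hb _ ih => exact .ite_true hf ((htest _ _ hf).1 hb) ih
  | ite_false hf hb _ ih => exact .ite_false hf (fun h => hb ((htest _ _ hf).2 h)) ih
  | while_true hf hb _ _ ih1 ih2 => exact .while_true hf ((htest _ _ hf).1 hb) ih1 ih2
  | while_false hf hb => exact .while_false hf fun h => hb ((htest _ _ hf).2 h)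

theorem Run.congr {π π' : ℕ → unitInterval} (hπ : ∀ a < W, ∀ b < W, π a < π b ↔ π' a < π' b)
    {p : Program} {s s' : State} {L : List Update} {t : ℕ} (h : Run W G π p s L t s') :
    Run W G π' p s L t s' := by
  induction h with
  | nil s => exact .nil s
  | cons hu _ ih => exact .cons (hu.congr hπ) ih

theorem measurable_runTime (W : ℕ) (G : SimpleGraph ℕ) (p : Program) (k : ℕ) (L : List Update) :
    Measurable fun π : ℕ → unitInterval => runTime W G π p k L := by
  refine measurable_of_comparisons W _ fun π π' h => ?_
  have key : ∀ t, (∃ s, Run W G π p (initState k) L t s) ↔ ∃ s, Run W G π' p (initState k) L t s :=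
    fun t => ⟨fun ⟨s, hs⟩ => ⟨s, hs.congr h⟩,
      fun ⟨s, hs⟩ => ⟨s, hs.congr fun a ha b hb => (h a ha b hb).symm⟩⟩
  simp only [runTime, key]

theorem measurable_work (G : SimpleGraph ℕ) (L : List Update) (A : Finset ℕ) :
    Measurable fun π => (work G π A L : ℝ≥0∞) := by
  induction L generalizing A with
  | nil => simp [work]
  | cons u L ih =>
    simp only [work, Nat.cast_add, Nat.cast_mul]
    exact (((measurable_changes G _ _).const_mul _).add_const _).add (ih _)

/-- The active sets do not depend on the ranking, so the logarithmic bound applies to each update,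
and expectations add up. -/
theorem lintegral_work_le (G : SimpleGraph ℕ) {n : ℕ} (L : List Update) (A : Finset ℕ)
    (hL : ValidFrom A L) (hn : ∀ t ≤ L.length, ((L.take t).foldl Update.apply A).card ≤ n) :
    ∫⁻ π, (work G π A L : ℝ≥0∞) ∂rankingLaw ≤ L.length * (6 * ENNReal.ofReal (Real.log n) + 20) := by
  induction L generalizing A with
  | nil => simp [work]
  | cons u L ih =>
    rw [validFrom_cons] at hL
    have ih' := ih (u.apply A) hL.2 fun t ht => by simpa using hn (t + 1) (by simpa using ht)
    -- The larger of the active sets before and after the update.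
    have hcard : (insert u.vertex (A.erase u.vertex)).card ≤ n := by
      have h0 : A.card ≤ n := by simpa using hn 0 (by simp)
      have h1 : (u.apply A).card ≤ n := by simpa using hn 1 (by simp)
      cases u with
      | ins v =>
        have hv : v ∉ A := hL.1
        simpa [Update.vertex, Finset.erase_eq_of_notMem hv, Update.apply] using h1
      | del v =>
        have hv : v ∈ A := hL.1
        simpa [Update.vertex, Finset.insert_erase hv] using h0
    have h1 : ∫⁻ π, (changes π G (A.erase u.vertex) u.vertex : ℝ≥0∞) ∂rankingLaw ≤
        ENNReal.ofReal (Real.log n) := by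
      refine (lintegral_changes_le G _ _).trans (ENNReal.ofReal_le_ofReal ?_)
      exact Real.log_le_log (by exact_mod_cast Finset.card_pos.2 ⟨_, Finset.mem_insert_self _ _⟩)
        (by exact_mod_cast hcard)
    simp only [work, Nat.cast_add, Nat.cast_mul, Nat.cast_ofNat]
    rw [lintegral_add_right _ (measurable_work G L _), lintegral_add_right _ measurable_const,
      lintegral_const_mul _ (measurable_changes G _ _), lintegral_const, measure_univ, mul_one]
    calc _ ≤ 6 * ENNReal.ofReal (Real.log n) + 20 +
          L.length * (6 * ENNReal.ofReal (Real.log n) + 20) := by gcongr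
      _ = _ := by
        simp only [List.length_cons, Nat.cast_add, Nat.cast_one]; ring

end Stream
end DynLFMIS

namespace DynLFMIS

/-! ### Word size, numerical constants, and the theorem -/

section Total

theorem card_active_take_le (L : List Update) {t : ℕ} (ht : t ≤ L.length) :
    ((L.take t).foldl Update.apply ∅).card ≤ maxActive L :=
  Finset.le_sup (f := fun t => (active (L.take t)).card) (Finset.mem_range.2 (by omega))

theorem active_subset {L : List Update} {N : ℕ} (hL : ∀ u ∈ L, u.vertex ≤ N) {A : Finset ℕ}
    (hA : A ⊆ Finset.range (N + 1)) : L.foldl Update.apply A ⊆ Finset.range (N + 1) := by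
  induction L generalizing A with
  | nil => exact hA
  | cons u L ih =>
    refine ih (fun u' hu' => hL u' (by simp [hu'])) ?_
    have hu := hL u (by simp)
    cases u with
    | ins v =>
      refine Finset.insert_subset (Finset.mem_range.2 ?_) hA
      exact Nat.lt_succ_of_le hu
    | del v => exact (Finset.erase_subset _ _).trans hA

/-- With N the largest name, `B = N + k + 2` works: the active vertices lie in {0, …, N}, so there
are at most N + 1 < B of them. Since B ≥ 3, 100 B² ≤ 3⁶ B² ≤ B⁸, which explains the exponent 8. -/
theorem exists_bounds {k : ℕ} (hk : 1 ≤ k) {L : List Update} (hne : L ≠ []) {W : ℕ}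
    (hW : ∀ u ∈ L, (u.vertex + k + 2) ^ 8 ≤ W) :
    ∃ B, Bounds W B (maxActive L) k ∧ ∀ u ∈ L, u.vertex < B := by
  classical
  obtain ⟨u₀, hu₀, hmax⟩ := L.toFinset.exists_max_image Update.vertex
    (by obtain ⟨u, hu⟩ := List.exists_mem_of_ne_nil L hne; exact ⟨u, List.mem_toFinset.2 hu⟩)
  replace hmax : ∀ u ∈ L, u.vertex ≤ u₀.vertex := fun u hu => hmax u (List.mem_toFinset.2 hu)
  refine ⟨u₀.vertex + k + 2, ⟨by omega, ?_, ?_, by omega⟩, fun u hu => by have := hmax u hu; omega⟩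
  · refine le_trans ?_ (hW u₀ (List.mem_toFinset.1 hu₀))
    have h3 : 3 ^ 6 ≤ (u₀.vertex + k + 2) ^ 6 := Nat.pow_le_pow_left (by omega) 6
    calc 100 * ((u₀.vertex + k + 2) * (u₀.vertex + k + 2))
        ≤ (u₀.vertex + k + 2) ^ 6 * ((u₀.vertex + k + 2) * (u₀.vertex + k + 2)) :=
          Nat.mul_le_mul_right _ (by omega)
      _ = (u₀.vertex + k + 2) ^ 8 := by ring
  · refine lt_of_le_of_lt (b := u₀.vertex + 1) (Finset.sup_le fun t _ => ?_) (by omega)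
    have := Finset.card_le_card (active_subset (L := L.take t) (A := ∅)
      (fun u hu => hmax u (List.mem_of_mem_take hu)) (Finset.empty_subset _))
    rwa [Finset.card_range] at this

theorem one_le_maxActive {L : List Update} (hL : ValidStream L) (hne : L ≠ []) :
    1 ≤ maxActive L := by
  obtain ⟨u, L', rfl⟩ := List.exists_cons_of_ne_nil hne
  have h := card_active_take_le (u :: L') (t := 1) (by simp)
  cases u with
  | ins v => simpa [Update.apply] using h
  | del v => exact absurd hL.1 (by simp)

/-- The price of a unit of potential. -/
def price (n k : ℕ) : ℕ := 200 * Nat.log 2 (2 * n + 1) + 70 * k + 400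

theorem le_price (n k h : ℕ) (hh : 2 ^ h ≤ 2 * n + 1) : 200 * h + 70 * k + 400 ≤ price n k := by
  have := Nat.le_log_of_pow_le one_lt_two hh
  unfold price
  omega

/-- Write l = log(n + 1) ≥ log 2. Since 2n + 1 ≤ (n + 1)², the binary logarithm is at most 2l / log
2 ≤ 3l, so the price is at most 600 l + 470 k. Since 20 ≤ 30 log 2, the second factor is at most 36
l, and 600 · 36 = 21600. -/
theorem price_mul_le {n k : ℕ} (hn : 1 ≤ n) (hk : 1 ≤ k) :
    (price n k : ℝ) * (6 * Real.log n + 20) ≤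
      21600 * (k * Real.log (n + 1) + Real.log (n + 1) ^ 2) := by
  have hn' : (1 : ℝ) ≤ n := by exact_mod_cast hn
  have hk' : (1 : ℝ) ≤ k := by exact_mod_cast hk
  set l := Real.log (n + 1) with hl
  have h2 := Real.log_two_gt_d9
  have hl2 : Real.log 2 ≤ l := Real.log_le_log (by norm_num) (by linarith)
  have hln : Real.log n ≤ l := Real.log_le_log (by linarith) (by linarith)
  have hln0 : 0 ≤ Real.log n := Real.log_nonneg hn'
  have hlog : (Nat.log 2 (2 * n + 1) : ℝ) ≤ 3 * l := by
    have h1 : (2 : ℝ) ^ Nat.log 2 (2 * n + 1) ≤ (n + 1) ^ 2 := by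
      have : ((2 ^ Nat.log 2 (2 * n + 1) : ℕ) : ℝ) ≤ ((2 * n + 1 : ℕ) : ℝ) :=
        Nat.cast_le.2 (Nat.pow_log_le_self 2 (by omega))
      push_cast at this
      nlinarith
    have h3 := Real.log_le_log (by positivity) h1
    rw [Real.log_pow, Real.log_pow, ← hl] at h3
    push_cast at h3
    nlinarith [Nat.cast_nonneg (α := ℝ) (Nat.log 2 (2 * n + 1))]
  have hR : (price n k : ℝ) ≤ 600 * l + 470 * k := by
    unfold price
    push_cast
    linarith
  calc (price n k : ℝ) * (6 * Real.log n + 20) ≤ (600 * l + 470 * k) * (36 * l) :=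
        mul_le_mul hR (by linarith) (by linarith) (by nlinarith)
    _ ≤ _ := by nlinarith [mul_nonneg (Nat.cast_nonneg (α := ℝ) k) (by linarith : 0 ≤ l)]

/-- Almost every ranking has no ties; for these, the initial potential is 0 and the final one cannot
be negative, so the work times the price bounds the time. -/
theorem lintegral_runTime_le {k : ℕ} (hk : 1 ≤ k) (G : SimpleGraph ℕ) {L : List Update}
    (hL : ValidStream L) {W B : ℕ} (hb : Bounds W B (maxActive L) k) (hB : ∀ u ∈ L, u.vertex < B) :
    ∫⁻ π, runTime W G π dynamicProgram k L ∂rankingLaw ≤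
      (price (maxActive L) k : ℝ≥0∞) *
        (L.length * (6 * ENNReal.ofReal (Real.log (maxActive L)) + 20)) := by
  calc ∫⁻ π, runTime W G π dynamicProgram k L ∂rankingLaw
      ≤ ∫⁻ π, (price (maxActive L) k : ℝ≥0∞) * (work G π ∅ L : ℝ≥0∞) ∂rankingLaw := by
        refine lintegral_mono_ae (ae_injective_rankingLaw.mono fun π hπ => ?_)
        obtain ⟨t, s', P', hrun, -, hle⟩ := dynamicProgram_run hπ hb hk (le_price (maxActive L) k)
          (waiting_init G π B (maxActive L) k) hL hB fun t ht => card_active_take_le L ht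
        refine (iInf₂_le t ⟨s', hrun⟩).trans ?_
        have : t ≤ price (maxActive L) k * work G π ∅ L := by omega
        exact_mod_cast this
    _ = (price (maxActive L) k : ℝ≥0∞) * ∫⁻ π, (work G π ∅ L : ℝ≥0∞) ∂rankingLaw :=
        lintegral_const_mul _ (measurable_work G L ∅)
    _ ≤ _ := by
        gcongr
        exact lintegral_work_le G L ∅ hL fun t ht => card_active_take_le L ht

end Total
end DynLFMIS

open DynLFMIS in
theorem mainTheorem2 :
    ∃ (p : Program) (C c : ℕ),
      ∀ (k : ℕ) (_ : 1 ≤ k) (G : SimpleGraph ℕ) (L : List Update) (_ : ValidStream L)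
        (W : ℕ) (_ : ∀ u ∈ L, (u.vertex + k + 2) ^ c ≤ W),
        (∀ π : ℕ → unitInterval, Function.Injective π → ∀ m ≤ L.length,
          ∃ (t : ℕ) (s : State), Run W G π p (initState k) (L.take m) t s ∧
            Maintains G π (active (L.take m)) k s) ∧
        (Measurable fun π : ℕ → unitInterval => runTime W G π p k L) ∧
        ∫⁻ π, runTime W G π p k L ∂rankingLaw ≤
          ENNReal.ofReal (C * L.length *
            (k * Real.log (maxActive L + 1) + Real.log (maxActive L + 1) ^ 2)) := by
  refine ⟨dynamicProgram, 21600, 8, fun k hk G L hL W hW => ⟨?_, measurable_runTime _ _ _ _ _, ?_⟩⟩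
  · intro π hπ m hm
    -- An empty stream imposes no condition on the word size, but the program is not run on it
    -- either.
    by_cases hne : L = []
    · subst hne
      rw [List.take_nil]
      exact ⟨0, _, .nil _, (waiting_init G π 0 0 k).maintains hπ⟩
    · obtain ⟨B, hb, hB⟩ := exists_bounds hk hne hW
      obtain ⟨t, s, P, hrun, hwait, -⟩ := dynamicProgram_run hπ hb hk (le_price (maxActive L) k)
        (waiting_init G π B (maxActive L) k) (ValidFrom.take hL m)
        (fun u hu => hB u (List.mem_of_mem_take hu)) fun t ht => by
          rw [List.take_take]
          exact card_active_take_le L ((min_le_right _ _).trans hm)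
      exact ⟨t, s, hrun, hwait.maintains hπ⟩
  · by_cases hne : L = []
    · subst hne
      refine le_of_eq_of_le ?_ zero_le
      refine lintegral_eq_zero_of_ae_eq_zero (Filter.Eventually.of_forall fun π => ?_)
      refine le_antisymm ((iInf₂_le 0 ⟨_, .nil _⟩).trans ?_) zero_le
      simp
    · obtain ⟨B, hb, hB⟩ := exists_bounds hk hne hW
      have hn := one_le_maxActive hL hne
      refine (lintegral_runTime_le hk G hL hb hB).trans ?_
      have h0 : 0 ≤ Real.log (maxActive L) := Real.log_nonneg (by exact_mod_cast hn)
      have e : (price (maxActive L) k : ℝ≥0∞) *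
          (L.length * (6 * ENNReal.ofReal (Real.log (maxActive L)) + 20)) =
          ENNReal.ofReal (L.length *
            ((price (maxActive L) k : ℝ) * (6 * Real.log (maxActive L) + 20))) := by
        rw [ENNReal.ofReal_mul (by positivity), ENNReal.ofReal_mul (by positivity),
          ENNReal.ofReal_add (by positivity) (by norm_num), ENNReal.ofReal_mul (by norm_num),
          ENNReal.ofReal_natCast, ENNReal.ofReal_natCast, ENNReal.ofReal_ofNat,
          ENNReal.ofReal_ofNat]
        ring
      rw [e]
      refine ENNReal.ofReal_le_ofReal ?_
      calc (L.length : ℝ) * ((price (maxActive L) k : ℝ) * (6 * Real.log (maxActive L) + 20))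
          ≤ L.length * (21600 * (k * Real.log (maxActive L + 1) +
              Real.log (maxActive L + 1) ^ 2)) :=
            mul_le_mul_of_nonneg_left (price_mul_le hn hk) (Nat.cast_nonneg _)
        _ = _ := by push_cast; ring
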